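/- **Model.** Let $\nu_1,\nu_2,\dots$ (numbers of packets in messages) be i.i.d. integer random variables with $1\le\nu^{lower}\le\nu_i\le\nu^{upper}$ a.s., the law of $\nu_i$ and the bounds being fixed, and for $N\in\mathbb N$ put $\zeta(N)=\sup\{m:\nu_1+\dots+\nu_m\le N\}$. For each $N$ consider a single-server FIFO queue with the following data, whose parameters $\lambda,B,p$ may depend on $N$. Messages arrive with independent exponential interarrival times of rate $\lambda>0$; their service times are i.i.d. with distribution $B$ on $[0,\infty)$; each message is marked with probability $p\in[0,1]$; the interarrival times, service times and marks are all independent. Let $\zeta_1,\zeta_2,\dots$ be a strictly stationary ergodic sequence, independent of all these, in which every $\zeta_i$ has the distribution of $\zeta(N)$. If $\xi_i$ is the number of messages in the system immediately before the arrival of the $i$th message ($\xi_1=0$), that message joins the queue (is *processed*) if $\xi_i\le\zeta_i$ and is *refused* if $\xi_i>\zeta_i$. A message is *lost* if it is refused or marked (a marked message that is not refused still occupies the buffer and is served). Let $P_{\zeta(N)}$, $R_{\zeta(N)}$, $L_{\zeta(N)}$ be the numbers of processed, refused and lost messages among those arriving during the first busy period (the one started by the first message, which is itself counted). The loss probability is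 $$\Pi_{\zeta(N)}=\frac{\mathbf E L_{\zeta(N)}}{\mathbf E R_{\zeta(N)}+\mathbf E P_{\zeta(N)}}.$$ Write $\varrho_j=\varrho_j(N)=\lambda^j\int_0^\infty x^j\,dB(x)$ and $\varrho=\varrho_1$. **Theorem 5.3.** Let $N\to\infty$ and suppose that $\varrho=1+\varepsilon$ with $\varepsilon=\varepsilon(N)>0$, $\varepsilon\to0$, that $\varepsilon\,\zeta(N)\to C$ a.s. for a constant $C>0$, and that $p=p(N)\to0$. Assume also that $\varrho_3(N)$ is finite for every $N$ and bounded in $N$, and that the limit $\widetilde\varrho_2=\lim_{N\to\infty}\varrho_2(N)$ exists. (i) If $p/\varepsilon\to D$ for a constant $D\ge0$, then $$\Pi_{\zeta(N)}=\Big(D+\frac{e^{2C/\widetilde\varrho_2}}{e^{2C/\widetilde\varrho_2}-1}\Big)\varepsilon+o(\varepsilon).$$ (ii) If $p/\varepsilon\to\infty$, then $\Pi_{\zeta(N)}=p+O(\varepsilon)$. -/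

import Mathlib

open MeasureTheory ProbabilityTheory Filter Topology Asymptotics
open scoped ENNReal

namespace LossQueue

/-- `bufferSize ν N` is `ζ(N) = sup {m : ν₁ + ⋯ + ν_m ≤ N}`, where `ν 0, ν 1, …` are the numbers of
packets in the successive messages. The set is bounded as soon as all `ν i` are at least `1`. -/
noncomputable def bufferSize (ν : ℕ → ℕ) (N : ℕ) : ℕ :=
  sSup {m : ℕ | ∑ i ∈ Finset.range m, ν i ≤ N}

/-- The state of the system is the list of the residual service requirements of the messages
present, in the order of arrival (the head is in service). `serve q t` is the state reached from
`q` after the server has worked for a time `t` without new arrivals. -/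
noncomputable def serve : List ℝ → ℝ → List ℝ
  | [], _ => []
  | w :: q, t => if w ≤ t then serve q (t - w) else (w - t) :: q

/-- The state immediately before the arrival of message `i` (messages are numbered from `0`).
`τ i` is the time between the arrivals of messages `i` and `i + 1`, `χ i` is the service time of
message `i`, and message `i` joins the queue iff the number of messages it finds in the system is
at most `ζ i`. The system is empty before the arrival of message `0`. -/
noncomputable def state (τ χ : ℕ → ℝ) (ζ : ℕ → ℕ) : ℕ → List ℝ
  | 0 => []
  | i + 1 =>
    serve (if (state τ χ ζ i).length ≤ ζ i then state τ χ ζ i ++ [χ i] else state τ χ ζ i) (τ i)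

/-- The number `ξ i` of messages in the system immediately before the arrival of message `i`. -/
noncomputable def found (τ χ : ℕ → ℝ) (ζ : ℕ → ℕ) (i : ℕ) : ℕ := (state τ χ ζ i).length

/-- The messages that arrive during the first busy period (which message `0` initiates): those not
preceded by, and not themselves, a later message that finds the system empty. -/
def busyPeriod (τ χ : ℕ → ℝ) (ζ : ℕ → ℕ) : Set ℕ :=
  {i | ∀ j, 0 < j → j ≤ i → found τ χ ζ j ≠ 0}

/-- The messages of the busy period that are processed, that is, join the queue. -/
def processed (τ χ : ℕ → ℝ) (ζ : ℕ → ℕ) : Set ℕ :=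
  {i | i ∈ busyPeriod τ χ ζ ∧ found τ χ ζ i ≤ ζ i}

/-- The messages of the busy period that are refused because of buffer overflow. -/
def refused (τ χ : ℕ → ℝ) (ζ : ℕ → ℕ) : Set ℕ :=
  {i | i ∈ busyPeriod τ χ ζ ∧ ζ i < found τ χ ζ i}

/-- The messages of the busy period that are lost: refused, or marked (a marked message does occupy
the buffer if there is room for it, but is lost nevertheless). -/
def lost (τ χ : ℕ → ℝ) (ζ : ℕ → ℕ) (mark : ℕ → Bool) : Set ℕ :=
  {i | i ∈ busyPeriod τ χ ζ ∧ (ζ i < found τ χ ζ i ∨ mark i = true)}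

/-- The expected number of elements of a random set of messages. -/
noncomputable def expectedCard {Ω : Type*} [MeasurableSpace Ω] (μ : Measure Ω)
    (S : Ω → Set ℕ) : ℝ≥0∞ :=
  ∫⁻ ω, ((S ω).encard : ℝ≥0∞) ∂μ

/-- The loss probability `Π = E L / (E R + E P)`, where `L`, `R`, `P` are the numbers of lost,
refused and processed messages during a busy period. -/
noncomputable def lossProbability {Ω : Type*} [MeasurableSpace Ω] (μ : Measure Ω)
    (τ χ : ℕ → Ω → ℝ) (ζ : ℕ → Ω → ℕ) (mark : ℕ → Ω → Bool) : ℝ :=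
  (expectedCard μ (fun ω => lost (τ · ω) (χ · ω) (ζ · ω) (mark · ω)) /
    (expectedCard μ (fun ω => refused (τ · ω) (χ · ω) (ζ · ω)) +
      expectedCard μ (fun ω => processed (τ · ω) (χ · ω) (ζ · ω)))).toReal

/-- The number of packets per message: `ν 0, ν 1, …` are independent and identically distributed,
and bounded: `1 ≤ lo ≤ ν i ≤ up` almost surely. -/
structure IsPacketSequence {Ω : Type*} [MeasurableSpace Ω] (P : Measure Ω)
    (ν : ℕ → Ω → ℕ) (lo up : ℕ) : Prop where
  measurable : ∀ i, Measurable (ν i)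
  indep : iIndepFun ν P
  identDistrib : ∀ i, IdentDistrib (ν i) (ν 0) P P
  one_le : 1 ≤ lo
  bounds : ∀ i, ∀ᵐ ω ∂P, lo ≤ ν i ω ∧ ν i ω ≤ up

/-- The random data of the `M/GI/1` system with a random number of waiting places: interarrival
times `τ i`, exponential with rate `lam`; service times `χ i` with law `B`; marks `mark i`, true
with probability `p`; all these are independent. The sequence `ζ 0, ζ 1, …` is strictly stationary
and ergodic, independent of the rest, and its members have the distribution `law`. -/
structure IsLossSystem {Ω : Type*} [MeasurableSpace Ω] (μ : Measure Ω)
    (lam : ℝ) (B : Measure ℝ) (p : ℝ) (law : ℕ → ℝ≥0∞)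
    (τ χ : ℕ → Ω → ℝ) (ζ : ℕ → Ω → ℕ) (mark : ℕ → Ω → Bool) : Prop where
  measurable_τ : ∀ i, Measurable (τ i)
  measurable_χ : ∀ i, Measurable (χ i)
  measurable_ζ : ∀ i, Measurable (ζ i)
  measurable_mark : ∀ i, Measurable (mark i)
  law_τ : ∀ i, μ.map (τ i) = expMeasure lam
  law_χ : ∀ i, μ.map (χ i) = B
  law_mark : ∀ i, μ {ω | mark i ω = true} = ENNReal.ofReal p
  law_ζ : ∀ i j, μ {ω | ζ i ω = j} = law j
  ergodic_ζ : Ergodic (fun (x : ℕ → ℕ) (i : ℕ) => x (i + 1)) (μ.map (fun ω i => ζ i ω))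
  indep_messages : iIndepFun (fun i ω => (τ i ω, χ i ω, mark i ω)) μ
  indep_τ : ∀ i, IndepFun (τ i) (fun ω => (χ i ω, mark i ω)) μ
  indep_χ : ∀ i, IndepFun (χ i) (mark i) μ
  indep_ζ : IndepFun (fun ω i => (τ i ω, χ i ω, mark i ω)) (fun ω i => ζ i ω) μ

/-- `ϱ_j = λ ^ j * ∫ x ^ j dB(x)`; in particular `ϱ_1` is the offered load `ϱ`. -/
noncomputable def loadMoment (lam : ℝ) (B : Measure ℝ) (j : ℕ) : ℝ :=
  lam ^ j * ∫ x, x ^ j ∂B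

end LossQueue

/-!
# The loss probability in heavy traffic

Write `R` and `X` for the expected numbers of refused and of processed messages in the busy period.
Marks do not influence the queue, so the loss probability is `(R + p X) / (R + X)`
(`IsLossSystem.lossProbability_eq`). Everything rests on the workload `W` found by an arriving
message, which is the sum of the residual service times in the state. Between two arrivals `W` grows
by a service time if the message is processed, and then decreases at unit rate for an exponential
time. While the server is busy this gives one-step identities for the means of `W` and of
`exp (-θ λ W)`; at the end of the busy period the memoryless interarrival time accounts for the
boundary term.

* Summing the identity for `W` over the busy period gives `R = 1 + (ϱ - 1) X = 1 + ε X`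
  (`IsLossSystem.tsum_refR_eq`). It therefore suffices to find the limit of `R`
  (`loss_asymptotics`).
* Summing the identity for `exp (-θ λ W)` gives, with `θ = 2 ε / ρ₂`, for which the exponent is
  critical up to `o (ε ^ 2)`, that the sum `S` of the means of `exp (-θ λ W)` over the refused
  messages is `1 + o (R)` (`IsLossSystem.tsum_exp_balance`, `tendsto_laplace_sub`).
* The evolution of the queue up to message `i` uses only the service times of the messages that have
  begun their service. Given the queue length and the residual service time at the head, the service
  times of the waiting messages are therefore still independent with law `B`
  (`IsLossSystem.busyMean_hide`). A refused message finds more messages than its threshold, and at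
  most one more than the largest threshold so far. As the thresholds are close to `C / ε`, `S` is
  close to `R` times the power `C / ε` of the Laplace transform of the service time, that is, to
  `R exp (-2 C / ρ₂)` (`IsLossSystem.refR_le_add_badProb`, `IsLossSystem.le_refR_add_badProb`), and
  `R → exp (2 C / ρ₂)` follows (`tendsto_of_balance`, `tendsto_tsum_refR`). The residual service
  time at the head is the only part of `W` without a known law; long ones are rare by the third
  moment (`IsLossSystem.summable_headProb`).

The thresholds `ζ i` are random and arbitrarily dependent, but by Hoeffding's inequality `ζ(N)` lies
in an interval of width `o (N)` around `N / E ν` up to a probability smaller than any power of `N`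
(`IsPacketSequence.exists_thresholds`), and `ε N → C E ν` by the Borel-Cantelli lemma
(`IsPacketSequence.tendsto_mul_nat`). That makes a union bound over the first `N ^ 16` messages
possible; that few messages follow in the same busy period comes from the choice `θ = 4 ε`, for
which `exp (-θ λ W)` has drift at least `ε ^ 2`
(`IsLossSystem.sum_busyProb_le`, `exists_sum_busyProb_le`, `tendsto_badProb`).
-/

namespace LossQueue

/-! ### Lists of residual service times -/

/-- The σ-algebra on the lists of real numbers that makes the length and all entries (read as `0`
beyond the end of the list) measurable. -/
instance listMeasurableSpace : MeasurableSpace (List ℝ) :=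
  MeasurableSpace.comap (fun q : List ℝ => (q.length, fun j : ℕ => q.getD j 0)) inferInstance

lemma measurable_list_iff {α : Type*} [MeasurableSpace α] {f : α → List ℝ} :
    Measurable f ↔
      Measurable (fun a => (f a).length) ∧ ∀ j, Measurable (fun a => (f a).getD j 0) := by
  rw [measurable_comap_iff]
  constructor
  · intro h
    exact ⟨measurable_fst.comp h, fun j => (measurable_pi_apply j).comp (measurable_snd.comp h)⟩
  · rintro ⟨h1, h2⟩
    exact h1.prodMk (measurable_pi_lambda _ h2)

@[fun_prop]
lemma measurable_length : Measurable (fun q : List ℝ => q.length) :=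
  (measurable_list_iff.1 measurable_id).1

@[fun_prop]
lemma measurable_getD (j : ℕ) : Measurable (fun q : List ℝ => q.getD j 0) :=
  (measurable_list_iff.1 measurable_id).2 j

lemma measurable_of_nat_index {α β : Type*} [MeasurableSpace α] [MeasurableSpace β]
    {n : α → ℕ} (hn : Measurable n) {g : ℕ → α → β} (hg : ∀ k, Measurable (g k)) :
    Measurable (fun a => g (n a) a) :=
  (measurable_from_prod_countable_right (f := fun x : ℕ × α => g x.1 x.2) hg).comp
    (hn.prodMk measurable_id)

@[fun_prop]
lemma measurable_list_cons {α : Type*} [MeasurableSpace α] {w : α → ℝ} {q : α → List ℝ}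
    (hw : Measurable w) (hq : Measurable q) : Measurable (fun a => w a :: q a) := by
  rw [measurable_list_iff]
  refine ⟨by simpa using (measurable_length.comp hq).add_const 1, fun j => ?_⟩
  cases j with
  | zero => simpa using hw
  | succ j =>
    simp only [List.getD_cons_succ]
    exact (measurable_getD j).comp hq

@[fun_prop]
lemma measurable_list_tail {α : Type*} [MeasurableSpace α] {q : α → List ℝ}
    (hq : Measurable q) : Measurable (fun a => (q a).tail) := by
  rw [measurable_list_iff]
  constructor
  · have : Measurable (fun a => (q a).length - 1) :=
      (measurable_from_nat (f := fun n => n - 1)).comp (measurable_length.comp hq)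
    simpa using this
  · intro j
    have : (fun a => (q a).tail.getD j 0) = fun a => (q a).getD (j + 1) 0 := by
      funext a
      cases q a <;> simp
    rw [this]
    exact (measurable_getD (j + 1)).comp hq

@[fun_prop]
lemma measurable_list_concat {α : Type*} [MeasurableSpace α] {q : α → List ℝ} {x : α → ℝ}
    (hq : Measurable q) (hx : Measurable x) : Measurable (fun a => q a ++ [x a]) := by
  have hl : Measurable (fun a => (q a).length) := measurable_length.comp hq
  rw [measurable_list_iff]
  refine ⟨by simpa using hl.add_const 1, fun j => ?_⟩
  have : (fun a => (q a ++ [x a]).getD j 0) =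
      fun a => if j < (q a).length then (q a).getD j 0 else
        if j = (q a).length then x a else 0 := by
    funext a
    split_ifs with h1 h2
    · rw [List.getD_append _ _ _ _ h1]
    · rw [List.getD_append_right _ _ _ _ (by omega)]; simp [h2]
    · rw [List.getD_append_right _ _ _ _ (by omega)]
      exact List.getD_eq_default _ _ (by simp; omega)
  rw [this]
  refine Measurable.ite (hl (measurableSet_Ioi (a := j))) ((measurable_getD j).comp hq) ?_
  exact Measurable.ite (measurableSet_eq_fun measurable_const hl) hx measurable_const

lemma measurable_list_sum_map {ψ : ℝ → ℝ} (hψ : Measurable ψ) :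
    Measurable (fun q : List ℝ => (q.map ψ).sum) := by
  have : (fun q : List ℝ => (q.map ψ).sum) =
      fun q => ∑ j ∈ Finset.range q.length, ψ (q.getD j 0) := by
    funext q
    induction q with
    | nil => simp
    | cons w q ih => simp [Finset.sum_range_succ', ih, add_comm]
  rw [this]
  exact measurable_of_nat_index measurable_length
    (g := fun n q => ∑ j ∈ Finset.range n, ψ (q.getD j 0))
    fun n => Finset.measurable_fun_sum _ fun j _ => hψ.comp (measurable_getD j)

@[fun_prop]
lemma measurable_list_sum : Measurable (fun q : List ℝ => q.sum) := by
  simpa using measurable_list_sum_map measurable_id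

lemma serve_eq_ite (q : List ℝ) (t : ℝ) :
    serve q t = if q.length = 0 then [] else
      if q.getD 0 0 ≤ t then serve q.tail (t - q.getD 0 0) else (q.getD 0 0 - t) :: q.tail := by
  cases q <;> simp [serve]

lemma measurableSet_length_eq {α : Type*} [MeasurableSpace α] {q : α → List ℝ}
    (hq : Measurable q) (n : ℕ) : MeasurableSet {a | (q a).length = n} :=
  (measurable_length.comp hq) (measurableSet_singleton n)

@[fun_prop]
lemma measurable_serve {α : Type*} [MeasurableSpace α] {q : α → List ℝ} {t : α → ℝ}
    (hq : Measurable q) (ht : Measurable t) : Measurable (fun a => serve (q a) (t a)) := by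
  -- On lists of length at most `n` the recursion unfolds `n` times.
  have key : ∀ n : ℕ, ∃ F : List ℝ × ℝ → List ℝ, Measurable F ∧
      ∀ q t, q.length = n → F (q, t) = serve q t := by
    intro n
    induction n with
    | zero =>
      refine ⟨fun _ => [], measurable_const, fun q t h => ?_⟩
      rw [List.length_eq_zero_iff.1 h]; rfl
    | succ n ih =>
      obtain ⟨F, hF, hFe⟩ := ih
      refine ⟨fun x => if x.1.getD 0 0 ≤ x.2 then F (x.1.tail, x.2 - x.1.getD 0 0)
        else (x.1.getD 0 0 - x.2) :: x.1.tail, ?_, ?_⟩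
      · have h0 : Measurable (fun x : List ℝ × ℝ => x.1.getD 0 0) :=
          (measurable_getD 0).comp measurable_fst
        refine Measurable.ite (measurableSet_le h0 measurable_snd) ?_ ?_
        · exact hF.comp ((measurable_list_tail measurable_fst).prodMk (measurable_snd.sub h0))
        · exact measurable_list_cons (h0.sub measurable_snd) (measurable_list_tail measurable_fst)
      · intro q t h
        rw [serve_eq_ite q t, if_neg (by omega)]
        simp only
        rw [hFe _ _ (by simp [h])]
  choose F hF hFe using key
  have : (fun a => serve (q a) (t a)) = fun a => F (q a).length (q a, t a) := by
    funext a
    rw [hFe _ _ _ rfl]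
  rw [this]
  exact measurable_of_nat_index (measurable_length.comp hq)
    (g := fun n a => F n (q a, t a)) fun n => (hF n).comp (hq.prodMk ht)

lemma serve_nonneg {q : List ℝ} (hq : ∀ w ∈ q, 0 ≤ w) (t : ℝ) : ∀ w ∈ serve q t, 0 ≤ w := by
  induction q generalizing t with
  | nil => simp [serve]
  | cons w q ih =>
    simp only [List.mem_cons, forall_eq_or_imp] at hq
    simp only [serve]
    split_ifs with h
    · exact ih hq.2 _
    · simp only [List.mem_cons, forall_eq_or_imp]
      exact ⟨by linarith, hq.2⟩

lemma length_serve_le (q : List ℝ) (t : ℝ) : (serve q t).length ≤ q.length := by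
  induction q generalizing t with
  | nil => simp [serve]
  | cons w q ih =>
    simp only [serve]
    split_ifs with h
    · exact (ih _).trans (by simp)
    · simp

lemma sum_serve {q : List ℝ} (hq : ∀ w ∈ q, 0 ≤ w) {t : ℝ} (ht : 0 ≤ t) :
    (serve q t).sum = max (q.sum - t) 0 := by
  induction q generalizing t with
  | nil => simp [serve, ht]
  | cons w q ih =>
    simp only [List.mem_cons, forall_eq_or_imp] at hq
    have hs : 0 ≤ q.sum := List.sum_nonneg hq.2
    simp only [serve]
    split_ifs with h
    · rw [ih hq.2 (by linarith), List.sum_cons]; congr 1; ring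
    · rw [List.sum_cons, List.sum_cons, max_eq_left (by linarith)]; ring

/-- The server is idle after a time `t` iff the workload is at most `t`; messages with service time
zero that wait behind others do not matter, since they leave together with their predecessor. -/
lemma serve_eq_nil_iff {q : List ℝ} (hq : ∀ w ∈ q, 0 ≤ w) {t : ℝ} (ht : 0 ≤ t) :
    serve q t = [] ↔ q.sum ≤ t := by
  induction q generalizing t with
  | nil => simp [serve, ht]
  | cons w q ih =>
    simp only [List.mem_cons, forall_eq_or_imp] at hq
    have hs : 0 ≤ q.sum := List.sum_nonneg hq.2
    simp only [serve]
    split_ifs with h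
    · rw [ih hq.2 (by linarith), List.sum_cons]; constructor <;> intro <;> linarith
    · simp only [List.sum_cons, false_iff, not_le]; linarith

/-- The excess of the service requirements over the level `M`, summed over the messages in the
system; it decreases at unit rate while the residual service time of the head exceeds `M`. -/
noncomputable def excess (M : ℝ) (q : List ℝ) : ℝ := (q.map fun w => max (w - M) 0).sum

@[fun_prop]
lemma measurable_excess (M : ℝ) : Measurable (excess M) :=
  measurable_list_sum_map (by fun_prop)

lemma excess_nonneg (M : ℝ) (q : List ℝ) : 0 ≤ excess M q :=
  List.sum_nonneg (by simp)

/-- While the residual service time of the head exceeds `M`, the work done reduces the excess. -/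
lemma excess_serve_add_le {M : ℝ} (hM : 0 ≤ M) {q : List ℝ} (hq : ∀ w ∈ q, 0 ≤ w) {t : ℝ}
    (ht : 0 ≤ t) :
    excess M (serve q t) + min t (max (q.getD 0 0 - M) 0) ≤ excess M q := by
  induction q generalizing t with
  | nil => simp [serve, excess, ht, hM]
  | cons w q ih =>
    simp only [List.mem_cons, forall_eq_or_imp] at hq
    have e1 : excess M (w :: q) = max (w - M) 0 + excess M q := by simp [excess]
    simp only [serve, List.getD_cons_zero]
    split_ifs with h
    · have h1 := ih hq.2 (t := t - w) (by linarith)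
      have h2 : 0 ≤ min (t - w) (max (q.getD 0 0 - M) 0) :=
        le_min (by linarith) (le_max_right _ _)
      have h3 := min_le_right t (max (w - M) 0)
      rw [e1]; linarith
    · push Not at h
      have e2 : excess M ((w - t) :: q) = max (w - t - M) 0 + excess M q := by simp [excess]
      rw [e1, e2]
      have : max (w - t - M) 0 + min t (max (w - M) 0) ≤ max (w - M) 0 := by
        rcases le_total (w - M) 0 with h1 | h1
        · rw [max_eq_right h1, max_eq_right (by linarith), min_eq_right ht]; simp
        · rw [max_eq_left h1]
          rcases le_total t (w - M) with h2 | h2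
          · rw [max_eq_left (by linarith), min_eq_left h2]; linarith
          · rw [max_eq_right (by linarith), min_eq_right h2]; linarith
      linarith

lemma excess_concat (M : ℝ) (q : List ℝ) (x : ℝ) :
    excess M (q ++ [x]) = excess M q + max (x - M) 0 := by
  simp [excess]

/-- The state just after an arrival: a message with service time `x` joins iff it finds at most `n`
messages in the system. -/
noncomputable def join (q : List ℝ) (x : ℝ) (n : ℕ) : List ℝ :=
  if q.length ≤ n then q ++ [x] else q

lemma state_succ (τ χ : ℕ → ℝ) (ζ : ℕ → ℕ) (i : ℕ) :
    state τ χ ζ (i + 1) = serve (join (state τ χ ζ i) (χ i) (ζ i)) (τ i) := rfl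

@[fun_prop]
lemma measurable_join {α : Type*} [MeasurableSpace α] {q : α → List ℝ} {x : α → ℝ} {n : α → ℕ}
    (hq : Measurable q) (hx : Measurable x) (hn : Measurable n) :
    Measurable (fun a => join (q a) (x a) (n a)) :=
  Measurable.ite (measurableSet_le (measurable_length.comp hq) hn)
    (measurable_list_concat hq hx) hq

lemma join_nonneg {q : List ℝ} (hq : ∀ w ∈ q, 0 ≤ w) {x : ℝ} (hx : 0 ≤ x) (n : ℕ) :
    ∀ w ∈ join q x n, 0 ≤ w := by
  intro w hw
  unfold join at hw
  split_ifs at hw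
  · simp only [List.mem_append, List.mem_singleton] at hw
    rcases hw with hw | rfl
    exacts [hq w hw, hx]
  · exact hq w hw

lemma state_nonneg {τ χ : ℕ → ℝ} (hχ : ∀ i, 0 ≤ χ i) (ζ : ℕ → ℕ) (i : ℕ) :
    ∀ w ∈ state τ χ ζ i, 0 ≤ w := by
  induction i with
  | zero => simp [state]
  | succ i ih => rw [state_succ]; exact serve_nonneg (join_nonneg ih (hχ i) _) _

lemma length_state_le (τ χ : ℕ → ℝ) {ζ : ℕ → ℕ} {i n : ℕ} (h : ∀ j < i, ζ j ≤ n) :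
    (state τ χ ζ i).length ≤ n + 1 := by
  induction i with
  | zero => simp [state]
  | succ i ih =>
    rw [state_succ]
    refine (length_serve_le _ _).trans ?_
    unfold join
    have h1 := ih fun j hj => h j (by omega)
    have h2 := h i (by omega)
    split_ifs with h3
    · simp; omega
    · exact h1

/-! ### Averaging over unrevealed service times -/

/-- The mean of `φ [x₁, …, x_m]` for independent `x₁, …, x_m` with distribution `B`. -/
noncomputable def iidMean (B : Measure ℝ) : ℕ → (List ℝ → ℝ≥0∞) → ℝ≥0∞
  | 0, φ => φ []
  | m + 1, φ => ∫⁻ x, iidMean B m (fun y => φ (x :: y)) ∂B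

/-- The function of the state obtained from `φ` by averaging over the service times of all messages
but the one in service: only the residual service time of the head and the number of messages are
kept. -/
noncomputable def hide (B : Measure ℝ) (φ : List ℝ → ℝ≥0∞) : List ℝ → ℝ≥0∞
  | [] => φ []
  | w :: q => iidMean B q.length (fun y => φ (w :: y))

section iid

variable {B : Measure ℝ}

lemma iidMean_congr {m : ℕ} {φ ψ : List ℝ → ℝ≥0∞} (h : ∀ y, y.length = m → φ y = ψ y) :
    iidMean B m φ = iidMean B m ψ := by
  induction m generalizing φ ψ with
  | zero => exact h [] rfl
  | succ m ih =>
    exact lintegral_congr fun x => ih fun y hy => h _ (by simp [hy])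

lemma iidMean_const [IsProbabilityMeasure B] (m : ℕ) (c : ℝ≥0∞) : iidMean B m (fun _ => c) = c := by
  induction m with
  | zero => rfl
  | succ m ih => simp [iidMean, ih]

lemma iidMean_const_mul (m : ℕ) {c : ℝ≥0∞} (hc : c ≠ ∞) (φ : List ℝ → ℝ≥0∞) :
    iidMean B m (fun y => c * φ y) = c * iidMean B m φ := by
  induction m generalizing φ with
  | zero => rfl
  | succ m ih => simp only [iidMean, ih, lintegral_const_mul' _ _ hc]

lemma measurable_iidMean [IsProbabilityMeasure B] {α : Type*} [MeasurableSpace α] (m : ℕ)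
    {φ : α → List ℝ → ℝ≥0∞}
    (hφ : Measurable (Function.uncurry φ)) : Measurable (fun a => iidMean B m (φ a)) := by
  -- The space of parameters grows with the number of variables integrated out: it is `List ℝ`
  -- that collects them.
  have key : ∀ (m : ℕ) (f : α × List ℝ → List ℝ → ℝ≥0∞), Measurable (Function.uncurry f) →
      Measurable (fun a => iidMean B m (f a)) := by
    intro m
    induction m with
    | zero =>
      intro f hf
      exact hf.comp (measurable_id.prodMk measurable_const)
    | succ m ih =>
      intro f hf
      have h1 : Measurable (fun a : α × List ℝ =>
          iidMean B m (fun y => f (a.1, a.2.tail) (a.2.getD 0 0 :: y))) := by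
        refine ih (fun a y => f (a.1, a.2.tail) (a.2.getD 0 0 :: y)) ?_
        have : Measurable (fun x : (α × List ℝ) × List ℝ =>
            ((x.1.1, x.1.2.tail), x.1.2.getD 0 0 :: x.2)) := by
          refine Measurable.prodMk ?_ ?_
          · exact (measurable_fst.comp measurable_fst).prodMk
              (measurable_list_tail (measurable_snd.comp measurable_fst))
          · exact measurable_list_cons ((measurable_getD 0).comp
              (measurable_snd.comp measurable_fst)) measurable_snd
        exact hf.comp this
      have h2 : Measurable (fun x : (α × List ℝ) × ℝ => ((x.1.1, x.2 :: x.1.2) : α × List ℝ)) :=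
        (measurable_fst.comp measurable_fst).prodMk
          (measurable_list_cons measurable_snd (measurable_snd.comp measurable_fst))
      have h3 := (h1.comp h2).lintegral_prod_right' (ν := B)
      simpa [iidMean] using h3
  exact (key m (fun a y => φ a.1 y) (hφ.comp
    ((measurable_fst.comp measurable_fst).prodMk measurable_snd))).comp
    (measurable_id.prodMk (measurable_const (a := ([] : List ℝ))))

lemma measurable_hide [IsProbabilityMeasure B] {α : Type*} [MeasurableSpace α]
    {φ : α → List ℝ → ℝ≥0∞}
    (hφ : Measurable (Function.uncurry φ)) :
    Measurable (Function.uncurry fun a => hide B (φ a)) := by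
  have : (Function.uncurry fun a => hide B (φ a)) = fun x : α × List ℝ =>
      if x.2.length = 0 then φ x.1 [] else
        iidMean B (x.2.length - 1) (fun y => φ x.1 (x.2.getD 0 0 :: y)) := by
    funext ⟨a, q⟩
    cases q <;> simp [Function.uncurry, hide]
  rw [this]
  refine Measurable.ite (measurableSet_length_eq measurable_snd 0) ?_ ?_
  · exact hφ.comp (measurable_fst.prodMk measurable_const)
  · refine measurable_of_nat_index (measurable_length.comp measurable_snd)
      (g := fun n x => iidMean B (n - 1) (fun y => φ x.1 (x.2.getD 0 0 :: y))) fun n => ?_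
    refine measurable_iidMean (n - 1)
      (φ := fun x : α × List ℝ => fun y => φ x.1 (x.2.getD 0 0 :: y)) ?_
    exact hφ.comp ((measurable_fst.comp measurable_fst).prodMk
      (measurable_list_cons ((measurable_getD 0).comp (measurable_snd.comp measurable_fst))
        measurable_snd))

lemma iidMean_concat (m : ℕ) (φ : List ℝ → ℝ≥0∞) :
    iidMean B m (fun y => ∫⁻ x, φ (y ++ [x]) ∂B) = iidMean B (m + 1) φ := by
  induction m generalizing φ with
  | zero => rfl
  | succ m ih => exact lintegral_congr fun x => ih fun y => φ (x :: y)

lemma iidMean_lintegral [IsProbabilityMeasure B] (m : ℕ) {ν : Measure ℝ} [SFinite ν]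
    {F : ℝ → List ℝ → ℝ≥0∞}
    (hF : Measurable (Function.uncurry F)) :
    iidMean B m (fun y => ∫⁻ t, F t y ∂ν) = ∫⁻ t, iidMean B m (F t) ∂ν := by
  induction m generalizing F with
  | zero => rfl
  | succ m ih =>
    have h1 : ∀ x : ℝ, Measurable (Function.uncurry fun t y => F t (x :: y)) := fun x =>
      hF.comp (measurable_fst.prodMk (measurable_list_cons measurable_const measurable_snd))
    simp only [iidMean]
    rw [lintegral_congr fun x => ih (h1 x)]
    refine lintegral_lintegral_swap (Measurable.aemeasurable ?_)
    refine measurable_iidMean m (φ := fun a : ℝ × ℝ => fun y => F a.2 (a.1 :: y)) ?_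
    exact hF.comp ((measurable_snd.comp measurable_fst).prodMk
      (measurable_list_cons (measurable_fst.comp measurable_fst) measurable_snd))

lemma iidMean_exp_neg_sum (m : ℕ) (s : ℝ) :
    iidMean B m (fun y => ENNReal.ofReal (Real.exp (-(s * y.sum)))) =
      (∫⁻ x, ENNReal.ofReal (Real.exp (-(s * x))) ∂B) ^ m := by
  induction m with
  | zero => simp [iidMean]
  | succ m ih =>
    have : ∀ x : ℝ, iidMean B m (fun y => ENNReal.ofReal (Real.exp (-(s * (x :: y).sum)))) =
        ENNReal.ofReal (Real.exp (-(s * x))) *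
          iidMean B m (fun y => ENNReal.ofReal (Real.exp (-(s * y.sum)))) := by
      intro x
      rw [← iidMean_const_mul m ENNReal.ofReal_ne_top]
      congr 1; funext y
      rw [← ENNReal.ofReal_mul (Real.exp_nonneg _), ← Real.exp_add, List.sum_cons]
      congr 2; ring
    simp only [iidMean, this, ih]
    rw [lintegral_mul_const, pow_succ, mul_comm]
    fun_prop

/-- Serving a queue in which only the head has been revealed leads to such a queue again. -/
lemma iidMean_serve [IsProbabilityMeasure B] (φ : List ℝ → ℝ≥0∞) (m : ℕ) (w t : ℝ) :
    iidMean B m (fun y => φ (serve (w :: y) t)) =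
      iidMean B m (fun y => hide B φ (serve (w :: y) t)) := by
  induction m generalizing w t with
  | zero =>
    simp only [iidMean, serve]
    split_ifs <;> rfl
  | succ m ih =>
    by_cases h : w ≤ t
    · simp only [serve, h, if_true, iidMean]
      exact lintegral_congr fun x => ih x (t - w)
    · simp only [serve, h, if_false, hide]
      rw [iidMean_congr (φ := fun y => iidMean B y.length fun y => φ ((w - t) :: y))
        (ψ := fun _ => iidMean B (m + 1) fun y => φ ((w - t) :: y)) fun y hy => by rw [hy],
        iidMean_const]

/-- One step of the queue, averaged: from the state `q` just before the arrival of a message that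
finds the admission threshold `n` to the state just before the next arrival. -/
noncomputable def stepMean (B T : Measure ℝ) (n : ℕ) (φ : List ℝ → ℝ≥0∞) (q : List ℝ) : ℝ≥0∞ :=
  ∫⁻ t, ∫⁻ x, φ (serve (join q x n) t) ∂B ∂T

lemma measurable_stepMean [IsProbabilityMeasure B] {α : Type*} [MeasurableSpace α]
    {T : Measure ℝ} [SFinite T] {φ : α → List ℝ → ℝ≥0∞}
    (hφ : Measurable (Function.uncurry φ)) {n : α → ℕ} (hn : Measurable n) :
    Measurable (Function.uncurry fun a => stepMean B T (n a) (φ a)) := by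
  have h : Measurable (fun z : ((α × List ℝ) × ℝ) × ℝ =>
      φ z.1.1.1 (serve (join z.1.1.2 z.2 (n z.1.1.1)) z.1.2)) := by
    have h1 : Measurable fun z : ((α × List ℝ) × ℝ) × ℝ => z.1.1.1 := by fun_prop
    exact hφ.comp (h1.prodMk (measurable_serve (measurable_join (by fun_prop) (by fun_prop)
      (hn.comp h1)) (by fun_prop)))
  exact Measurable.lintegral_prod_right' (ν := T) (Measurable.lintegral_prod_right' (ν := B) h)

/-- The service times of the waiting messages remain unrevealed during one step. -/
lemma hide_stepMean [IsProbabilityMeasure B] {T : Measure ℝ} [SFinite T] {φ : List ℝ → ℝ≥0∞}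
    (hφ : Measurable φ) (n : ℕ) (q : List ℝ) :
    hide B (stepMean B T n φ) q = hide B (stepMean B T n (hide B φ)) q := by
  have hh : Measurable (hide B φ) :=
    (measurable_hide (B := B) (φ := fun _ : Unit => φ) (hφ.comp measurable_snd)).comp
      (measurable_const (a := ()) |>.prodMk measurable_id)
  cases q with
  | nil =>
    have : ∀ x t, hide B φ (serve [x] t) = φ (serve [x] t) := by
      intro x t
      simp only [serve]
      split_ifs <;> rfl
    change stepMean B T n φ [] = stepMean B T n (hide B φ) []
    simp [stepMean, join, this]
  | cons w q =>
    simp only [hide]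
    generalize q.length = m
    by_cases hm : m + 1 ≤ n
    · have key : ∀ ψ : List ℝ → ℝ≥0∞, Measurable ψ →
          iidMean B m (fun y => stepMean B T n ψ (w :: y)) =
            ∫⁻ t, iidMean B (m + 1) (fun y => ψ (serve (w :: y) t)) ∂T := by
        intro ψ hψ
        rw [iidMean_congr (ψ := fun y => ∫⁻ t, ∫⁻ x, ψ (serve (w :: (y ++ [x])) t) ∂B ∂T)
          (fun y hy => by simp [stepMean, join, hy, hm])]
        rw [iidMean_lintegral m (F := fun t y => ∫⁻ x, ψ (serve (w :: (y ++ [x])) t) ∂B)]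
        · exact lintegral_congr fun t => iidMean_concat m fun y => ψ (serve (w :: y) t)
        · refine Measurable.lintegral_prod_right' (ν := B)
            (f := fun z : (ℝ × List ℝ) × ℝ => ψ (serve (w :: (z.1.2 ++ [z.2])) z.1.1)) ?_
          exact hψ.comp (measurable_serve (measurable_list_cons measurable_const
            (measurable_list_concat (by fun_prop) (by fun_prop))) (by fun_prop))
      rw [key φ hφ, key _ hh]
      exact lintegral_congr fun t => iidMean_serve φ (m + 1) w t
    · have key : ∀ ψ : List ℝ → ℝ≥0∞, Measurable ψ →
          iidMean B m (fun y => stepMean B T n ψ (w :: y)) =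
            ∫⁻ t, iidMean B m (fun y => ψ (serve (w :: y) t)) ∂T := by
        intro ψ hψ
        rw [iidMean_congr (ψ := fun y => ∫⁻ t, ψ (serve (w :: y) t) ∂T)
          (fun y hy => by simp [stepMean, join, hy, hm])]
        exact iidMean_lintegral m (F := fun t y => ψ (serve (w :: y) t))
          (hψ.comp (measurable_serve (measurable_list_cons measurable_const measurable_snd)
            measurable_fst))
      rw [key φ hφ, key _ hh]
      exact lintegral_congr fun t => iidMean_serve φ m w t

end iid

/-! ### The queue as a killed Markov chain -/

lemma indepFun_prodMk_of_indepFun {Ω α β γ : Type*} [MeasurableSpace Ω] [MeasurableSpace α]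
    [MeasurableSpace β] [MeasurableSpace γ] {μ : Measure Ω} [IsProbabilityMeasure μ] {X : Ω → α}
    {Y : Ω → β} {Z : Ω → γ} (hX : Measurable X) (hY : Measurable Y) (hZ : Measurable Z)
    (h1 : IndepFun X Y μ) (h2 : IndepFun (fun ω => (X ω, Y ω)) Z μ) :
    IndepFun (fun ω => (Y ω, Z ω)) X μ := by
  have hYZ : IndepFun Y Z μ := h2.comp measurable_snd measurable_id
  have : IsProbabilityMeasure (μ.map X) := Measure.isProbabilityMeasure_map hX.aemeasurable
  have : IsProbabilityMeasure (μ.map Y) := Measure.isProbabilityMeasure_map hY.aemeasurable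
  have : IsProbabilityMeasure (μ.map Z) := Measure.isProbabilityMeasure_map hZ.aemeasurable
  rw [indepFun_iff_map_prod_eq_prod_map_map (by fun_prop) (by fun_prop)] at h1 h2 hYZ ⊢
  have e : (fun ω => ((Y ω, Z ω), X ω)) =
      (Prod.swap ∘ MeasurableEquiv.prodAssoc) ∘ fun ω => ((X ω, Y ω), Z ω) := by
    funext ω; rfl
  rw [e, ← Measure.map_map (by fun_prop) (by fun_prop), h2, h1, hYZ,
    ← Measure.map_map (by fun_prop) (by fun_prop), Measure.prodAssoc_prod, Measure.prod_swap]

section pathwise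

variable {Ω : Type*} {τ χ : ℕ → Ω → ℝ} {ζ : ℕ → Ω → ℕ}

/-- The event that message `i` arrives during the first busy period. -/
def inBusy (τ χ : ℕ → Ω → ℝ) (ζ : ℕ → Ω → ℕ) (i : ℕ) : Set Ω :=
  {ω | i ∈ busyPeriod (τ · ω) (χ · ω) (ζ · ω)}

lemma inBusy_zero : inBusy τ χ ζ 0 = Set.univ := by
  ext ω
  simp only [inBusy, busyPeriod, Set.mem_ofPred_eq, Set.mem_univ, iff_true]
  intro j h1 h2; omega

lemma mem_inBusy_succ {i : ℕ} {ω : Ω} : ω ∈ inBusy τ χ ζ (i + 1) ↔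
    ω ∈ inBusy τ χ ζ i ∧ (state (τ · ω) (χ · ω) (ζ · ω) (i + 1)).length ≠ 0 := by
  simp only [inBusy, busyPeriod, Set.mem_ofPred_eq, found]
  constructor
  · intro h
    exact ⟨fun j h1 h2 => h j h1 (by omega), h (i + 1) (by omega) le_rfl⟩
  · rintro ⟨h1, h2⟩ j hj hj'
    rcases Nat.lt_or_ge i j with h | h
    · obtain rfl : j = i + 1 := by omega
      exact h2
    · exact h1 j hj h

end pathwise

section measurability

variable {Ω : Type*} [MeasurableSpace Ω] {τ χ : ℕ → Ω → ℝ} {ζ : ℕ → Ω → ℕ}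

lemma measurable_state {i : ℕ} (hτ : ∀ j < i, Measurable (τ j)) (hχ : ∀ j < i, Measurable (χ j))
    (hζ : ∀ j, Measurable (ζ j)) : Measurable (fun ω => state (τ · ω) (χ · ω) (ζ · ω) i) := by
  induction i with
  | zero => exact measurable_const
  | succ i ih =>
    simp only [state_succ]
    exact measurable_serve (measurable_join (ih (fun j hj => hτ j (by omega))
      fun j hj => hχ j (by omega)) (hχ i (by omega)) (hζ i)) (hτ i (by omega))

lemma measurableSet_inBusy {i : ℕ} (hτ : ∀ j < i, Measurable (τ j))
    (hχ : ∀ j < i, Measurable (χ j)) (hζ : ∀ j, Measurable (ζ j)) :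
    MeasurableSet (inBusy τ χ ζ i) := by
  induction i with
  | zero => rw [inBusy_zero]; exact MeasurableSet.univ
  | succ i ih =>
    have : inBusy τ χ ζ (i + 1) = inBusy τ χ ζ i ∩
        {ω | (state (τ · ω) (χ · ω) (ζ · ω) (i + 1)).length = 0}ᶜ := by
      ext ω; rw [mem_inBusy_succ]; rfl
    rw [this]
    exact (ih (fun j hj => hτ j (by omega)) fun j hj => hχ j (by omega)).inter
      (measurableSet_length_eq (measurable_state hτ hχ hζ) 0).compl

end measurability

/-- The mean of `φ ζ S` over the event that message `i` arrives during the first busy period, where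
`S` is the state just before its arrival. -/
noncomputable def busyMean {Ω : Type*} [MeasurableSpace Ω] (μ : Measure Ω) (τ χ : ℕ → Ω → ℝ)
    (ζ : ℕ → Ω → ℕ) (i : ℕ) (φ : (ℕ → ℕ) → List ℝ → ℝ≥0∞) : ℝ≥0∞ :=
  ∫⁻ ω in inBusy τ χ ζ i, φ (ζ · ω) (state (τ · ω) (χ · ω) (ζ · ω) i) ∂μ

/-- The function `φ` with its value at the empty system replaced by `0`. -/
noncomputable def kill (φ : List ℝ → ℝ≥0∞) (q : List ℝ) : ℝ≥0∞ := if q.length = 0 then 0 else φ q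

lemma measurable_kill {α : Type*} [MeasurableSpace α] {φ : α → List ℝ → ℝ≥0∞}
    (hφ : Measurable (Function.uncurry φ)) :
    Measurable (Function.uncurry fun a => kill (φ a)) :=
  Measurable.ite (measurableSet_length_eq measurable_snd 0) measurable_const hφ

lemma hide_kill (B : Measure ℝ) (φ : List ℝ → ℝ≥0∞) : hide B (kill φ) = kill (hide B φ) := by
  funext q
  cases q <;> simp [hide, kill]

section past

variable {Ω : Type*} {τ χ : ℕ → Ω → ℝ} {ζ : ℕ → Ω → ℕ} {mark : ℕ → Ω → Bool}

/-- What is known just before the arrival of message `i`: the data of the previous messages, and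
all admission thresholds, past and future. -/
def past (τ χ : ℕ → Ω → ℝ) (ζ : ℕ → Ω → ℕ) (mark : ℕ → Ω → Bool) (i : ℕ) (ω : Ω) :
    (Finset.range i → ℝ × ℝ × Bool) × (ℕ → ℕ) :=
  (fun j => (τ j ω, χ j ω, mark j ω), fun j => ζ j ω)

lemma measurable_past_τ {i j : ℕ} (hj : j < i) :
    Measurable[MeasurableSpace.comap (past τ χ ζ mark i) inferInstance] (τ j) :=
  Measurable.comp
    (g := fun x : (Finset.range i → ℝ × ℝ × Bool) × (ℕ → ℕ) =>
      (x.1 ⟨j, Finset.mem_range.2 hj⟩).1) (by fun_prop) (comap_measurable _)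

lemma measurable_past_χ {i j : ℕ} (hj : j < i) :
    Measurable[MeasurableSpace.comap (past τ χ ζ mark i) inferInstance] (χ j) :=
  Measurable.comp
    (g := fun x : (Finset.range i → ℝ × ℝ × Bool) × (ℕ → ℕ) =>
      (x.1 ⟨j, Finset.mem_range.2 hj⟩).2.1) (by fun_prop) (comap_measurable _)

lemma measurable_past_ζ (i j : ℕ) :
    Measurable[MeasurableSpace.comap (past τ χ ζ mark i) inferInstance] (ζ j) :=
  Measurable.comp
    (g := fun x : (Finset.range i → ℝ × ℝ × Bool) × (ℕ → ℕ) => x.2 j)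
    (by fun_prop) (comap_measurable _)

lemma measurable_past_state (i : ℕ) :
    Measurable[MeasurableSpace.comap (past τ χ ζ mark i) inferInstance]
      (fun ω => state (τ · ω) (χ · ω) (ζ · ω) i) := by
  let _ := MeasurableSpace.comap (past τ χ ζ mark i) inferInstance
  exact measurable_state (fun j hj => measurable_past_τ hj) (fun j hj => measurable_past_χ hj)
    (measurable_past_ζ i)

lemma measurableSet_past_inBusy (i : ℕ) :
    MeasurableSet[MeasurableSpace.comap (past τ χ ζ mark i) inferInstance]
      (inBusy τ χ ζ i) := by
  let _ := MeasurableSpace.comap (past τ χ ζ mark i) inferInstance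
  exact measurableSet_inBusy (fun j hj => measurable_past_τ hj) (fun j hj => measurable_past_χ hj)
    (measurable_past_ζ i)

end past

namespace IsLossSystem

variable {Ω : Type*} [MeasurableSpace Ω] {μ : Measure Ω}
  {lam : ℝ} {B : Measure ℝ} {p : ℝ} {law : ℕ → ℝ≥0∞}
  {τ χ : ℕ → Ω → ℝ} {ζ : ℕ → Ω → ℕ} {mark : ℕ → Ω → Bool}

lemma measurable_state' (h : IsLossSystem μ lam B p law τ χ ζ mark) (i : ℕ) :
    Measurable (fun ω => state (τ · ω) (χ · ω) (ζ · ω) i) :=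
  measurable_state (fun j _ => h.measurable_τ j) (fun j _ => h.measurable_χ j) h.measurable_ζ

lemma measurableSet_inBusy' (h : IsLossSystem μ lam B p law τ χ ζ mark) (i : ℕ) :
    MeasurableSet (inBusy τ χ ζ i) :=
  measurableSet_inBusy (fun j _ => h.measurable_τ j) (fun j _ => h.measurable_χ j) h.measurable_ζ

variable [IsProbabilityMeasure μ]

lemma indepFun_past (h : IsLossSystem μ lam B p law τ χ ζ mark) (i : ℕ) :
    IndepFun (past τ χ ζ mark i) (fun ω => (τ i ω, χ i ω, mark i ω)) μ := by
  have hm : ∀ j, Measurable (fun ω => (τ j ω, χ j ω, mark j ω)) := fun j =>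
    (h.measurable_τ j).prodMk ((h.measurable_χ j).prodMk (h.measurable_mark j))
  have h1 := (h.indep_messages.indepFun_finset {i} (Finset.range i) (by simp) hm)
  have h1' : IndepFun (fun ω => (τ i ω, χ i ω, mark i ω))
      (fun ω (j : Finset.range i) => (τ j ω, χ j ω, mark j ω)) μ :=
    h1.comp (φ := fun f : (({i} : Finset ℕ) → ℝ × ℝ × Bool) => f ⟨i, by simp⟩) (ψ := id)
      (measurable_pi_apply _) measurable_id
  have h2 : IndepFun (fun ω => ((τ i ω, χ i ω, mark i ω),
      (fun (j : Finset.range i) => (τ j ω, χ j ω, mark j ω)))) (fun ω j => ζ j ω) μ :=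
    h.indep_ζ.comp (φ := fun f : ℕ → ℝ × ℝ × Bool => (f i, fun j : Finset.range i => f j))
      (ψ := id) (by fun_prop) measurable_id
  exact indepFun_prodMk_of_indepFun (hm i) (measurable_pi_lambda _ fun j => hm j)
    (measurable_pi_lambda _ h.measurable_ζ) h1' h2

lemma indepFun_of_measurable_past (h : IsLossSystem μ lam B p law τ χ ζ mark) (i : ℕ)
    {β : Type*} [MeasurableSpace β] {W : Ω → β}
    (hW : Measurable[MeasurableSpace.comap (past τ χ ζ mark i) inferInstance] W) :
    IndepFun W (fun ω => (τ i ω, χ i ω, mark i ω)) μ := by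
  rw [IndepFun_iff_Indep]
  exact indep_of_indep_of_le_left ((IndepFun_iff_Indep _ _ _).1 (h.indepFun_past i)) hW.comap_le

/-- A variable determined by the past, the interarrival time and the service time of message `i` are
independent. -/
lemma lintegral_past (h : IsLossSystem μ lam B p law τ χ ζ mark) (i : ℕ)
    {β : Type*} [MeasurableSpace β] {W : Ω → β}
    (hW : Measurable[MeasurableSpace.comap (past τ χ ζ mark i) inferInstance] W)
    (hW' : Measurable W) {F : β → ℝ → ℝ → ℝ≥0∞}
    (hF : Measurable (fun x : β × ℝ × ℝ => F x.1 x.2.1 x.2.2)) :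
    ∫⁻ ω, F (W ω) (τ i ω) (χ i ω) ∂μ =
      ∫⁻ ω, ∫⁻ t, ∫⁻ x, F (W ω) t x ∂B ∂(expMeasure lam) ∂μ := by
  have hχ := h.measurable_χ i
  have hτ := h.measurable_τ i
  have : IsProbabilityMeasure (μ.map W) := Measure.isProbabilityMeasure_map hW'.aemeasurable
  have : IsProbabilityMeasure B := h.law_χ i ▸ Measure.isProbabilityMeasure_map hχ.aemeasurable
  have : IsProbabilityMeasure (expMeasure lam) :=
    h.law_τ i ▸ Measure.isProbabilityMeasure_map hτ.aemeasurable
  have h1 : IndepFun W (fun ω => (τ i ω, χ i ω)) μ :=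
    (h.indepFun_of_measurable_past i hW).comp measurable_id
      (ψ := fun x : ℝ × ℝ × Bool => (x.1, x.2.1)) (by fun_prop)
  have h2 : IndepFun (τ i) (χ i) μ := (h.indep_τ i).comp measurable_id measurable_fst
  rw [indepFun_iff_map_prod_eq_prod_map_map (by fun_prop) (by fun_prop)] at h1 h2
  rw [h2, h.law_τ, h.law_χ] at h1
  calc ∫⁻ ω, F (W ω) (τ i ω) (χ i ω) ∂μ
      = ∫⁻ x, F x.1 x.2.1 x.2.2 ∂(μ.map fun ω => (W ω, (τ i ω, χ i ω))) := by
        rw [lintegral_map hF (by fun_prop)]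
    _ = ∫⁻ w, ∫⁻ t, ∫⁻ x, F w t x ∂B ∂(expMeasure lam) ∂(μ.map W) := by
        rw [h1, lintegral_prod _ hF.aemeasurable]
        refine lintegral_congr fun w => ?_
        exact lintegral_prod _ (hF.comp measurable_prodMk_left).aemeasurable
    _ = _ := by
        rw [lintegral_map _ hW']
        refine Measurable.lintegral_prod_right' (ν := expMeasure lam)
          (f := fun z : β × ℝ => ∫⁻ x, F z.1 z.2 x ∂B) ?_
        refine Measurable.lintegral_prod_right' (ν := B)
          (f := fun z : (β × ℝ) × ℝ => F z.1.1 z.1.2 z.2) ?_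
        exact hF.comp (g := fun x : β × ℝ × ℝ => F x.1 x.2.1 x.2.2)
          (f := fun z : (β × ℝ) × ℝ => (z.1.1, z.1.2, z.2)) (by fun_prop)

/-- The mean of a function of the state, the service time and the interarrival time of message `i`:
the latter two are independent of the former. -/
lemma lintegral_inBusy (h : IsLossSystem μ lam B p law τ χ ζ mark) (i : ℕ)
    {F : (ℕ → ℕ) → List ℝ → ℝ → ℝ → ℝ≥0∞}
    (hF : Measurable (fun x : (ℕ → ℕ) × List ℝ × ℝ × ℝ => F x.1 x.2.1 x.2.2.1 x.2.2.2)) :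
    ∫⁻ ω in inBusy τ χ ζ i,
        F (ζ · ω) (state (τ · ω) (χ · ω) (ζ · ω) i) (τ i ω) (χ i ω) ∂μ =
      busyMean μ τ χ ζ i (fun z q => ∫⁻ t, ∫⁻ x, F z q t x ∂B ∂(expMeasure lam)) := by
  classical
  have hA := h.measurableSet_inBusy' i
  let W : Ω → ℝ≥0∞ × (ℕ → ℕ) × List ℝ := fun ω =>
    ((inBusy τ χ ζ i).indicator 1 ω, (ζ · ω), state (τ · ω) (χ · ω) (ζ · ω) i)
  have hW' : Measurable W :=
    (measurable_one.indicator hA).prodMk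
      ((measurable_pi_lambda _ h.measurable_ζ).prodMk (h.measurable_state' i))
  have hW : Measurable[MeasurableSpace.comap (past τ χ ζ mark i) inferInstance] W := by
    let _ := MeasurableSpace.comap (past τ χ ζ mark i) inferInstance
    exact (measurable_one.indicator (measurableSet_past_inBusy i)).prodMk
      ((measurable_pi_lambda _ (measurable_past_ζ i)).prodMk (measurable_past_state i))
  have key := h.lintegral_past i hW hW'
    (F := fun w t x => w.1 * F w.2.1 w.2.2 t x) (by
      refine Measurable.mul (by fun_prop) (hF.comp
        (f := fun x : (ℝ≥0∞ × (ℕ → ℕ) × List ℝ) × ℝ × ℝ =>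
          (x.1.2.1, x.1.2.2, x.2.1, x.2.2)) (by fun_prop)))
  rw [busyMean, ← lintegral_indicator hA, ← lintegral_indicator hA]
  convert key using 2
  · funext ω
    by_cases hω : ω ∈ inBusy τ χ ζ i <;> simp [W, hω]
  · funext ω
    by_cases hω : ω ∈ inBusy τ χ ζ i <;> simp [W, hω]

/-- The transition of the killed chain. -/
lemma busyMean_succ (h : IsLossSystem μ lam B p law τ χ ζ mark) (i : ℕ)
    {φ : (ℕ → ℕ) → List ℝ → ℝ≥0∞} (hφ : Measurable (Function.uncurry φ)) :
    busyMean μ τ χ ζ (i + 1) φ =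
      busyMean μ τ χ ζ i (fun z => stepMean B (expMeasure lam) (z i) (kill (φ z))) := by
  have key := h.lintegral_inBusy i
    (F := fun z q t x => kill (φ z) (serve (join q x (z i)) t)) (by
      refine (measurable_kill hφ).comp (f := fun x : (ℕ → ℕ) × List ℝ × ℝ × ℝ =>
        (x.1, serve (join x.2.1 x.2.2.2 (x.1 i)) x.2.2.1)) ?_
      refine measurable_fst.prodMk (measurable_serve (measurable_join ?_ ?_ ?_) ?_) <;> fun_prop)
  unfold stepMean
  rw [← key, busyMean, ← lintegral_indicator (h.measurableSet_inBusy' _),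
    ← lintegral_indicator (h.measurableSet_inBusy' _)]
  refine lintegral_congr fun ω => ?_
  by_cases h1 : ω ∈ inBusy τ χ ζ i
  · by_cases h2 : (state (τ · ω) (χ · ω) (ζ · ω) (i + 1)).length = 0
    · rw [Set.indicator_of_notMem (fun h3 => (mem_inBusy_succ.1 h3).2 h2),
        Set.indicator_of_mem h1, ← state_succ, kill, if_pos h2]
    · rw [Set.indicator_of_mem (mem_inBusy_succ.2 ⟨h1, h2⟩), Set.indicator_of_mem h1, ← state_succ,
        kill, if_neg h2]
  · rw [Set.indicator_of_notMem (fun h3 => h1 (mem_inBusy_succ.1 h3).1),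
      Set.indicator_of_notMem h1]

/-- During the busy period, the service times of the waiting messages are independent, have the
distribution `B`, and are independent of the residual service time of the head, of the number of
messages, and of the admission thresholds. -/
lemma busyMean_hide (h : IsLossSystem μ lam B p law τ χ ζ mark) (i : ℕ)
    {φ : (ℕ → ℕ) → List ℝ → ℝ≥0∞} (hφ : Measurable (Function.uncurry φ)) :
    busyMean μ τ χ ζ i φ = busyMean μ τ χ ζ i (fun z => hide B (φ z)) := by
  have : IsProbabilityMeasure B :=
    h.law_χ 0 ▸ Measure.isProbabilityMeasure_map (h.measurable_χ 0).aemeasurable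
  have : IsProbabilityMeasure (expMeasure lam) :=
    h.law_τ 0 ▸ Measure.isProbabilityMeasure_map (h.measurable_τ 0).aemeasurable
  induction i generalizing φ with
  | zero => rfl
  | succ i ih =>
    have hz : Measurable (fun z : ℕ → ℕ => z i) := measurable_pi_apply i
    rw [h.busyMean_succ i hφ, h.busyMean_succ i (measurable_hide hφ),
      ih (measurable_stepMean (measurable_kill hφ) hz),
      ih (measurable_stepMean (measurable_kill (measurable_hide hφ)) hz)]
    congr 1
    funext z q
    have hk : Measurable (kill (φ z)) := (measurable_kill hφ).comp measurable_prodMk_left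
    rw [hide_stepMean hk, hide_kill]

end IsLossSystem

/-! ### Exponential interarrival times -/

lemma ae_nonneg_expMeasure (lam : ℝ) : ∀ᵐ t ∂(expMeasure lam), 0 ≤ t := by
  rw [ae_iff]
  have : {t : ℝ | ¬ 0 ≤ t} = Set.Iio 0 := by ext; simp
  rw [this]
  change (volume.withDensity (exponentialPDF lam)) (Set.Iio 0) = 0
  rw [withDensity_apply _ measurableSet_Iio]
  exact lintegral_exponentialPDF_of_nonpos le_rfl

/-- The fundamental theorem of calculus for integrals against the exponential distribution. -/
lemma setLIntegral_Iio_expMeasure {lam : ℝ} (hlam : 0 < lam) {W : ℝ} (hW : 0 ≤ W) {f G : ℝ → ℝ}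
    (hf : Continuous f) (hf0 : ∀ t, t < W → 0 ≤ f t)
    (hG : ∀ t, HasDerivAt G (lam * Real.exp (-(lam * t)) * f t) t) :
    ∫⁻ t in Set.Iio W, ENNReal.ofReal (f t) ∂(expMeasure lam) = ENNReal.ofReal (G W - G 0) := by
  have hc : Continuous fun t : ℝ => lam * Real.exp (-(lam * t)) * f t := by fun_prop
  change ∫⁻ t in Set.Iio W, ENNReal.ofReal (f t) ∂(volume.withDensity (exponentialPDF lam)) = _
  have hm : Measurable (exponentialPDF lam) :=
    (measurable_exponentialPDFReal lam).ennreal_ofReal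
  rw [restrict_withDensity measurableSet_Iio,
    lintegral_withDensity_eq_lintegral_mul _ hm (by fun_prop)]
  have h1 : ∀ t ∈ Set.Iio W, (exponentialPDF lam * fun t => ENNReal.ofReal (f t)) t =
      (Set.Ico 0 W).indicator
        (fun t => ENNReal.ofReal (lam * Real.exp (-(lam * t)) * f t)) t := by
    intro t ht
    simp only [Pi.mul_apply]
    rcases lt_or_ge t 0 with h | h
    · rw [exponentialPDF_of_neg h, zero_mul, Set.indicator_of_notMem]
      simp [h]
    · rw [exponentialPDF_of_nonneg h, Set.indicator_of_mem (Set.mem_Ico.2 ⟨h, ht⟩),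
        ← ENNReal.ofReal_mul]
      positivity
  rw [setLIntegral_congr_fun measurableSet_Iio h1, setLIntegral_indicator measurableSet_Ico,
    Set.inter_eq_left.2 (show Set.Ico 0 W ⊆ Set.Iio W from fun t ht => ht.2)]
  rw [← ofReal_integral_eq_lintegral_ofReal]
  · rw [integral_Ico_eq_integral_Ioc, ← intervalIntegral.integral_of_le hW,
      intervalIntegral.integral_eq_sub_of_hasDerivAt (fun t _ => hG t) (hc.intervalIntegrable _ _)]
  · exact (hc.continuousOn.integrableOn_Icc (a := 0) (b := W)).mono_set Set.Ico_subset_Icc_self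
  · refine (ae_restrict_iff' measurableSet_Ico).2 (Eventually.of_forall fun t ht => ?_)
    have := hf0 t ht.2
    simp only [Pi.zero_apply]
    positivity

lemma expMeasure_Iio {lam : ℝ} (hlam : 0 < lam) {W : ℝ} (hW : 0 ≤ W) :
    expMeasure lam (Set.Iio W) = ENNReal.ofReal (1 - Real.exp (-(lam * W))) := by
  have := setLIntegral_Iio_expMeasure hlam hW (f := fun _ => 1)
    (G := fun t => -Real.exp (-(lam * t))) continuous_const (by simp)
    (fun t => by simpa using hasDerivAt_neg_exp_mul_exp (r := lam) (x := t))
  simpa [add_comm, sub_eq_add_neg] using this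

lemma expMeasure_Ici {lam : ℝ} (hlam : 0 < lam) {W : ℝ} (hW : 0 ≤ W) :
    expMeasure lam (Set.Ici W) = ENNReal.ofReal (Real.exp (-(lam * W))) := by
  have := isProbabilityMeasure_expMeasure hlam
  have h := prob_compl_eq_one_sub (μ := expMeasure lam) (measurableSet_Iio (a := W))
  rw [Set.compl_Iio, expMeasure_Iio hlam hW] at h
  rw [h, ← ENNReal.ofReal_one, ← ENNReal.ofReal_sub]
  · congr 1; ring
  · have : Real.exp (-(lam * W)) ≤ 1 := Real.exp_le_one_iff.2 (by nlinarith)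
    linarith

/-- The workload `W - t` left after an exponential time `t`, in the exponential scale. By lack of
memory, the idle time `t - W` is again exponential, whence the value assigned to it. -/
lemma lintegral_exp_workload {lam s : ℝ} (hs : 0 ≤ s) (hsl : s < lam) {W : ℝ} (hW : 0 ≤ W) :
    ∫⁻ t, (if W ≤ t then ENNReal.ofReal (lam / (lam - s)) else
      ENNReal.ofReal (Real.exp (-(s * (W - t))))) ∂(expMeasure lam) =
    ENNReal.ofReal (lam / (lam - s)) * ENNReal.ofReal (Real.exp (-(s * W))) := by
  have hlam : 0 < lam := by linarith
  have hls : 0 < lam - s := by linarith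
  rw [← lintegral_add_compl _ (measurableSet_Iio (a := W)), Set.compl_Iio]
  have h1 : ∫⁻ t in Set.Iio W, (if W ≤ t then ENNReal.ofReal (lam / (lam - s)) else
      ENNReal.ofReal (Real.exp (-(s * (W - t))))) ∂(expMeasure lam) =
      ∫⁻ t in Set.Iio W, ENNReal.ofReal (Real.exp (-(s * (W - t)))) ∂(expMeasure lam) :=
    setLIntegral_congr_fun measurableSet_Iio fun t ht => if_neg (not_le.2 ht)
  have h2 : ∫⁻ t in Set.Ici W, (if W ≤ t then ENNReal.ofReal (lam / (lam - s)) else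
      ENNReal.ofReal (Real.exp (-(s * (W - t))))) ∂(expMeasure lam) =
      ∫⁻ t in Set.Ici W, ENNReal.ofReal (lam / (lam - s)) ∂(expMeasure lam) :=
    setLIntegral_congr_fun measurableSet_Ici fun t ht => if_pos ht
  have hd : ∀ t, HasDerivAt (fun t => -(lam / (lam - s)) * Real.exp (-(s * W) - (lam - s) * t))
      (lam * Real.exp (-(lam * t)) * Real.exp (-(s * (W - t)))) t := by
    intro t
    have h := (((hasDerivAt_id t).const_mul (lam - s)).const_sub (-(s * W))).exp.const_mul
      (-(lam / (lam - s)))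
    refine h.congr_deriv ?_
    rw [mul_assoc lam, ← Real.exp_add]
    simp only [id_eq, mul_one]
    have : -(lam * t) + -(s * (W - t)) = -(s * W) - (lam - s) * t := by ring
    rw [this]; field_simp
  rw [h1, h2, setLIntegral_Iio_expMeasure hlam hW (by fun_prop) (fun _ _ => Real.exp_nonneg _) hd,
    setLIntegral_const, expMeasure_Ici hlam hW, ← ENNReal.ofReal_mul (by positivity),
    ← ENNReal.ofReal_mul (by positivity), ← ENNReal.ofReal_add]
  · congr 1
    have : -(s * W) - (lam - s) * W = -(lam * W) := by ring
    rw [this]; simp only [mul_zero, sub_zero]; ring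
  · have h3 : Real.exp (-(s * W) - (lam - s) * W) ≤ Real.exp (-(s * W) - (lam - s) * 0) :=
      Real.exp_le_exp.2 (by nlinarith)
    have h4 : 0 < lam / (lam - s) := by positivity
    nlinarith
  · positivity

/-- The mean of the workload left after an exponential time, when `1 / λ` is added in case it is
positive. -/
lemma lintegral_workload {lam : ℝ} (hlam : 0 < lam) {W : ℝ} (hW : 0 ≤ W) :
    ∫⁻ t, (if W ≤ t then 0 else ENNReal.ofReal (W - t + 1 / lam)) ∂(expMeasure lam) =
      ENNReal.ofReal W := by
  have h1 : (fun t => if W ≤ t then 0 else ENNReal.ofReal (W - t + 1 / lam)) =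
      (Set.Iio W).indicator fun t => ENNReal.ofReal (W - t + 1 / lam) := by
    funext t
    by_cases h : W ≤ t <;> simp [h, Set.indicator, not_lt.2, lt_of_not_ge]
  have hd : ∀ t, HasDerivAt (fun t => -((W - t) * Real.exp (-(lam * t))))
      (lam * Real.exp (-(lam * t)) * (W - t + 1 / lam)) t := by
    intro t
    have h := (((hasDerivAt_id t).const_sub W).mul
      (((hasDerivAt_id t).const_mul lam).neg.exp)).neg
    refine h.congr_deriv ?_
    simp only [id_eq, mul_one, Pi.neg_apply]
    field_simp
    ring
  rw [h1, lintegral_indicator measurableSet_Iio, setLIntegral_Iio_expMeasure hlam hW (by fun_prop)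
    (fun t ht => by have : 0 < 1 / lam := by positivity
                    linarith) hd]
  simp

/-! ### One step of the busy period -/

/-- The mean of `exp (-s W)` over the event that message `i` arrives during the busy period and is
processed, where `W` is the workload it finds. -/
noncomputable def accMean {Ω : Type*} [MeasurableSpace Ω] (μ : Measure Ω) (τ χ : ℕ → Ω → ℝ)
    (ζ : ℕ → Ω → ℕ) (s : ℝ) (i : ℕ) : ℝ≥0∞ :=
  busyMean μ τ χ ζ i fun z q =>
    if q.length ≤ z i then ENNReal.ofReal (Real.exp (-(s * q.sum))) else 0

/-- The mean of `exp (-s W)` over the event that message `i` arrives during the busy period and is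
refused, where `W` is the workload it finds. -/
noncomputable def refMean {Ω : Type*} [MeasurableSpace Ω] (μ : Measure Ω) (τ χ : ℕ → Ω → ℝ)
    (ζ : ℕ → Ω → ℕ) (s : ℝ) (i : ℕ) : ℝ≥0∞ :=
  busyMean μ τ χ ζ i fun z q =>
    if q.length ≤ z i then 0 else ENNReal.ofReal (Real.exp (-(s * q.sum)))

lemma measurableSet_length_le (i : ℕ) :
    MeasurableSet {x : (ℕ → ℕ) × List ℝ | x.2.length ≤ x.1 i} :=
  measurableSet_le (measurable_length.comp measurable_snd)
    ((measurable_pi_apply i).comp measurable_fst)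

lemma measurable_accFun (s : ℝ) (i : ℕ) :
    Measurable (Function.uncurry fun (z : ℕ → ℕ) (q : List ℝ) =>
      if q.length ≤ z i then ENNReal.ofReal (Real.exp (-(s * q.sum))) else 0) :=
  Measurable.ite (measurableSet_length_le i) (by fun_prop) measurable_const

lemma measurable_refFun (s : ℝ) (i : ℕ) :
    Measurable (Function.uncurry fun (z : ℕ → ℕ) (q : List ℝ) =>
      if q.length ≤ z i then 0 else ENNReal.ofReal (Real.exp (-(s * q.sum)))) :=
  Measurable.ite (measurableSet_length_le i) measurable_const (by fun_prop)

lemma ae_nonneg_of_measure_Iio {B : Measure ℝ} (hB : B (Set.Iio 0) = 0) : ∀ᵐ x ∂B, 0 ≤ x := by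
  rw [ae_iff]
  convert hB using 2
  ext; simp

namespace IsLossSystem

variable {Ω : Type*} [MeasurableSpace Ω] {μ : Measure Ω}
  {lam : ℝ} {B : Measure ℝ} {p : ℝ} {law : ℕ → ℝ≥0∞}
  {τ χ : ℕ → Ω → ℝ} {ζ : ℕ → Ω → ℕ} {mark : ℕ → Ω → Bool}

lemma ae_χ_nonneg (h : IsLossSystem μ lam B p law τ χ ζ mark) (hB : B (Set.Iio 0) = 0) :
    ∀ᵐ ω ∂μ, ∀ i, 0 ≤ χ i ω := by
  rw [ae_all_iff]
  intro i
  have : ∀ᵐ x ∂(μ.map (χ i)), 0 ≤ x := by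
    rw [h.law_χ i]; exact ae_nonneg_of_measure_Iio hB
  exact ae_of_ae_map (h.measurable_χ i).aemeasurable this

lemma ae_τ_nonneg (h : IsLossSystem μ lam B p law τ χ ζ mark) :
    ∀ᵐ ω ∂μ, ∀ i, 0 ≤ τ i ω := by
  rw [ae_all_iff]
  intro i
  have : ∀ᵐ x ∂(μ.map (τ i)), 0 ≤ x := by
    rw [h.law_τ i]; exact ae_nonneg_expMeasure lam
  exact ae_of_ae_map (h.measurable_τ i).aemeasurable this

lemma busyMean_congr (h : IsLossSystem μ lam B p law τ χ ζ mark) (hB : B (Set.Iio 0) = 0) (i : ℕ)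
    {φ ψ : (ℕ → ℕ) → List ℝ → ℝ≥0∞} (hφ : ∀ z q, (∀ w ∈ q, 0 ≤ w) → φ z q = ψ z q) :
    busyMean μ τ χ ζ i φ = busyMean μ τ χ ζ i ψ := by
  refine lintegral_congr_ae (ae_restrict_of_ae ?_)
  filter_upwards [h.ae_χ_nonneg hB] with ω hω
  exact hφ _ _ (state_nonneg hω _ i)

lemma busyMean_add (h : IsLossSystem μ lam B p law τ χ ζ mark) (i : ℕ)
    {φ : (ℕ → ℕ) → List ℝ → ℝ≥0∞} (hφ : Measurable (Function.uncurry φ))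
    (ψ : (ℕ → ℕ) → List ℝ → ℝ≥0∞) :
    busyMean μ τ χ ζ i (fun z q => φ z q + ψ z q) =
      busyMean μ τ χ ζ i φ + busyMean μ τ χ ζ i ψ :=
  lintegral_add_left (hφ.comp
    ((measurable_pi_lambda _ h.measurable_ζ).prodMk (h.measurable_state' i))) _

lemma busyMean_const_mul (i : ℕ) {c : ℝ≥0∞} (hc : c ≠ ∞) (φ : (ℕ → ℕ) → List ℝ → ℝ≥0∞) :
    busyMean μ τ χ ζ i (fun z q => c * φ z q) = c * busyMean μ τ χ ζ i φ :=
  lintegral_const_mul' _ _ hc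

lemma busyMean_exp (h : IsLossSystem μ lam B p law τ χ ζ mark) (s : ℝ) (i : ℕ) :
    busyMean μ τ χ ζ i (fun _ q => ENNReal.ofReal (Real.exp (-(s * q.sum)))) =
      accMean μ τ χ ζ s i + refMean μ τ χ ζ s i := by
  rw [accMean, refMean, ← h.busyMean_add i (measurable_accFun s i)]
  congr 1; funext z q
  split_ifs <;> simp

variable [IsProbabilityMeasure μ]

lemma isProbabilityMeasure_service (h : IsLossSystem μ lam B p law τ χ ζ mark) :
    IsProbabilityMeasure B :=
  h.law_χ 0 ▸ Measure.isProbabilityMeasure_map (h.measurable_χ 0).aemeasurable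

lemma isProbabilityMeasure_arrival (h : IsLossSystem μ lam B p law τ χ ζ mark) :
    IsProbabilityMeasure (expMeasure lam) :=
  h.law_τ 0 ▸ Measure.isProbabilityMeasure_map (h.measurable_τ 0).aemeasurable

/-- The mean over the two possible fates of the busy period at the next arrival. -/
lemma busyMean_succ_add (h : IsLossSystem μ lam B p law τ χ ζ mark) (hB : B (Set.Iio 0) = 0)
    (i : ℕ) {φ : List ℝ → ℝ≥0∞} (hφ : Measurable φ) (c : ℝ≥0∞) {ψ : List ℝ → ℝ≥0∞}
    (hψ : ∀ q, (∀ w ∈ q, 0 ≤ w) →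
      ∫⁻ t, (if (serve q t).length = 0 then c else φ (serve q t)) ∂(expMeasure lam) = ψ q) :
    busyMean μ τ χ ζ (i + 1) (fun _ => φ) + c * μ (inBusy τ χ ζ i \ inBusy τ χ ζ (i + 1)) =
      busyMean μ τ χ ζ i (fun z q => ∫⁻ x, ψ (join q x (z i)) ∂B) := by
  have := h.isProbabilityMeasure_service
  have := h.isProbabilityMeasure_arrival
  have hm1 := h.measurableSet_inBusy' i
  have hm2 := h.measurableSet_inBusy' (i + 1)
  have hg : Measurable fun q : List ℝ => if q.length = 0 then c else φ q :=
    Measurable.ite (measurableSet_length_eq measurable_id 0) measurable_const hφ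
  have key := h.lintegral_inBusy i
    (F := fun z q t x => if (serve (join q x (z i)) t).length = 0 then c else
      φ (serve (join q x (z i)) t)) (by
      refine hg.comp (f := fun x : (ℕ → ℕ) × List ℝ × ℝ × ℝ =>
        serve (join x.2.1 x.2.2.2 (x.1 i)) x.2.2.1) ?_
      refine measurable_serve (measurable_join ?_ ?_ ?_) ?_ <;> fun_prop)
  have h1 : busyMean μ τ χ ζ i (fun z q => ∫⁻ x, ψ (join q x (z i)) ∂B) =
      busyMean μ τ χ ζ i (fun z q => ∫⁻ t, ∫⁻ x,
        (if (serve (join q x (z i)) t).length = 0 then c else φ (serve (join q x (z i)) t))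
          ∂B ∂(expMeasure lam)) := by
    refine h.busyMean_congr hB i fun z q hq => ?_
    rw [lintegral_lintegral_swap]
    · refine lintegral_congr_ae ?_
      have hx : ∀ᵐ x ∂B, 0 ≤ x := ae_nonneg_of_measure_Iio hB
      filter_upwards [hx] with x hx
      exact (hψ _ (join_nonneg hq hx _)).symm
    · refine Measurable.aemeasurable (hg.comp (f := fun y : ℝ × ℝ =>
        serve (join q y.2 (z i)) y.1) ?_)
      exact measurable_serve (measurable_join measurable_const measurable_snd measurable_const)
        measurable_fst
  rw [h1, ← key, busyMean]
  have hsub : inBusy τ χ ζ (i + 1) ⊆ inBusy τ χ ζ i := fun ω hω => (mem_inBusy_succ.1 hω).1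
  rw [← lintegral_inter_add_sdiff (A := inBusy τ χ ζ i) _ hm2, Set.inter_eq_right.2 hsub,
    ← setLIntegral_const]
  congr 1
  · refine setLIntegral_congr_fun hm2 fun ω hω => ?_
    simp only
    rw [← state_succ, if_neg (mem_inBusy_succ.1 hω).2]
  · refine setLIntegral_congr_fun (hm1.diff hm2) fun ω hω => ?_
    simp only
    rw [← state_succ, if_pos]
    by_contra h2
    exact hω.2 (mem_inBusy_succ.2 ⟨hω.1, h2⟩)

/-- The balance of `exp (-s W)` over one step. The last term on the left accounts for the end of the
busy period: the idle time before the next arrival is exponential. -/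
lemma accMean_succ_add_refMean_succ (h : IsLossSystem μ lam B p law τ χ ζ mark)
    (hB : B (Set.Iio 0) = 0) {s : ℝ} (hs : 0 ≤ s) (hsl : s < lam) (i : ℕ) :
    accMean μ τ χ ζ s (i + 1) + refMean μ τ χ ζ s (i + 1) +
        ENNReal.ofReal (lam / (lam - s)) * μ (inBusy τ χ ζ i \ inBusy τ χ ζ (i + 1)) =
      ENNReal.ofReal (lam / (lam - s)) *
        ((∫⁻ x, ENNReal.ofReal (Real.exp (-(s * x))) ∂B) * accMean μ τ χ ζ s i +
          refMean μ τ χ ζ s i) := by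
  have := h.isProbabilityMeasure_service
  set c := ENNReal.ofReal (lam / (lam - s))
  have hβ : (∫⁻ x, ENNReal.ofReal (Real.exp (-(s * x))) ∂B) ≠ ∞ := by
    refine ((lintegral_mono_ae (g := fun _ => 1) ?_).trans_lt (by simp)).ne
    have hx : ∀ᵐ x ∂B, 0 ≤ x := ae_nonneg_of_measure_Iio hB
    filter_upwards [hx] with x hx
    rw [ENNReal.ofReal_le_one, Real.exp_le_one_iff]
    nlinarith
  rw [← h.busyMean_exp, h.busyMean_succ_add hB i
    (φ := fun q => ENNReal.ofReal (Real.exp (-(s * q.sum)))) (by fun_prop) c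
    (ψ := fun q => c * ENNReal.ofReal (Real.exp (-(s * q.sum))))]
  · rw [accMean, refMean, ← busyMean_const_mul i hβ, ← h.busyMean_add i
      ((measurable_accFun s i).const_mul _), ← busyMean_const_mul i ENNReal.ofReal_ne_top]
    congr 1; funext z q
    by_cases hq : q.length ≤ z i
    · simp only [join, if_pos hq, List.sum_append, List.sum_singleton, add_zero]
      have : ∀ x : ℝ, c * ENNReal.ofReal (Real.exp (-(s * (q.sum + x)))) =
          (c * ENNReal.ofReal (Real.exp (-(s * q.sum)))) *
            ENNReal.ofReal (Real.exp (-(s * x))) := by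
        intro x
        rw [mul_assoc, ← ENNReal.ofReal_mul (Real.exp_nonneg _), ← Real.exp_add]
        congr 3; ring
      simp only [this]
      rw [lintegral_const_mul _ (by fun_prop)]
      ring
    · simp [join, if_neg hq, c]
  · intro q hq
    have hsum : 0 ≤ q.sum := List.sum_nonneg hq
    rw [← lintegral_exp_workload hs hsl hsum]
    refine lintegral_congr_ae ?_
    filter_upwards [ae_nonneg_expMeasure lam] with t ht
    simp only [List.length_eq_zero_iff, serve_eq_nil_iff hq ht, sum_serve hq ht]
    split_ifs with h1
    · rfl
    · rw [max_eq_left (by linarith)]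

/-- The mean workload found during the busy period grows by the mean service time with each
processed message. The work done between two arrivals is the interarrival time less the idle time,
if any. By lack of memory the idle time, if any, has mean `1 / λ`, so the mean work done is `1 / λ`
times the probability that the busy period lasts until the second arrival. -/
lemma busyMean_workload_succ (h : IsLossSystem μ lam B p law τ χ ζ mark)
    (hB : B (Set.Iio 0) = 0) (hlam : 0 < lam) (i : ℕ) :
    busyMean μ τ χ ζ (i + 1) (fun _ q => ENNReal.ofReal q.sum) +
        ENNReal.ofReal (1 / lam) * μ (inBusy τ χ ζ (i + 1)) =
      busyMean μ τ χ ζ i (fun _ q => ENNReal.ofReal q.sum) +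
        (∫⁻ x, ENNReal.ofReal x ∂B) * accMean μ τ χ ζ 0 i := by
  have := h.isProbabilityMeasure_service
  have h0 : ENNReal.ofReal (1 / lam) * μ (inBusy τ χ ζ (i + 1)) =
      busyMean μ τ χ ζ (i + 1) (fun _ _ => ENNReal.ofReal (1 / lam)) := by
    rw [busyMean, setLIntegral_const]
  have hm : Measurable (Function.uncurry fun (_ : ℕ → ℕ) (q : List ℝ) => ENNReal.ofReal q.sum) :=
    (measurable_list_sum.comp measurable_snd).ennreal_ofReal
  have h1 := h.busyMean_succ_add hB i
    (φ := fun q => ENNReal.ofReal (q.sum + 1 / lam)) (by fun_prop) 0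
    (ψ := fun q => ENNReal.ofReal q.sum) (by
      intro q hq
      have hsum : 0 ≤ q.sum := List.sum_nonneg hq
      rw [← lintegral_workload hlam hsum]
      refine lintegral_congr_ae ?_
      filter_upwards [ae_nonneg_expMeasure lam] with t ht
      simp only [List.length_eq_zero_iff, serve_eq_nil_iff hq ht, sum_serve hq ht]
      split_ifs with h1
      · rfl
      · rw [max_eq_left (by linarith)])
  rw [zero_mul, add_zero] at h1
  have h2 : busyMean μ τ χ ζ (i + 1) (fun _ q => ENNReal.ofReal (q.sum + 1 / lam)) =
      busyMean μ τ χ ζ (i + 1) (fun _ q => ENNReal.ofReal q.sum + ENNReal.ofReal (1 / lam)) := by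
    refine h.busyMean_congr hB _ fun z q hq => ?_
    exact ENNReal.ofReal_add (List.sum_nonneg hq) (by positivity)
  have hx : ∀ᵐ x ∂B, 0 ≤ x := ae_nonneg_of_measure_Iio hB
  rw [h0, ← h.busyMean_add (i + 1) hm, ← h2, h1]
  have h3 : (∫⁻ x, ENNReal.ofReal x ∂B) * accMean μ τ χ ζ 0 i =
      busyMean μ τ χ ζ i (fun z q => (∫⁻ x, ENNReal.ofReal x ∂B) *
        if q.length ≤ z i then ENNReal.ofReal (Real.exp (-(0 * q.sum))) else 0) :=
    (lintegral_const_mul _ ((measurable_accFun 0 i).comp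
      ((measurable_pi_lambda _ h.measurable_ζ).prodMk (h.measurable_state' i)))).symm
  rw [h3, ← h.busyMean_add i hm]
  refine h.busyMean_congr hB _ fun z q hq => ?_
  by_cases hl : q.length ≤ z i
  · simp only [join, if_pos hl, List.sum_append, List.sum_singleton, zero_mul, neg_zero,
      Real.exp_zero, ENNReal.ofReal_one, mul_one]
    have : ∀ᵐ x ∂B, ENNReal.ofReal (q.sum + x) = ENNReal.ofReal q.sum + ENNReal.ofReal x := by
      filter_upwards [hx] with x hx
      exact ENNReal.ofReal_add (List.sum_nonneg hq) hx
    rw [lintegral_congr_ae this, lintegral_add_left measurable_const]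
    simp
  · simp [join, if_neg hl]

/-- The excess over the level `M` decreases as long as the message in service has a residual
service time above `M`. -/
lemma busyMean_excess_succ_le (h : IsLossSystem μ lam B p law τ χ ζ mark)
    (hB : B (Set.Iio 0) = 0) (hlam : 0 < lam) {M : ℝ} (hM : 0 ≤ M) (i : ℕ) :
    busyMean μ τ χ ζ (i + 1) (fun _ q => ENNReal.ofReal (excess M q)) +
        ENNReal.ofReal (Real.exp (-1) / lam) * busyMean μ τ χ ζ i
          (fun _ q => if M + 1 / lam ≤ q.getD 0 0 then 1 else 0) ≤
      busyMean μ τ χ ζ i (fun _ q => ENNReal.ofReal (excess M q)) +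
        (∫⁻ x, ENNReal.ofReal (max (x - M) 0) ∂B) * accMean μ τ χ ζ 0 i := by
  have := h.isProbabilityMeasure_service
  have := h.isProbabilityMeasure_arrival
  have hm1 := h.measurableSet_inBusy' i
  have hl' : 0 < 1 / lam := by positivity
  have hmh : MeasurableSet {q : List ℝ | M + 1 / lam ≤ q.getD 0 0} :=
    measurableSet_le measurable_const (measurable_getD 0)
  have hmacc : Measurable fun x : (ℕ → ℕ) × List ℝ =>
      if x.2.length ≤ x.1 i then (1 : ℝ≥0∞) else 0 :=
    Measurable.ite (measurableSet_length_le i) measurable_const measurable_const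
  -- both sides as integrals of functions of the state and the data of message `i`
  have e1 := h.lintegral_inBusy i
    (F := fun _ q t _ => ENNReal.ofReal (1 / lam) * if 1 / lam ≤ t ∧ M + 1 / lam ≤ q.getD 0 0
      then 1 else 0) (by
        refine measurable_const.mul (Measurable.ite ?_ measurable_const measurable_const)
        refine MeasurableSet.inter (measurableSet_le (f := fun _ => 1 / lam)
          (g := fun x : (ℕ → ℕ) × List ℝ × ℝ × ℝ => x.2.2.1) measurable_const (by fun_prop)) ?_
        exact hmh.preimage (f := fun x : (ℕ → ℕ) × List ℝ × ℝ × ℝ => x.2.1) (by fun_prop))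
  have e2 := h.lintegral_inBusy i
    (F := fun z q _ x => ENNReal.ofReal (max (x - M) 0) * if q.length ≤ z i then 1 else 0) (by
        refine Measurable.mul (f := fun x : (ℕ → ℕ) × List ℝ × ℝ × ℝ =>
          ENNReal.ofReal (max (x.2.2.2 - M) 0)) (by fun_prop) ?_
        exact hmacc.comp (f := fun x : (ℕ → ℕ) × List ℝ × ℝ × ℝ => (x.1, x.2.1)) (by fun_prop))
  have c1 : ∫⁻ ω in inBusy τ χ ζ i, (ENNReal.ofReal (1 / lam) *
      if 1 / lam ≤ τ i ω ∧ M + 1 / lam ≤ (state (τ · ω) (χ · ω) (ζ · ω) i).getD 0 0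
      then 1 else 0) ∂μ = ENNReal.ofReal (Real.exp (-1) / lam) * busyMean μ τ χ ζ i
          (fun _ q => if M + 1 / lam ≤ q.getD 0 0 then 1 else 0) := by
    rw [e1, ← busyMean_const_mul i ENNReal.ofReal_ne_top]
    congr 1; funext z q
    by_cases hq : M + 1 / lam ≤ q.getD 0 0
    · have : ∀ t : ℝ, (if 1 / lam ≤ t ∧ M + 1 / lam ≤ q.getD 0 0 then (1 : ℝ≥0∞) else 0) =
          (Set.Ici (1 / lam)).indicator 1 t := by
        intro t
        simp only [hq, and_true, Set.indicator, Set.mem_Ici, Pi.one_apply]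
      simp only [this, lintegral_const, measure_univ, mul_one, if_pos hq]
      rw [lintegral_const_mul _ (measurable_one.indicator measurableSet_Ici),
        lintegral_indicator_one measurableSet_Ici, expMeasure_Ici hlam hl'.le,
        ← ENNReal.ofReal_mul hl'.le]
      congr 1
      field_simp
    · simp only [hq, and_false, if_false, mul_zero, lintegral_zero]
  have c2 : ∫⁻ ω in inBusy τ χ ζ i, (ENNReal.ofReal (max (χ i ω - M) 0) *
      if (state (τ · ω) (χ · ω) (ζ · ω) i).length ≤ ζ i ω then 1 else 0) ∂μ =
      (∫⁻ x, ENNReal.ofReal (max (x - M) 0) ∂B) * accMean μ τ χ ζ 0 i := by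
    rw [e2, accMean, busyMean, busyMean, ← lintegral_const_mul]
    · refine lintegral_congr fun ω => ?_
      simp only [lintegral_const, measure_univ, mul_one]
      rw [lintegral_mul_const _ (by fun_prop)]
      simp
    · exact (measurable_accFun 0 i).comp
        ((measurable_pi_lambda _ h.measurable_ζ).prodMk (h.measurable_state' i))
  rw [← c1, ← c2, busyMean, busyMean]
  have hsub : inBusy τ χ ζ (i + 1) ⊆ inBusy τ χ ζ i := fun ω hω => (mem_inBusy_succ.1 hω).1
  refine (add_le_add_left (lintegral_mono_set hsub) _).trans ?_
  have hme : ∀ j, Measurable fun ω => ENNReal.ofReal (excess M (state (τ · ω) (χ · ω) (ζ · ω) j)) :=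
    fun j => ((measurable_excess M).comp (h.measurable_state' j)).ennreal_ofReal
  rw [← lintegral_add_left (hme _), ← lintegral_add_left (hme _)]
  refine lintegral_mono_ae (ae_restrict_of_ae ?_)
  filter_upwards [h.ae_χ_nonneg hB, h.ae_τ_nonneg] with ω h1 h2
  have hq := state_nonneg h1 (ζ · ω) (τ := (τ · ω)) i
  rw [state_succ]
  set q := state (τ · ω) (χ · ω) (ζ · ω) i
  have hb := excess_serve_add_le hM (join_nonneg hq (h1 i) (ζ i ω)) (h2 i)
  have hj : excess M (join q (χ i ω) (ζ i ω)) =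
      excess M q + max (χ i ω - M) 0 * if q.length ≤ ζ i ω then 1 else 0 := by
    unfold join; split_ifs <;> simp [excess_concat]
  have hi : (ENNReal.ofReal (1 / lam) *
      if 1 / lam ≤ τ i ω ∧ M + 1 / lam ≤ q.getD 0 0 then 1 else 0) ≤
      ENNReal.ofReal (min (τ i ω) (max ((join q (χ i ω) (ζ i ω)).getD 0 0 - M) 0)) := by
    split_ifs with h3
    · rw [mul_one]
      refine ENNReal.ofReal_le_ofReal (le_min h3.1 (le_max_of_le_left ?_))
      have : (join q (χ i ω) (ζ i ω)).getD 0 0 = q.getD 0 0 := by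
        have hne : q ≠ [] := by
          rintro h4
          rw [h4] at h3
          have := h3.2
          simp only [List.getD_nil] at this
          linarith
        unfold join
        split_ifs
        · rw [List.getD_append _ _ _ _ (List.length_pos_iff.2 hne)]
        · rfl
      rw [this]; linarith [h3.2]
    · simp
  refine (add_le_add_right hi _).trans ?_
  rw [← ENNReal.ofReal_add (excess_nonneg _ _) (le_min (h2 i) (le_max_right _ _))]
  refine (ENNReal.ofReal_le_ofReal (hb.trans_eq hj)).trans ?_
  rw [ENNReal.ofReal_add (excess_nonneg _ _) (by split_ifs <;> simp)]
  refine add_le_add_right (le_of_eq ?_) _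
  split_ifs <;> simp

end IsLossSystem

/-! ### Summation of drift inequalities -/

/-- Two drift inequalities combine to a bound for the expected remaining length of the busy period:
`g` controls the messages that find a moderate residual service time at the head of the queue,
and `f` controls the others, whose probabilities are `b`. -/
lemma sum_Ico_le_of_drift {v e b f g : ℕ → ℝ} {δ κ k : ℝ} (hδ : 0 < δ) (hk : 0 < k)
    (hκ : 2 * κ ≤ k) (hv : ∀ i, 0 ≤ v i) (hf : ∀ i, 0 ≤ f i) (hg : ∀ i, 0 ≤ g i)
    (hgv : ∀ i, g i ≤ v i) (h1 : ∀ i, δ * e i ≤ g i - g (i + 1))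
    (h2 : ∀ i, b i ≤ f i - f (i + 1) + κ * v i) (h3 : ∀ i, k * v i ≤ e i + b i) {L n : ℕ}
    (hLn : L ≤ n) : ∑ i ∈ Finset.Ico L n, v i ≤ 2 / k * (v L / δ + f L) := by
  set V := ∑ i ∈ Finset.Ico L n, v i with hV
  have hV0 : 0 ≤ V := Finset.sum_nonneg fun i _ => hv i
  have s1 : δ * ∑ i ∈ Finset.Ico L n, e i ≤ v L := by
    rw [Finset.mul_sum]
    refine (Finset.sum_le_sum fun i _ => h1 i).trans ?_
    have := Finset.sum_Ico_sub (f := g) hLn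
    have h4 : ∑ i ∈ Finset.Ico L n, (g i - g (i + 1)) = g L - g n := by
      rw [← neg_sub (g n), ← this, ← Finset.sum_neg_distrib]
      exact Finset.sum_congr rfl fun i _ => by ring
    rw [h4]; linarith [hg n, hgv L]
  have s2 : ∑ i ∈ Finset.Ico L n, b i ≤ f L + κ * V := by
    refine (Finset.sum_le_sum fun i _ => h2 i).trans ?_
    rw [Finset.sum_add_distrib, ← Finset.mul_sum]
    have := Finset.sum_Ico_sub (f := f) hLn
    have h4 : ∑ i ∈ Finset.Ico L n, (f i - f (i + 1)) = f L - f n := by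
      rw [← neg_sub (f n), ← this, ← Finset.sum_neg_distrib]
      exact Finset.sum_congr rfl fun i _ => by ring
    rw [h4]; linarith [hf n]
  have s3 : k * V ≤ ∑ i ∈ Finset.Ico L n, e i + ∑ i ∈ Finset.Ico L n, b i := by
    rw [hV, Finset.mul_sum, ← Finset.sum_add_distrib]
    exact Finset.sum_le_sum fun i _ => h3 i
  have s4 : ∑ i ∈ Finset.Ico L n, e i ≤ v L / δ := by
    rw [le_div_iff₀ hδ]; linarith
  have s5 : k / 2 * V ≤ v L / δ + f L := by nlinarith
  rw [div_mul_eq_mul_div, le_div_iff₀ hk]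
  linarith

lemma antitone_mul_le_tsum {v : ℕ → ℝ} (hv : ∀ i, 0 ≤ v i) (ha : Antitone v) (hs : Summable v)
    (n : ℕ) : n * v n ≤ ∑' i, v i := by
  calc (n : ℝ) * v n = ∑ i ∈ Finset.range n, v n := by simp
    _ ≤ ∑ i ∈ Finset.range n, v i :=
        Finset.sum_le_sum fun i hi => ha (Finset.mem_range.1 hi).le
    _ ≤ ∑' i, v i := hs.sum_le_tsum _ fun i _ => hv i

/-- Telescoping along a subsequence on which `g` tends to zero. -/
lemma hasSum_of_telescope {u g : ℕ → ℝ} (hu : ∀ i, u i = g i - g (i + 1)) (hs : Summable u)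
    {n : ℕ → ℕ} (hn : Tendsto n atTop atTop) (hg : Tendsto (fun k => g (n k)) atTop (𝓝 0)) :
    HasSum u (g 0) := by
  have h1 : ∀ m, ∑ i ∈ Finset.range m, u i = g 0 - g m := by
    intro m
    rw [← Finset.sum_range_sub' g m]
    exact Finset.sum_congr rfl fun i _ => hu i
  have h2 := hs.hasSum.tendsto_sum_nat.comp hn
  have h3 : Tendsto (fun k => ∑ i ∈ Finset.range (n k), u i) atTop (𝓝 (g 0 - 0)) := by
    simp only [h1]
    exact tendsto_const_nhds.sub hg
  have := tendsto_nhds_unique h2 h3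
  rw [sub_zero] at this
  exact this ▸ hs.hasSum

/-! ### Moments of the service time -/

lemma exp_neg_le_quadratic {y : ℝ} (hy : 0 ≤ y) : Real.exp (-y) ≤ 1 - y + y ^ 2 / 2 := by
  have hd : ∀ t, HasDerivAt (fun t : ℝ => 1 - t + t ^ 2 / 2 - Real.exp (-t))
      (-1 + t + Real.exp (-t)) t := by
    intro t
    have h := (((hasDerivAt_id t).const_sub 1).add (((hasDerivAt_id t).pow 2).div_const 2)).sub
      (hasDerivAt_id t).neg.exp
    refine h.congr_deriv ?_
    simp
  have hm : MonotoneOn (fun t : ℝ => 1 - t + t ^ 2 / 2 - Real.exp (-t)) (Set.Ici 0) := by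
    refine monotoneOn_of_hasDerivWithinAt_nonneg (convex_Ici 0)
      (fun t _ => (hd t).continuousAt.continuousWithinAt)
      (fun t _ => (hd t).hasDerivWithinAt) fun t _ => ?_
    have := Real.add_one_le_exp (-t)
    linarith
  have := hm (Set.mem_Ici.2 le_rfl) (Set.mem_Ici.2 hy) hy
  simp at this
  linarith

lemma cubic_le_exp_neg {y : ℝ} (hy : 0 ≤ y) : 1 - y + y ^ 2 / 2 - y ^ 3 / 6 ≤ Real.exp (-y) := by
  have hd : ∀ t, HasDerivAt (fun t : ℝ => Real.exp (-t) - (1 - t + t ^ 2 / 2 - t ^ 3 / 6))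
      (1 - t + t ^ 2 / 2 - Real.exp (-t)) t := by
    intro t
    have h := (hasDerivAt_id t).neg.exp.sub
      ((((hasDerivAt_id t).const_sub 1).add (((hasDerivAt_id t).pow 2).div_const 2)).sub
        (((hasDerivAt_id t).pow 3).div_const 6))
    refine h.congr_deriv ?_
    simp
    ring
  have hm : MonotoneOn (fun t : ℝ => Real.exp (-t) - (1 - t + t ^ 2 / 2 - t ^ 3 / 6))
      (Set.Ici 0) := by
    refine monotoneOn_of_hasDerivWithinAt_nonneg (convex_Ici 0)
      (fun t _ => (hd t).continuousAt.continuousWithinAt)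
      (fun t _ => (hd t).hasDerivWithinAt) fun t ht => ?_
    rw [interior_Ici] at ht
    have := exp_neg_le_quadratic (le_of_lt ht)
    linarith
  have := hm (Set.mem_Ici.2 le_rfl) (Set.mem_Ici.2 hy) hy
  simp at this
  linarith

section moments

variable {B : Measure ℝ}

lemma loadMoment_nonneg {lam : ℝ} (hlam : 0 < lam) (hB : B (Set.Iio 0) = 0) (j : ℕ) :
    0 ≤ loadMoment lam B j := by
  refine mul_nonneg (by positivity) (integral_nonneg_of_ae ?_)
  filter_upwards [ae_nonneg_of_measure_Iio hB] with x hx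
  simp only [Pi.zero_apply]
  positivity

/-- The third moment controls the mean excess of the service time over the level `a / λ`. -/
lemma lintegral_service_excess_le {lam : ℝ} (hlam : 0 < lam) (hB : B (Set.Iio 0) = 0)
    (hint : Integrable (fun x => x ^ 3) B) {a : ℝ} (ha : 0 < a) :
    ∫⁻ x, ENNReal.ofReal (max (x - a / lam) 0) ∂B ≤
      ENNReal.ofReal (loadMoment lam B 3 / a ^ 2 / lam) := by
  have h1 : loadMoment lam B 3 / a ^ 2 / lam = ∫ x, lam ^ 2 / a ^ 2 * x ^ 3 ∂B := by
    rw [integral_const_mul, loadMoment]; field_simp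
  rw [h1, ofReal_integral_eq_lintegral_ofReal (hint.const_mul _)]
  · refine lintegral_mono_ae ?_
    filter_upwards [ae_nonneg_of_measure_Iio hB] with x hx
    refine ENNReal.ofReal_le_ofReal (max_le ?_ (by positivity))
    rcases le_total x (a / lam) with h | h
    · have : 0 ≤ lam ^ 2 / a ^ 2 * x ^ 3 := by positivity
      linarith
    · have h2 : 1 ≤ lam / a * x := by
        rw [div_le_iff₀ hlam] at h
        rw [div_mul_eq_mul_div, le_div_iff₀ ha]; linarith
      have h3 : 0 < a / lam := by positivity
      have h4 : 1 ≤ (lam / a * x) ^ 2 := one_le_pow₀ h2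
      have h5 : lam ^ 2 / a ^ 2 * x ^ 3 = (lam / a * x) ^ 2 * x := by ring
      rw [h5]; nlinarith
  · filter_upwards [ae_nonneg_of_measure_Iio hB] with x hx
    simp only [Pi.zero_apply]
    positivity

/-- The Laplace transform of the service time at `s = θ λ`, as a real number. -/
noncomputable def laplace (lam : ℝ) (B : Measure ℝ) (θ : ℝ) : ℝ :=
  ∫ x, Real.exp (-(θ * lam * x)) ∂B

variable [IsProbabilityMeasure B]

lemma integrable_pow_of_cube (hB : B (Set.Iio 0) = 0) (hint : Integrable (fun x => x ^ 3) B)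
    {j : ℕ} (hj : j ≤ 3) : Integrable (fun x => x ^ j) B := by
  refine ((integrable_const (1 : ℝ)).add hint).mono' (by fun_prop) ?_
  filter_upwards [ae_nonneg_of_measure_Iio hB] with x hx
  simp only [Pi.add_apply, norm_pow, Real.norm_eq_abs, abs_of_nonneg hx]
  rcases le_total x 1 with h | h
  · have := pow_le_one₀ (n := j) hx h
    have h3 : 0 ≤ x ^ 3 := by positivity
    linarith
  · have := pow_le_pow_right₀ h hj
    linarith

lemma integrable_exp_neg (hB : B (Set.Iio 0) = 0) {s : ℝ} (hs : 0 ≤ s) :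
    Integrable (fun x => Real.exp (-(s * x))) B := by
  refine (integrable_const (1 : ℝ)).mono' (by fun_prop) ?_
  filter_upwards [ae_nonneg_of_measure_Iio hB] with x hx
  rw [Real.norm_eq_abs, abs_of_nonneg (Real.exp_nonneg _), Real.exp_le_one_iff]
  nlinarith

lemma lintegral_exp_eq_laplace {lam : ℝ} (hlam : 0 < lam) (hB : B (Set.Iio 0) = 0) {θ : ℝ}
    (hθ : 0 ≤ θ) : ∫⁻ x, ENNReal.ofReal (Real.exp (-(θ * lam * x))) ∂B =
      ENNReal.ofReal (laplace lam B θ) := by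
  rw [laplace, ofReal_integral_eq_lintegral_ofReal (integrable_exp_neg hB (by positivity))]
  exact Eventually.of_forall fun x => Real.exp_nonneg _

lemma laplace_pos {lam : ℝ} (hlam : 0 < lam) (hB : B (Set.Iio 0) = 0) {θ : ℝ} (hθ : 0 ≤ θ) :
    0 < laplace lam B θ :=
  integral_exp_pos (integrable_exp_neg hB (by positivity))

lemma laplace_le_one {lam : ℝ} (hlam : 0 < lam) (hB : B (Set.Iio 0) = 0) {θ : ℝ} (hθ : 0 ≤ θ) :
    laplace lam B θ ≤ 1 := by
  have : ∫ _, (1 : ℝ) ∂B = 1 := by simp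
  rw [← this, laplace]
  refine integral_mono_ae (integrable_exp_neg hB (by positivity)) (integrable_const _) ?_
  filter_upwards [ae_nonneg_of_measure_Iio hB] with x hx
  rw [Real.exp_le_one_iff]
  have : 0 ≤ θ * lam * x := by positivity
  linarith

lemma laplace_le {lam : ℝ} (hlam : 0 < lam) (hB : B (Set.Iio 0) = 0)
    (hint : Integrable (fun x => x ^ 3) B) {θ : ℝ} (hθ : 0 ≤ θ) :
    laplace lam B θ ≤ 1 - θ * loadMoment lam B 1 + θ ^ 2 / 2 * loadMoment lam B 2 := by
  have i1 := integrable_pow_of_cube hB hint (j := 1) (by norm_num)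
  have i2 := integrable_pow_of_cube hB hint (j := 2) (by norm_num)
  have e : 1 - θ * loadMoment lam B 1 + θ ^ 2 / 2 * loadMoment lam B 2 =
      ∫ x, (1 - θ * lam * x ^ 1 + θ ^ 2 * lam ^ 2 / 2 * x ^ 2) ∂B := by
    rw [integral_add, integral_sub, integral_const_mul, integral_const_mul]
    · simp only [loadMoment, integral_const, probReal_univ, smul_eq_mul, one_mul]; ring
    · exact integrable_const _
    · exact i1.const_mul _
    · exact (integrable_const _).sub (i1.const_mul _)
    · exact i2.const_mul _
  rw [e, laplace]
  refine integral_mono_ae (integrable_exp_neg hB (by positivity))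
    (((integrable_const _).sub (i1.const_mul _)).add (i2.const_mul _)) ?_
  filter_upwards [ae_nonneg_of_measure_Iio hB] with x hx
  have := exp_neg_le_quadratic (y := θ * lam * x) (by positivity)
  linarith

lemma le_laplace {lam : ℝ} (hlam : 0 < lam) (hB : B (Set.Iio 0) = 0)
    (hint : Integrable (fun x => x ^ 3) B) {θ : ℝ} (hθ : 0 ≤ θ) :
    1 - θ * loadMoment lam B 1 + θ ^ 2 / 2 * loadMoment lam B 2 -
      θ ^ 3 / 6 * loadMoment lam B 3 ≤ laplace lam B θ := by
  have i1 := integrable_pow_of_cube hB hint (j := 1) (by norm_num)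
  have i2 := integrable_pow_of_cube hB hint (j := 2) (by norm_num)
  have e : 1 - θ * loadMoment lam B 1 + θ ^ 2 / 2 * loadMoment lam B 2 -
      θ ^ 3 / 6 * loadMoment lam B 3 =
      ∫ x, (1 - θ * lam * x ^ 1 + θ ^ 2 * lam ^ 2 / 2 * x ^ 2 -
        θ ^ 3 * lam ^ 3 / 6 * x ^ 3) ∂B := by
    rw [integral_sub, integral_add, integral_sub, integral_const_mul, integral_const_mul,
      integral_const_mul]
    · simp only [loadMoment, integral_const, probReal_univ, smul_eq_mul, one_mul]; ring
    · exact integrable_const _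
    · exact i1.const_mul _
    · exact (integrable_const _).sub (i1.const_mul _)
    · exact i2.const_mul _
    · exact ((integrable_const _).sub (i1.const_mul _)).add (i2.const_mul _)
    · exact hint.const_mul _
  rw [e, laplace]
  refine integral_mono_ae ((((integrable_const _).sub (i1.const_mul _)).add
    (i2.const_mul _)).sub (hint.const_mul _)) (integrable_exp_neg hB (by positivity)) ?_
  filter_upwards [ae_nonneg_of_measure_Iio hB] with x hx
  have := cubic_le_exp_neg (y := θ * lam * x) (by positivity)
  linarith

/-- The second moment is at least `2 ϱ - 1`, since `(λ x - 1) ^ 2 ≥ 0`. -/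
lemma two_mul_loadMoment_one_sub_one_le {lam : ℝ} (hB : B (Set.Iio 0) = 0)
    (hint : Integrable (fun x => x ^ 3) B) :
    2 * loadMoment lam B 1 - 1 ≤ loadMoment lam B 2 := by
  have i1 := integrable_pow_of_cube hB hint (j := 1) (by norm_num)
  have i2 := integrable_pow_of_cube hB hint (j := 2) (by norm_num)
  have e : loadMoment lam B 2 - (2 * loadMoment lam B 1 - 1) =
      ∫ x, (lam ^ 2 * x ^ 2 - 2 * lam * x ^ 1 + 1) ∂B := by
    rw [integral_add, integral_sub, integral_const_mul, integral_const_mul]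
    · simp only [loadMoment, integral_const, probReal_univ, smul_eq_mul, one_mul]; ring
    · exact i2.const_mul _
    · exact i1.const_mul _
    · exact (i2.const_mul _).sub (i1.const_mul _)
    · exact integrable_const _
  have : 0 ≤ ∫ x, (lam ^ 2 * x ^ 2 - 2 * lam * x ^ 1 + 1) ∂B :=
    integral_nonneg fun x => by
      have := sq_nonneg (lam * x - 1)
      simp only [Pi.zero_apply]
      nlinarith
  linarith

lemma lintegral_service {lam : ℝ} (hlam : 0 < lam) (hB : B (Set.Iio 0) = 0)
    (hint : Integrable (fun x => x ^ 3) B) :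
    ∫⁻ x, ENNReal.ofReal x ∂B = ENNReal.ofReal (loadMoment lam B 1 / lam) := by
  have i1 := integrable_pow_of_cube hB hint (j := 1) (by norm_num)
  simp only [pow_one] at i1
  rw [← ofReal_integral_eq_lintegral_ofReal i1 (ae_nonneg_of_measure_Iio hB)]
  simp only [loadMoment, pow_one]
  congr 1; field_simp

end moments

/-! ### One-step relations between real-valued means -/

section defs

variable {Ω : Type*} [MeasurableSpace Ω] (μ : Measure Ω) (τ χ : ℕ → Ω → ℝ) (ζ : ℕ → Ω → ℕ)

/-- The probability that message `i` arrives during the busy period. -/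
noncomputable def busyProb (i : ℕ) : ℝ := (μ (inBusy τ χ ζ i)).toReal

/-- `accMean` as a real number. -/
noncomputable def accR (s : ℝ) (i : ℕ) : ℝ := (accMean μ τ χ ζ s i).toReal

/-- `refMean` as a real number. -/
noncomputable def refR (s : ℝ) (i : ℕ) : ℝ := (refMean μ τ χ ζ s i).toReal

/-- The probability that message `i` arrives during the busy period and finds a residual service
time of at least `r` at the head of the queue. -/
noncomputable def headProb (r : ℝ) (i : ℕ) : ℝ :=
  (busyMean μ τ χ ζ i fun _ q => if r ≤ q.getD 0 0 then 1 else 0).toReal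

/-- The mean workload found by message `i` during the busy period. -/
noncomputable def workMean (i : ℕ) : ℝ :=
  (busyMean μ τ χ ζ i fun _ q => ENNReal.ofReal q.sum).toReal

/-- The mean excess over the level `M` found by message `i` during the busy period. -/
noncomputable def excessMean (M : ℝ) (i : ℕ) : ℝ :=
  (busyMean μ τ χ ζ i fun _ q => ENNReal.ofReal (excess M q)).toReal

/-- The probability that message `i` arrives during the busy period and that one of the admission
thresholds up to that of message `i` lies outside `[lo, hi]`. -/
noncomputable def badProb (lo hi : ℕ) (i : ℕ) : ℝ :=
  (busyMean μ τ χ ζ i fun z _ =>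
    if ∀ j ≤ i, lo ≤ z j ∧ z j ≤ hi then 0 else 1).toReal

end defs

lemma excess_le_sum {M : ℝ} (hM : 0 ≤ M) {q : List ℝ} (hq : ∀ w ∈ q, 0 ≤ w) :
    excess M q ≤ q.sum := by
  induction q with
  | nil => simp [excess]
  | cons w q ih =>
    simp only [List.mem_cons, forall_eq_or_imp] at hq
    have e1 : excess M (w :: q) = max (w - M) 0 + excess M q := by simp [excess]
    have := ih hq.2
    have h2 : max (w - M) 0 ≤ w := max_le (by linarith) hq.1
    rw [e1, List.sum_cons]; linarith

lemma sum_le_mul_length_add_excess (M : ℝ) (q : List ℝ) :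
    q.sum ≤ M * q.length + excess M q := by
  induction q with
  | nil => simp [excess]
  | cons w q ih =>
    have e1 : excess M (w :: q) = max (w - M) 0 + excess M q := by simp [excess]
    have h2 : w - M ≤ max (w - M) 0 := le_max_left _ _
    rw [e1, List.sum_cons, List.length_cons]; push_cast; linarith

lemma hide_ofReal_exp (B : Measure ℝ) (s : ℝ) (q : List ℝ) :
    hide B (fun q => ENNReal.ofReal (Real.exp (-(s * q.sum)))) q =
      ENNReal.ofReal (Real.exp (-(s * q.getD 0 0))) *
        (∫⁻ x, ENNReal.ofReal (Real.exp (-(s * x))) ∂B) ^ (q.length - 1) := by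
  cases q with
  | nil => simp [hide]
  | cons w q =>
    simp only [hide, List.getD_cons_zero, List.length_cons, Nat.add_sub_cancel]
    rw [← iidMean_exp_neg_sum, ← iidMean_const_mul _ ENNReal.ofReal_ne_top]
    congr 1; funext y
    rw [← ENNReal.ofReal_mul (Real.exp_nonneg _), ← Real.exp_add, List.sum_cons]
    congr 2; ring

lemma hide_ite_length (B : Measure ℝ) (P : ℕ → Prop) [DecidablePred P] (φ : List ℝ → ℝ≥0∞)
    (q : List ℝ) [IsProbabilityMeasure B] :
    hide B (fun q => if P q.length then 0 else φ q) q = if P q.length then 0 else hide B φ q := by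
  cases q with
  | nil => rfl
  | cons w q =>
    simp only [hide]
    by_cases h : P (w :: q).length
    · rw [if_pos h, iidMean_congr (ψ := fun _ => 0) fun y hy => ?_, iidMean_const]
      rw [if_pos (by simpa [hy] using h)]
    · rw [if_neg h]
      refine iidMean_congr fun y hy => ?_
      rw [if_neg (by simpa [hy] using h)]

namespace IsLossSystem

variable {Ω : Type*} [MeasurableSpace Ω] {μ : Measure Ω}
  {lam : ℝ} {B : Measure ℝ} {p : ℝ} {law : ℕ → ℝ≥0∞}
  {τ χ : ℕ → Ω → ℝ} {ζ : ℕ → Ω → ℕ} {mark : ℕ → Ω → Bool}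

lemma busyMean_mono (h : IsLossSystem μ lam B p law τ χ ζ mark) (hB : B (Set.Iio 0) = 0) (i : ℕ)
    {φ ψ : (ℕ → ℕ) → List ℝ → ℝ≥0∞} (hφ : ∀ z q, (∀ w ∈ q, 0 ≤ w) → φ z q ≤ ψ z q) :
    busyMean μ τ χ ζ i φ ≤ busyMean μ τ χ ζ i ψ := by
  refine lintegral_mono_ae (ae_restrict_of_ae ?_)
  filter_upwards [h.ae_χ_nonneg hB] with ω hω
  exact hφ _ _ (state_nonneg hω _ i)

lemma busyMean_const (i : ℕ) (c : ℝ≥0∞) :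
    busyMean μ τ χ ζ i (fun _ _ => c) = c * μ (inBusy τ χ ζ i) := by
  rw [busyMean, setLIntegral_const]

lemma ofReal_exp_le_one {s : ℝ} (hs : 0 ≤ s) {q : List ℝ} (hq : ∀ w ∈ q, 0 ≤ w) :
    ENNReal.ofReal (Real.exp (-(s * q.sum))) ≤ 1 := by
  rw [ENNReal.ofReal_le_one, Real.exp_le_one_iff]
  have := List.sum_nonneg hq
  nlinarith

lemma accR_nonneg (s : ℝ) (i : ℕ) : 0 ≤ accR μ τ χ ζ s i := ENNReal.toReal_nonneg

lemma refR_nonneg (s : ℝ) (i : ℕ) : 0 ≤ refR μ τ χ ζ s i := ENNReal.toReal_nonneg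

lemma excessMean_zero (M : ℝ) : excessMean μ τ χ ζ M 0 = 0 := by
  simp [excessMean, busyMean, state, excess]

lemma workMean_zero : workMean μ τ χ ζ 0 = 0 := by
  simp [workMean, busyMean, state]

lemma length_le_of_bounded {N : ℕ} (hN : ∀ᵐ ω ∂μ, ∀ i, ζ i ω ≤ N) (i : ℕ) :
    ∀ᵐ ω ∂μ, (state (τ · ω) (χ · ω) (ζ · ω) i).length ≤ N + 1 := by
  filter_upwards [hN] with ω hω
  exact length_state_le _ _ fun j _ => hω j

lemma measurable_badFun (lo hi i : ℕ) : Measurable (Function.uncurry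
    fun (z : ℕ → ℕ) (_ : List ℝ) =>
      if ∀ j ≤ i, lo ≤ z j ∧ z j ≤ hi then (0 : ℝ≥0∞) else 1) := by
  refine Measurable.ite ?_ measurable_const measurable_const
  have : {x : (ℕ → ℕ) × List ℝ | ∀ j ≤ i, lo ≤ x.1 j ∧ x.1 j ≤ hi} =
      ⋂ j, ⋂ (_ : j ≤ i), {x | x.1 j ∈ Set.Icc lo hi} := by
    ext; simp
  rw [this]
  refine MeasurableSet.iInter fun j => MeasurableSet.iInter fun _ => ?_
  exact measurableSet_Icc.preimage ((measurable_pi_apply j).comp measurable_fst)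

lemma measurable_hiddenFun (θ : ℝ) :
    Measurable (Function.uncurry fun (_ : ℕ → ℕ) (q : List ℝ) => ENNReal.ofReal
      (Real.exp (-(θ * lam * q.getD 0 0)) * laplace lam B θ ^ (q.length - 1))) := by
  refine Measurable.ennreal_ofReal (Measurable.mul (by fun_prop) ?_)
  exact (measurable_from_nat (f := fun n => laplace lam B θ ^ (n - 1))).comp
    (measurable_length.comp measurable_snd)

lemma accMean_zero_add_refMean_zero (h : IsLossSystem μ lam B p law τ χ ζ mark) (i : ℕ) :
    accMean μ τ χ ζ 0 i + refMean μ τ χ ζ 0 i = μ (inBusy τ χ ζ i) := by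
  rw [← h.busyMean_exp]
  simpa using busyMean_const (μ := μ) (τ := τ) (χ := χ) (ζ := ζ) i 1

lemma accMean_le (h : IsLossSystem μ lam B p law τ χ ζ mark) (hB : B (Set.Iio 0) = 0) {s : ℝ}
    (hs : 0 ≤ s) (i : ℕ) : accMean μ τ χ ζ s i ≤ accMean μ τ χ ζ 0 i :=
  h.busyMean_mono hB i fun z q hq => by
    split_ifs
    · simpa using ofReal_exp_le_one hs hq
    · exact le_rfl

lemma refMean_le (h : IsLossSystem μ lam B p law τ χ ζ mark) (hB : B (Set.Iio 0) = 0) {s : ℝ}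
    (hs : 0 ≤ s) (i : ℕ) : refMean μ τ χ ζ s i ≤ refMean μ τ χ ζ 0 i :=
  h.busyMean_mono hB i fun z q hq => by
    split_ifs
    · exact le_rfl
    · simpa using ofReal_exp_le_one hs hq

variable [IsProbabilityMeasure μ]

lemma accMean_ne_top (h : IsLossSystem μ lam B p law τ χ ζ mark) (hB : B (Set.Iio 0) = 0) {s : ℝ}
    (hs : 0 ≤ s) (i : ℕ) : accMean μ τ χ ζ s i ≠ ∞ := by
  refine ne_top_of_le_ne_top (measure_ne_top μ (inBusy τ χ ζ i)) ?_
  rw [← h.accMean_zero_add_refMean_zero]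
  exact (h.accMean_le hB hs i).trans le_self_add

lemma refMean_ne_top (h : IsLossSystem μ lam B p law τ χ ζ mark) (hB : B (Set.Iio 0) = 0) {s : ℝ}
    (hs : 0 ≤ s) (i : ℕ) : refMean μ τ χ ζ s i ≠ ∞ := by
  refine ne_top_of_le_ne_top (measure_ne_top μ (inBusy τ χ ζ i)) ?_
  rw [← h.accMean_zero_add_refMean_zero]
  exact (h.refMean_le hB hs i).trans le_add_self

lemma accR_le (h : IsLossSystem μ lam B p law τ χ ζ mark) (hB : B (Set.Iio 0) = 0) {s : ℝ}
    (hs : 0 ≤ s) (i : ℕ) : accR μ τ χ ζ s i ≤ accR μ τ χ ζ 0 i :=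
  ENNReal.toReal_mono (h.accMean_ne_top hB le_rfl i) (h.accMean_le hB hs i)

lemma refR_le (h : IsLossSystem μ lam B p law τ χ ζ mark) (hB : B (Set.Iio 0) = 0) {s : ℝ}
    (hs : 0 ≤ s) (i : ℕ) : refR μ τ χ ζ s i ≤ refR μ τ χ ζ 0 i :=
  ENNReal.toReal_mono (h.refMean_ne_top hB le_rfl i) (h.refMean_le hB hs i)

lemma busyProb_eq (h : IsLossSystem μ lam B p law τ χ ζ mark) (hB : B (Set.Iio 0) = 0) (i : ℕ) :
    busyProb μ τ χ ζ i = accR μ τ χ ζ 0 i + refR μ τ χ ζ 0 i := by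
  rw [accR, refR, ← ENNReal.toReal_add (h.accMean_ne_top hB le_rfl i)
    (h.refMean_ne_top hB le_rfl i), h.accMean_zero_add_refMean_zero, busyProb]

lemma busyProb_zero : busyProb μ τ χ ζ 0 = 1 := by simp [busyProb, inBusy_zero]

lemma antitone_busyProb : Antitone (busyProb μ τ χ ζ) :=
  antitone_nat_of_succ_le fun _ => ENNReal.toReal_mono (measure_ne_top _ _)
    (measure_mono fun _ hω => (mem_inBusy_succ.1 hω).1)

lemma toReal_measure_diff (h : IsLossSystem μ lam B p law τ χ ζ mark) (i : ℕ) :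
    (μ (inBusy τ χ ζ i \ inBusy τ χ ζ (i + 1))).toReal =
      busyProb μ τ χ ζ i - busyProb μ τ χ ζ (i + 1) := by
  have hsub : inBusy τ χ ζ (i + 1) ⊆ inBusy τ χ ζ i := fun ω hω => (mem_inBusy_succ.1 hω).1
  rw [measure_sdiff hsub (h.measurableSet_inBusy' _).nullMeasurableSet (measure_ne_top _ _),
    ENNReal.toReal_sub_of_le (measure_mono hsub) (measure_ne_top _ _)]
  rfl

/-- The balance of `exp (-s W)` over one step, for `s = θ λ`. -/
lemma accR_add_refR_succ (h : IsLossSystem μ lam B p law τ χ ζ mark) (hB : B (Set.Iio 0) = 0)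
    (hlam : 0 < lam) {θ : ℝ} (hθ : 0 ≤ θ) (hθ1 : θ < 1) (i : ℕ) :
    (laplace lam B θ - 1 + θ) * accR μ τ χ ζ (θ * lam) i + θ * refR μ τ χ ζ (θ * lam) i =
      (busyProb μ τ χ ζ i - (1 - θ) * (accR μ τ χ ζ (θ * lam) i + refR μ τ χ ζ (θ * lam) i)) -
      (busyProb μ τ χ ζ (i + 1) - (1 - θ) *
        (accR μ τ χ ζ (θ * lam) (i + 1) + refR μ τ χ ζ (θ * lam) (i + 1))) := by
  have := h.isProbabilityMeasure_service
  have hs : 0 ≤ θ * lam := by positivity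
  have key := congrArg ENNReal.toReal
    (h.accMean_succ_add_refMean_succ hB hs (by nlinarith) i)
  have fa := h.accMean_ne_top hB hs
  have fr := h.refMean_ne_top hB hs
  rw [lintegral_exp_eq_laplace hlam hB hθ] at key
  have hc : lam / (lam - θ * lam) = 1 / (1 - θ) := by
    have : (1 - θ) ≠ 0 := by linarith
    have : lam - θ * lam = lam * (1 - θ) := by ring
    rw [this]; field_simp
  have hc0 : 0 < 1 - θ := by linarith
  rw [ENNReal.toReal_add (ENNReal.add_ne_top.2 ⟨fa _, fr _⟩)
    (ENNReal.mul_ne_top ENNReal.ofReal_ne_top (measure_ne_top _ _)),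
    ENNReal.toReal_add (fa _) (fr _), ENNReal.toReal_mul, ENNReal.toReal_mul,
    ENNReal.toReal_add (ENNReal.mul_ne_top ENNReal.ofReal_ne_top (fa _)) (fr _),
    ENNReal.toReal_mul, h.toReal_measure_diff, hc, ENNReal.toReal_ofReal (by positivity),
    ENNReal.toReal_ofReal (laplace_pos hlam hB hθ).le] at key
  change accR μ τ χ ζ (θ * lam) (i + 1) + refR μ τ χ ζ (θ * lam) (i + 1) + _ =
    _ * (_ * accR μ τ χ ζ (θ * lam) i + refR μ τ χ ζ (θ * lam) i) at key
  field_simp at key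
  linarith

lemma workload_ne_top (h : IsLossSystem μ lam B p law τ χ ζ mark) (hB : B (Set.Iio 0) = 0)
    (hlam : 0 < lam) (hint : Integrable (fun x => x ^ 3) B) (i : ℕ) :
    busyMean μ τ χ ζ i (fun _ q => ENNReal.ofReal q.sum) ≠ ∞ := by
  have := h.isProbabilityMeasure_service
  induction i with
  | zero => simp [busyMean, state]
  | succ i ih =>
    have key := h.busyMean_workload_succ hB hlam i
    rw [lintegral_service hlam hB hint] at key
    refine ne_top_of_le_ne_top ?_ (le_self_add.trans_eq key)
    exact ENNReal.add_ne_top.2 ⟨ih, ENNReal.mul_ne_top ENNReal.ofReal_ne_top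
      (h.accMean_ne_top hB le_rfl i)⟩

/-- The balance of the workload over one step. -/
lemma workMean_succ (h : IsLossSystem μ lam B p law τ χ ζ mark) (hB : B (Set.Iio 0) = 0)
    (hlam : 0 < lam) (hint : Integrable (fun x => x ^ 3) B) (i : ℕ) :
    lam * workMean μ τ χ ζ (i + 1) + busyProb μ τ χ ζ (i + 1) =
      lam * workMean μ τ χ ζ i + loadMoment lam B 1 * accR μ τ χ ζ 0 i := by
  have := h.isProbabilityMeasure_service
  have key := congrArg ENNReal.toReal (h.busyMean_workload_succ hB hlam i)
  rw [lintegral_service hlam hB hint, ENNReal.toReal_add (h.workload_ne_top hB hlam hint _)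
    (ENNReal.mul_ne_top ENNReal.ofReal_ne_top (measure_ne_top _ _)),
    ENNReal.toReal_add (h.workload_ne_top hB hlam hint _)
    (ENNReal.mul_ne_top ENNReal.ofReal_ne_top (h.accMean_ne_top hB le_rfl i)),
    ENNReal.toReal_mul, ENNReal.toReal_mul, ENNReal.toReal_ofReal (by positivity),
    ENNReal.toReal_ofReal (div_nonneg (loadMoment_nonneg hlam hB 1) hlam.le)] at key
  change workMean μ τ χ ζ (i + 1) + 1 / lam * busyProb μ τ χ ζ (i + 1) =
    workMean μ τ χ ζ i + loadMoment lam B 1 / lam * accR μ τ χ ζ 0 i at key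
  field_simp at key
  linarith

lemma excess_ne_top (h : IsLossSystem μ lam B p law τ χ ζ mark) (hB : B (Set.Iio 0) = 0)
    (hlam : 0 < lam) (hint : Integrable (fun x => x ^ 3) B) {M : ℝ} (hM : 0 ≤ M) (i : ℕ) :
    busyMean μ τ χ ζ i (fun _ q => ENNReal.ofReal (excess M q)) ≠ ∞ :=
  ne_top_of_le_ne_top (h.workload_ne_top hB hlam hint i)
    (h.busyMean_mono hB i fun _ _ hq => ENNReal.ofReal_le_ofReal (excess_le_sum hM hq))

lemma excessMean_le_workMean (h : IsLossSystem μ lam B p law τ χ ζ mark)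
    (hB : B (Set.Iio 0) = 0) (hlam : 0 < lam) (hint : Integrable (fun x => x ^ 3) B) {M : ℝ}
    (hM : 0 ≤ M) (i : ℕ) : excessMean μ τ χ ζ M i ≤ workMean μ τ χ ζ i :=
  ENNReal.toReal_mono (h.workload_ne_top hB hlam hint i)
    (h.busyMean_mono hB i fun _ _ hq => ENNReal.ofReal_le_ofReal (excess_le_sum hM hq))

lemma busyMean_ne_top_of_le_one (i : ℕ) {φ : (ℕ → ℕ) → List ℝ → ℝ≥0∞} (hφ : ∀ z q, φ z q ≤ 1) :
    busyMean μ τ χ ζ i φ ≠ ∞ := by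
  refine ne_top_of_le_ne_top (measure_ne_top μ (inBusy τ χ ζ i)) ?_
  rw [← one_mul (μ _), ← busyMean_const]
  exact lintegral_mono fun ω => hφ _ _

/-- The balance of the excess over the level `a / λ` over one step. -/
lemma headProb_le (h : IsLossSystem μ lam B p law τ χ ζ mark) (hB : B (Set.Iio 0) = 0)
    (hlam : 0 < lam) (hint : Integrable (fun x => x ^ 3) B) {a : ℝ} (ha : 0 < a) (i : ℕ) :
    headProb μ τ χ ζ ((a + 1) / lam) i ≤
      Real.exp 1 * (lam * excessMean μ τ χ ζ (a / lam) i) -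
        Real.exp 1 * (lam * excessMean μ τ χ ζ (a / lam) (i + 1)) +
        Real.exp 1 * (loadMoment lam B 3 / a ^ 2) * accR μ τ χ ζ 0 i := by
  have hM : 0 ≤ a / lam := by positivity
  have h3 := loadMoment_nonneg hlam hB 3
  have fe := h.excess_ne_top hB hlam hint hM
  have fb := busyMean_ne_top_of_le_one (μ := μ) (τ := τ) (χ := χ) (ζ := ζ) i
    (φ := fun _ q => if (a + 1) / lam ≤ q.getD 0 0 then 1 else 0)
    (fun _ q => by split_ifs <;> simp)
  have key := h.busyMean_excess_succ_le hB hlam hM i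
  have key2 := key.trans (add_le_add_right (mul_le_mul_left
    (lintegral_service_excess_le hlam hB hint ha) _) _)
  rw [← add_div] at key2
  have key3 := ENNReal.toReal_mono (ENNReal.add_ne_top.2 ⟨fe _, ENNReal.mul_ne_top
      ENNReal.ofReal_ne_top (h.accMean_ne_top hB le_rfl i)⟩) key2
  rw [ENNReal.toReal_add (fe _) (ENNReal.mul_ne_top ENNReal.ofReal_ne_top fb),
    ENNReal.toReal_add (fe _) (ENNReal.mul_ne_top
      ENNReal.ofReal_ne_top (h.accMean_ne_top hB le_rfl i)),
    ENNReal.toReal_mul, ENNReal.toReal_mul, ENNReal.toReal_ofReal (by positivity),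
    ENNReal.toReal_ofReal (by positivity)] at key3
  change excessMean μ τ χ ζ (a / lam) (i + 1) +
    Real.exp (-1) / lam * headProb μ τ χ ζ ((a + 1) / lam) i ≤
    excessMean μ τ χ ζ (a / lam) i + loadMoment lam B 3 / a ^ 2 / lam * accR μ τ χ ζ 0 i at key3
  have he : Real.exp 1 * Real.exp (-1) = 1 := by rw [← Real.exp_add]; simp
  have h4 := mul_le_mul_of_nonneg_left key3 (a := Real.exp 1 * lam) (by positivity)
  have h5 : Real.exp 1 * lam * (excessMean μ τ χ ζ (a / lam) (i + 1) +
      Real.exp (-1) / lam * headProb μ τ χ ζ ((a + 1) / lam) i) =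
      Real.exp 1 * (lam * excessMean μ τ χ ζ (a / lam) (i + 1)) +
        (Real.exp 1 * Real.exp (-1)) * headProb μ τ χ ζ ((a + 1) / lam) i := by
    field_simp
  have h6 : Real.exp 1 * lam * (excessMean μ τ χ ζ (a / lam) i +
      loadMoment lam B 3 / a ^ 2 / lam * accR μ τ χ ζ 0 i) =
      Real.exp 1 * (lam * excessMean μ τ χ ζ (a / lam) i) +
        Real.exp 1 * (loadMoment lam B 3 / a ^ 2) * accR μ τ χ ζ 0 i := by
    field_simp
  rw [h5, h6, he] at h4
  linarith

lemma excessMean_le (h : IsLossSystem μ lam B p law τ χ ζ mark) (hB : B (Set.Iio 0) = 0)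
    (hlam : 0 < lam) (hint : Integrable (fun x => x ^ 3) B) {a : ℝ} (ha : 0 < a) (i : ℕ) :
    lam * excessMean μ τ χ ζ (a / lam) i ≤ i * (loadMoment lam B 3 / a ^ 2) := by
  have h3 := loadMoment_nonneg hlam hB 3
  induction i with
  | zero => simp [excessMean_zero]
  | succ i ih =>
    have h1 := h.headProb_le hB hlam hint ha i
    have h2 : 0 ≤ headProb μ τ χ ζ ((a + 1) / lam) i := ENNReal.toReal_nonneg
    have h4 : accR μ τ χ ζ 0 i ≤ 1 := by
      have e1 := h.busyProb_eq hB i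
      have e2 := refR_nonneg (μ := μ) (τ := τ) (χ := χ) (ζ := ζ) 0 i
      have e3 := antitone_busyProb (μ := μ) (τ := τ) (χ := χ) (ζ := ζ) (Nat.zero_le i)
      rw [busyProb_zero] at e3
      linarith
    have h5 : Real.exp 1 * (lam * excessMean μ τ χ ζ (a / lam) (i + 1)) ≤
        Real.exp 1 * (lam * excessMean μ τ χ ζ (a / lam) i +
          loadMoment lam B 3 / a ^ 2 * accR μ τ χ ζ 0 i) := by linarith
    have h6 := le_of_mul_le_mul_left h5 (Real.exp_pos 1)
    have h7 : 0 ≤ loadMoment lam B 3 / a ^ 2 := by positivity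
    push_cast
    nlinarith

/-- The workload is at most `a / λ` for each message present, plus the excess over `a / λ`. -/
lemma workMean_le (h : IsLossSystem μ lam B p law τ χ ζ mark) (hB : B (Set.Iio 0) = 0)
    (hlam : 0 < lam) (hint : Integrable (fun x => x ^ 3) B) {N : ℕ}
    (hN : ∀ᵐ ω ∂μ, ∀ i, ζ i ω ≤ N) {a : ℝ} (ha : 0 < a) (i : ℕ) :
    lam * workMean μ τ χ ζ i ≤
      a * (N + 1) * busyProb μ τ χ ζ i + i * (loadMoment lam B 3 / a ^ 2) := by
  have hM : 0 ≤ a / lam := by positivity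
  have fe := h.excess_ne_top hB hlam hint hM i
  have h1 : busyMean μ τ χ ζ i (fun _ q => ENNReal.ofReal q.sum) ≤
      ENNReal.ofReal (a / lam * (N + 1)) * μ (inBusy τ χ ζ i) +
        busyMean μ τ χ ζ i (fun _ q => ENNReal.ofReal (excess (a / lam) q)) := by
    rw [← busyMean_const, ← h.busyMean_add i (by fun_prop)]
    refine lintegral_mono_ae (ae_restrict_of_ae ?_)
    filter_upwards [length_le_of_bounded (τ := τ) (χ := χ) hN i] with ω hω
    rw [← ENNReal.ofReal_add (by positivity) (excess_nonneg _ _)]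
    refine ENNReal.ofReal_le_ofReal ((sum_le_mul_length_add_excess (a / lam) _).trans ?_)
    have : ((state (τ · ω) (χ · ω) (ζ · ω) i).length : ℝ) ≤ N + 1 := by exact_mod_cast hω
    have := mul_le_mul_of_nonneg_left this hM
    linarith
  have h2 := ENNReal.toReal_mono (ENNReal.add_ne_top.2 ⟨ENNReal.mul_ne_top ENNReal.ofReal_ne_top
    (measure_ne_top _ _), fe⟩) h1
  rw [ENNReal.toReal_add (ENNReal.mul_ne_top ENNReal.ofReal_ne_top (measure_ne_top _ _)) fe,
    ENNReal.toReal_mul, ENNReal.toReal_ofReal (by positivity)] at h2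
  change workMean μ τ χ ζ i ≤ a / lam * (N + 1) * busyProb μ τ χ ζ i +
    excessMean μ τ χ ζ (a / lam) i at h2
  have h3 := h.excessMean_le hB hlam hint ha i
  have h4 := mul_le_mul_of_nonneg_left h2 hlam.le
  have h5 : lam * (a / lam * (N + 1) * busyProb μ τ χ ζ i + excessMean μ τ χ ζ (a / lam) i) =
      a * (N + 1) * busyProb μ τ χ ζ i + lam * excessMean μ τ χ ζ (a / lam) i := by
    field_simp
  linarith

/-- `exp (-s W)` averaged over the service times of the waiting messages. -/
lemma busyMean_exp_hidden (h : IsLossSystem μ lam B p law τ χ ζ mark) (hB : B (Set.Iio 0) = 0)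
    (hlam : 0 < lam) {θ : ℝ} (hθ : 0 ≤ θ) (i : ℕ) :
    accMean μ τ χ ζ (θ * lam) i + refMean μ τ χ ζ (θ * lam) i = busyMean μ τ χ ζ i fun _ q =>
      ENNReal.ofReal (Real.exp (-(θ * lam * q.getD 0 0)) * laplace lam B θ ^ (q.length - 1)) := by
  have := h.isProbabilityMeasure_service
  rw [← h.busyMean_exp, h.busyMean_hide i (by fun_prop)]
  congr 1; funext z q
  rw [hide_ofReal_exp, lintegral_exp_eq_laplace hlam hB hθ, ← ENNReal.ofReal_pow
    (laplace_pos hlam hB hθ).le, ← ENNReal.ofReal_mul (Real.exp_nonneg _)]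

/-- `exp (-s W)` at the refused messages, averaged over the service times of the waiting ones. -/
lemma refMean_hidden (h : IsLossSystem μ lam B p law τ χ ζ mark) (hB : B (Set.Iio 0) = 0)
    (hlam : 0 < lam) {θ : ℝ} (hθ : 0 ≤ θ) (i : ℕ) :
    refMean μ τ χ ζ (θ * lam) i = busyMean μ τ χ ζ i fun z q =>
      if q.length ≤ z i then 0 else
        ENNReal.ofReal (Real.exp (-(θ * lam * q.getD 0 0)) * laplace lam B θ ^ (q.length - 1)) := by
  have := h.isProbabilityMeasure_service
  rw [refMean, h.busyMean_hide i (measurable_refFun _ _)]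
  congr 1; funext z q
  rw [hide_ite_length B (fun n => n ≤ z i)]
  split_ifs
  · rfl
  · rw [hide_ofReal_exp, lintegral_exp_eq_laplace hlam hB hθ, ← ENNReal.ofReal_pow
      (laplace_pos hlam hB hθ).le, ← ENNReal.ofReal_mul (Real.exp_nonneg _)]

lemma le_hidden_exp {lam θ r w : ℝ} (hlam : 0 < lam) (hθ : 0 ≤ θ) [IsProbabilityMeasure B]
    (hB : B (Set.Iio 0) = 0) (hw : w ≤ r / lam) {m n : ℕ} (hmn : m ≤ n) :
    Real.exp (-(θ * r)) * laplace lam B θ ^ n ≤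
      Real.exp (-(θ * lam * w)) * laplace lam B θ ^ m := by
  have h0 := laplace_pos hlam hB hθ
  refine mul_le_mul (Real.exp_le_exp.2 ?_)
    (pow_le_pow_of_le_one h0.le (laplace_le_one hlam hB hθ) hmn) (by positivity) (by positivity)
  rw [le_div_iff₀ hlam] at hw
  nlinarith

/-- With a moderate residual service time at the head of the queue, `exp (-s W)` is bounded below
in the mean, since the queue is bounded. -/
lemma busyProb_le (h : IsLossSystem μ lam B p law τ χ ζ mark) (hB : B (Set.Iio 0) = 0)
    (hlam : 0 < lam) {N : ℕ} (hN : ∀ᵐ ω ∂μ, ∀ i, ζ i ω ≤ N) {θ r : ℝ} (hθ : 0 ≤ θ) (hr : 0 ≤ r)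
    (i : ℕ) : Real.exp (-(θ * r)) * laplace lam B θ ^ N * busyProb μ τ χ ζ i ≤
      accR μ τ χ ζ (θ * lam) i + refR μ τ χ ζ (θ * lam) i + headProb μ τ χ ζ (r / lam) i := by
  have := h.isProbabilityMeasure_service
  have hs : 0 ≤ θ * lam := by positivity
  have h0 := laplace_pos hlam hB hθ
  have fa := h.accMean_ne_top hB hs i
  have fr := h.refMean_ne_top hB hs i
  have fb := busyMean_ne_top_of_le_one (μ := μ) (τ := τ) (χ := χ) (ζ := ζ) i
    (φ := fun _ q => if r / lam ≤ q.getD 0 0 then 1 else 0)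
    (fun _ q => by split_ifs <;> simp)
  have h1 : ENNReal.ofReal (Real.exp (-(θ * r)) * laplace lam B θ ^ N) * μ (inBusy τ χ ζ i) ≤
      accMean μ τ χ ζ (θ * lam) i + refMean μ τ χ ζ (θ * lam) i +
        busyMean μ τ χ ζ i fun _ q => if r / lam ≤ q.getD 0 0 then 1 else 0 := by
    rw [h.busyMean_exp_hidden hB hlam hθ, ← busyMean_const, ← h.busyMean_add]
    · refine lintegral_mono_ae (ae_restrict_of_ae ?_)
      filter_upwards [length_le_of_bounded (τ := τ) (χ := χ) hN i] with ω hω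
      split_ifs with h2
      · refine le_trans ?_ le_add_self
        rw [ENNReal.ofReal_le_one]
        exact mul_le_one₀ (Real.exp_le_one_iff.2 (by nlinarith)) (by positivity)
          (pow_le_one₀ h0.le (laplace_le_one hlam hB hθ))
      · rw [add_zero]
        refine ENNReal.ofReal_le_ofReal (le_hidden_exp hlam hθ hB (not_le.1 h2).le (by omega))
    · exact measurable_hiddenFun θ
  have h2 := ENNReal.toReal_mono (ENNReal.add_ne_top.2 ⟨ENNReal.add_ne_top.2 ⟨fa, fr⟩, fb⟩) h1
  rwa [ENNReal.toReal_add (ENNReal.add_ne_top.2 ⟨fa, fr⟩) fb, ENNReal.toReal_add fa fr,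
    ENNReal.toReal_mul, ENNReal.toReal_ofReal (by positivity)] at h2

/-- A refused message finds more than `lo` messages unless a threshold is below `lo`. -/
lemma refR_le_add_badProb (h : IsLossSystem μ lam B p law τ χ ζ mark) (hB : B (Set.Iio 0) = 0)
    (hlam : 0 < lam) {θ : ℝ} (hθ : 0 ≤ θ) (lo hi i : ℕ) :
    refR μ τ χ ζ (θ * lam) i ≤
      laplace lam B θ ^ lo * refR μ τ χ ζ 0 i + badProb μ τ χ ζ lo hi i := by
  have := h.isProbabilityMeasure_service
  have hs : 0 ≤ θ * lam := by positivity
  have h0 := laplace_pos hlam hB hθ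
  have hl1 := laplace_le_one hlam hB hθ
  have fr := h.refMean_ne_top hB le_rfl i
  have fb := busyMean_ne_top_of_le_one (μ := μ) (τ := τ) (χ := χ) (ζ := ζ) i
    (φ := fun z _ => if ∀ j ≤ i, lo ≤ z j ∧ z j ≤ hi then 0 else 1)
    (fun z q => by split_ifs <;> simp)
  have h1 : refMean μ τ χ ζ (θ * lam) i ≤
      ENNReal.ofReal (laplace lam B θ ^ lo) * refMean μ τ χ ζ 0 i +
        busyMean μ τ χ ζ i fun z _ => if ∀ j ≤ i, lo ≤ z j ∧ z j ≤ hi then 0 else 1 := by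
    rw [h.refMean_hidden hB hlam hθ, refMean, ← busyMean_const_mul i ENNReal.ofReal_ne_top,
      ← h.busyMean_add i ((measurable_refFun 0 i).const_mul _)]
    refine h.busyMean_mono hB i fun z q hq => ?_
    by_cases hl : q.length ≤ z i
    · simp [hl]
    · have hw : 0 ≤ q.getD 0 0 := by
        cases q with
        | nil => simp
        | cons w q => simpa using hq w (by simp)
      have he : Real.exp (-(θ * lam * q.getD 0 0)) ≤ 1 := by
        rw [Real.exp_le_one_iff]
        have : 0 ≤ θ * lam * q.getD 0 0 := by positivity
        linarith
      simp only [if_neg hl, zero_mul, neg_zero, Real.exp_zero, ENNReal.ofReal_one, mul_one]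
      split_ifs with hz
      · rw [add_zero]
        refine ENNReal.ofReal_le_ofReal ?_
        have := hz i le_rfl
        exact (mul_le_of_le_one_left (by positivity) he).trans
          (pow_le_pow_of_le_one h0.le hl1 (by omega))
      · refine le_trans ?_ le_add_self
        rw [ENNReal.ofReal_le_one]
        exact mul_le_one₀ he (by positivity) (pow_le_one₀ h0.le hl1)
  have h2 := ENNReal.toReal_mono (ENNReal.add_ne_top.2 ⟨ENNReal.mul_ne_top ENNReal.ofReal_ne_top
    fr, fb⟩) h1
  rwa [ENNReal.toReal_add (ENNReal.mul_ne_top ENNReal.ofReal_ne_top fr) fb, ENNReal.toReal_mul,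
    ENNReal.toReal_ofReal (by positivity)] at h2

/-- A refused message finds at most `hi + 1` messages unless a threshold was above `hi`. -/
lemma le_refR_add_badProb (h : IsLossSystem μ lam B p law τ χ ζ mark) (hB : B (Set.Iio 0) = 0)
    (hlam : 0 < lam) {θ r : ℝ} (hθ : 0 ≤ θ) (hr : 0 ≤ r) (lo hi i : ℕ) :
    Real.exp (-(θ * r)) * laplace lam B θ ^ hi * refR μ τ χ ζ 0 i ≤
      refR μ τ χ ζ (θ * lam) i + headProb μ τ χ ζ (r / lam) i + badProb μ τ χ ζ lo hi i := by
  have := h.isProbabilityMeasure_service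
  have hs : 0 ≤ θ * lam := by positivity
  have h0 := laplace_pos hlam hB hθ
  have hl1 := laplace_le_one hlam hB hθ
  have fr := h.refMean_ne_top hB hs i
  have fh := busyMean_ne_top_of_le_one (μ := μ) (τ := τ) (χ := χ) (ζ := ζ) i
    (φ := fun _ q => if r / lam ≤ q.getD 0 0 then 1 else 0)
    (fun _ q => by split_ifs <;> simp)
  have fb := busyMean_ne_top_of_le_one (μ := μ) (τ := τ) (χ := χ) (ζ := ζ) i
    (φ := fun z _ => if ∀ j ≤ i, lo ≤ z j ∧ z j ≤ hi then 0 else 1)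
    (fun z q => by split_ifs <;> simp)
  have hk1 : ENNReal.ofReal (Real.exp (-(θ * r)) * laplace lam B θ ^ hi) ≤ 1 := by
    rw [ENNReal.ofReal_le_one]
    exact mul_le_one₀ (Real.exp_le_one_iff.2 (by nlinarith)) (by positivity)
      (pow_le_one₀ h0.le hl1)
  have h1 : ENNReal.ofReal (Real.exp (-(θ * r)) * laplace lam B θ ^ hi) * refMean μ τ χ ζ 0 i ≤
      refMean μ τ χ ζ (θ * lam) i +
        (busyMean μ τ χ ζ i fun _ q => if r / lam ≤ q.getD 0 0 then 1 else 0) +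
        busyMean μ τ χ ζ i fun z _ => if ∀ j ≤ i, lo ≤ z j ∧ z j ≤ hi then 0 else 1 := by
    rw [h.refMean_hidden hB hlam hθ, refMean, ← busyMean_const_mul i ENNReal.ofReal_ne_top,
      add_assoc, add_comm, add_assoc, ← h.busyMean_add i (measurable_badFun lo hi i),
      add_comm, ← h.busyMean_add]
    · refine lintegral_mono fun ω => ?_
      by_cases hl : (state (τ · ω) (χ · ω) (ζ · ω) i).length ≤ ζ i ω
      · simp [hl]
      · simp only [if_neg hl, zero_mul, neg_zero, Real.exp_zero, ENNReal.ofReal_one, mul_one]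
        split_ifs with h2 h3 h3
        · exact hk1.trans (by simp)
        · simp only [zero_add, add_zero]
          refine ENNReal.ofReal_le_ofReal (le_hidden_exp hlam hθ hB (not_le.1 h3).le ?_)
          have := length_state_le (τ · ω) (χ · ω) (ζ := (ζ · ω)) (i := i) (n := hi)
            fun j hj => (h2 j hj.le).2
          omega
        · exact hk1.trans (by simp)
        · exact hk1.trans (by simp)
    · exact (measurable_badFun lo hi i).add (Measurable.ite (measurableSet_length_le i)
        measurable_const (measurable_hiddenFun θ))
  have h2 := ENNReal.toReal_mono (ENNReal.add_ne_top.2 ⟨ENNReal.add_ne_top.2 ⟨fr, fh⟩, fb⟩) h1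
  rwa [ENNReal.toReal_add (ENNReal.add_ne_top.2 ⟨fr, fh⟩) fb, ENNReal.toReal_add fr fh,
    ENNReal.toReal_mul, ENNReal.toReal_ofReal (by positivity)] at h2

end IsLossSystem

/-! ### Totals over the busy period -/

lemma expectedCard_eq_tsum {Ω : Type*} [MeasurableSpace Ω] (μ : Measure Ω) {S : Ω → Set ℕ}
    (hS : ∀ i, MeasurableSet {ω | i ∈ S ω}) :
    expectedCard μ S = ∑' i, μ {ω | i ∈ S ω} := by
  have h1 : ∀ ω, ((S ω).encard : ℝ≥0∞) = ∑' i, {ω | i ∈ S ω}.indicator 1 ω := by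
    intro ω
    rw [← Measure.count_apply (MeasurableSet.of_discrete (s := S ω)),
      ← lintegral_indicator_one (MeasurableSet.of_discrete (s := S ω)), lintegral_count]
    rfl
  simp only [expectedCard, h1]
  rw [lintegral_tsum fun i => (measurable_one.indicator (hS i)).aemeasurable]
  exact tsum_congr fun i => lintegral_indicator_one (hS i)

lemma measurableSet_past_processed {Ω : Type*} {τ χ : ℕ → Ω → ℝ} {ζ : ℕ → Ω → ℕ}
    {mark : ℕ → Ω → Bool} (i : ℕ) :
    MeasurableSet[MeasurableSpace.comap (past τ χ ζ mark i) inferInstance]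
      {ω | i ∈ processed (τ · ω) (χ · ω) (ζ · ω)} := by
  let _ := MeasurableSpace.comap (past τ χ ζ mark i) inferInstance
  exact (measurableSet_past_inBusy i).inter (measurableSet_le
    (measurable_length.comp (measurable_past_state i)) (measurable_past_ζ i i))

namespace IsLossSystem

variable {Ω : Type*} [MeasurableSpace Ω] {μ : Measure Ω}
  {lam : ℝ} {B : Measure ℝ} {p : ℝ} {law : ℕ → ℝ≥0∞}
  {τ χ : ℕ → Ω → ℝ} {ζ : ℕ → Ω → ℕ} {mark : ℕ → Ω → Bool}

lemma measurableSet_processed (h : IsLossSystem μ lam B p law τ χ ζ mark) (i : ℕ) :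
    MeasurableSet {ω | i ∈ processed (τ · ω) (χ · ω) (ζ · ω)} :=
  (h.measurableSet_inBusy' i).inter (measurableSet_le
    (measurable_length.comp (h.measurable_state' i)) (h.measurable_ζ i))

lemma measurableSet_refused (h : IsLossSystem μ lam B p law τ χ ζ mark) (i : ℕ) :
    MeasurableSet {ω | i ∈ refused (τ · ω) (χ · ω) (ζ · ω)} :=
  (h.measurableSet_inBusy' i).inter (measurableSet_lt (h.measurable_ζ i)
    (measurable_length.comp (h.measurable_state' i)))

lemma measure_processed (h : IsLossSystem μ lam B p law τ χ ζ mark) (i : ℕ) :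
    μ {ω | i ∈ processed (τ · ω) (χ · ω) (ζ · ω)} = accMean μ τ χ ζ 0 i := by
  rw [accMean, busyMean, ← lintegral_indicator_one (h.measurableSet_processed i),
    ← lintegral_indicator (h.measurableSet_inBusy' i)]
  refine lintegral_congr fun ω => ?_
  by_cases h1 : ω ∈ inBusy τ χ ζ i
  · by_cases h2 : (state (τ · ω) (χ · ω) (ζ · ω) i).length ≤ ζ i ω
    · rw [Set.indicator_of_mem (show ω ∈ {ω | i ∈ processed (τ · ω) (χ · ω) (ζ · ω)} from ⟨h1, h2⟩),
        Set.indicator_of_mem h1]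
      simp [h2]
    · rw [Set.indicator_of_notMem (fun h3 => h2 h3.2), Set.indicator_of_mem h1]
      simp [h2]
  · rw [Set.indicator_of_notMem (fun h3 => h1 h3.1), Set.indicator_of_notMem h1]

lemma measure_refused (h : IsLossSystem μ lam B p law τ χ ζ mark) (i : ℕ) :
    μ {ω | i ∈ refused (τ · ω) (χ · ω) (ζ · ω)} = refMean μ τ χ ζ 0 i := by
  rw [refMean, busyMean, ← lintegral_indicator_one (h.measurableSet_refused i),
    ← lintegral_indicator (h.measurableSet_inBusy' i)]
  refine lintegral_congr fun ω => ?_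
  by_cases h1 : ω ∈ inBusy τ χ ζ i
  · by_cases h2 : (state (τ · ω) (χ · ω) (ζ · ω) i).length ≤ ζ i ω
    · rw [Set.indicator_of_notMem (fun h3 => absurd h2 (not_le.2 h3.2)), Set.indicator_of_mem h1]
      simp [h2]
    · rw [Set.indicator_of_mem
        (show ω ∈ {ω | i ∈ refused (τ · ω) (χ · ω) (ζ · ω)} from ⟨h1, not_le.1 h2⟩),
        Set.indicator_of_mem h1]
      simp [h2]
  · rw [Set.indicator_of_notMem (fun h3 => h1 h3.1), Set.indicator_of_notMem h1]

lemma busyProb_nonneg (i : ℕ) : 0 ≤ busyProb μ τ χ ζ i := ENNReal.toReal_nonneg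

lemma badProb_le_mul (h : IsLossSystem μ lam B p law τ χ ζ mark) {lo hi : ℕ} {β : ℝ}
    (hβ : 0 ≤ β) (hbad : ∀ j, μ {ω | ¬ (lo ≤ ζ j ω ∧ ζ j ω ≤ hi)} ≤ ENNReal.ofReal β) (i : ℕ) :
    badProb μ τ χ ζ lo hi i ≤ (i + 1) * β := by
  have hm : ∀ j, MeasurableSet {ω | ¬ (lo ≤ ζ j ω ∧ ζ j ω ≤ hi)} := fun j =>
    (h.measurable_ζ j (measurableSet_Icc (a := lo) (b := hi))).compl
  have h1 : (busyMean μ τ χ ζ i fun z _ =>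
      if ∀ j ≤ i, lo ≤ z j ∧ z j ≤ hi then 0 else 1) ≤ ENNReal.ofReal ((i + 1) * β) := by
    calc (busyMean μ τ χ ζ i fun z _ => if ∀ j ≤ i, lo ≤ z j ∧ z j ≤ hi then 0 else 1)
        ≤ ∫⁻ ω, ∑ j ∈ Finset.range (i + 1),
            {ω | ¬ (lo ≤ ζ j ω ∧ ζ j ω ≤ hi)}.indicator 1 ω ∂μ := by
          refine (setLIntegral_le_lintegral _ _).trans (lintegral_mono fun ω => ?_)
          dsimp only
          split_ifs with h2
          · exact zero_le
          · push Not at h2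
            obtain ⟨j, hj, hj'⟩ := h2
            have h3 : (1 : ℝ≥0∞) = {ω | ¬ (lo ≤ ζ j ω ∧ ζ j ω ≤ hi)}.indicator 1 ω := by
              rw [Set.indicator_of_mem]
              · rfl
              · intro h4; exact absurd (hj' h4.1) (not_lt.2 h4.2)
            rw [h3]
            exact Finset.single_le_sum
              (f := fun j => {ω | ¬ (lo ≤ ζ j ω ∧ ζ j ω ≤ hi)}.indicator (1 : Ω → ℝ≥0∞) ω)
              (fun _ _ => zero_le) (Finset.mem_range.2 (by omega))
      _ = ∑ j ∈ Finset.range (i + 1), μ {ω | ¬ (lo ≤ ζ j ω ∧ ζ j ω ≤ hi)} := by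
          rw [lintegral_finsetSum _ fun j _ => measurable_one.indicator (hm j)]
          exact Finset.sum_congr rfl fun j _ => lintegral_indicator_one (hm j)
      _ ≤ ∑ j ∈ Finset.range (i + 1), ENNReal.ofReal β := Finset.sum_le_sum fun j _ => hbad j
      _ = ENNReal.ofReal ((i + 1) * β) := by
          rw [Finset.sum_const, Finset.card_range, nsmul_eq_mul,
            ENNReal.ofReal_mul (by positivity)]
          congr 1
          rw [← Nat.cast_succ, ENNReal.ofReal_natCast]
  exact (ENNReal.toReal_mono ENNReal.ofReal_ne_top h1).trans_eq
    (ENNReal.toReal_ofReal (by positivity))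

variable [IsProbabilityMeasure μ]

/-- Marks are independent of the event that the message is processed. -/
lemma measure_lost (h : IsLossSystem μ lam B p law τ χ ζ mark) (i : ℕ) :
    MeasurableSet {ω | i ∈ lost (τ · ω) (χ · ω) (ζ · ω) (mark · ω)} ∧
    μ {ω | i ∈ lost (τ · ω) (χ · ω) (ζ · ω) (mark · ω)} =
      refMean μ τ χ ζ 0 i + ENNReal.ofReal p * accMean μ τ χ ζ 0 i := by
  have hmk : MeasurableSet {ω | mark i ω = true} :=
    h.measurable_mark i (measurableSet_singleton true)
  have e : {ω | i ∈ lost (τ · ω) (χ · ω) (ζ · ω) (mark · ω)} =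
      {ω | i ∈ refused (τ · ω) (χ · ω) (ζ · ω)} ∪
        ({ω | i ∈ processed (τ · ω) (χ · ω) (ζ · ω)} ∩ {ω | mark i ω = true}) := by
    ext ω
    simp only [lost, refused, processed, Set.mem_ofPred_eq, Set.mem_union, Set.mem_inter_iff]
    have := lt_or_ge (ζ i ω) (found (τ · ω) (χ · ω) (ζ · ω) i)
    tauto
  have hd : Disjoint {ω | i ∈ refused (τ · ω) (χ · ω) (ζ · ω)}
      ({ω | i ∈ processed (τ · ω) (χ · ω) (ζ · ω)} ∩ {ω | mark i ω = true}) := by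
    rw [Set.disjoint_left]
    rintro ω h1 h2
    exact absurd h1.2 (not_lt.2 h2.1.2)
  have hm := (h.measurableSet_processed i).inter hmk
  refine ⟨e ▸ (h.measurableSet_refused i).union hm, ?_⟩
  rw [e, measure_union hd hm, h.measure_refused, ← h.measure_processed, ← h.law_mark i]
  congr 1
  obtain ⟨s, hs, hs'⟩ := measurableSet_past_processed (τ := τ) (χ := χ) (ζ := ζ) (mark := mark) i
  rw [← hs']
  have := (h.indepFun_past i).measure_inter_preimage_eq_mul s
    {x : ℝ × ℝ × Bool | x.2.2 = true} hs
    (measurableSet_eq_fun (by fun_prop) measurable_const)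
  rw [mul_comm]
  exact this

lemma accR_add_refR_le (h : IsLossSystem μ lam B p law τ χ ζ mark) (hB : B (Set.Iio 0) = 0)
    {s : ℝ} (hs : 0 ≤ s) (i : ℕ) :
    accR μ τ χ ζ s i + refR μ τ χ ζ s i ≤ busyProb μ τ χ ζ i := by
  rw [h.busyProb_eq hB]
  exact add_le_add (h.accR_le hB hs i) (h.refR_le hB hs i)

lemma summable_accR (h : IsLossSystem μ lam B p law τ χ ζ mark) (hB : B (Set.Iio 0) = 0)
    (hs : Summable (busyProb μ τ χ ζ)) {s : ℝ} (h0 : 0 ≤ s) : Summable (accR μ τ χ ζ s) :=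
  hs.of_nonneg_of_le (accR_nonneg s) fun i => by
    linarith [h.accR_add_refR_le hB h0 i,
      refR_nonneg (μ := μ) (τ := τ) (χ := χ) (ζ := ζ) s i]

lemma summable_refR (h : IsLossSystem μ lam B p law τ χ ζ mark) (hB : B (Set.Iio 0) = 0)
    (hs : Summable (busyProb μ τ χ ζ)) {s : ℝ} (h0 : 0 ≤ s) : Summable (refR μ τ χ ζ s) :=
  hs.of_nonneg_of_le (refR_nonneg s) fun i => by
    linarith [h.accR_add_refR_le hB h0 i,
      accR_nonneg (μ := μ) (τ := τ) (χ := χ) (ζ := ζ) s i]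

/-- The loss probability in terms of real series; summability of `busyProb` says that the expected
number of messages in the busy period is finite. -/
lemma lossProbability_eq (h : IsLossSystem μ lam B p law τ χ ζ mark) (hB : B (Set.Iio 0) = 0)
    (hp : 0 ≤ p) (hs : Summable (busyProb μ τ χ ζ)) :
    lossProbability μ τ χ ζ mark =
      (∑' i, refR μ τ χ ζ 0 i + p * ∑' i, accR μ τ χ ζ 0 i) /
        (∑' i, refR μ τ χ ζ 0 i + ∑' i, accR μ τ χ ζ 0 i) := by
  have fa := h.accMean_ne_top hB le_rfl
  have fr := h.refMean_ne_top hB le_rfl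
  have sa := h.summable_accR hB hs le_rfl
  have sr := h.summable_refR hB hs le_rfl
  have ta : ∑' i, accMean μ τ χ ζ 0 i ≠ ∞ := by
    simpa only [accR, ENNReal.ofReal_toReal (fa _)] using sa.tsum_ofReal_ne_top
  have tr : ∑' i, refMean μ τ χ ζ 0 i ≠ ∞ := by
    simpa only [refR, ENNReal.ofReal_toReal (fr _)] using sr.tsum_ofReal_ne_top
  rw [lossProbability, expectedCard_eq_tsum μ (fun i => (h.measure_lost i).1),
    expectedCard_eq_tsum μ h.measurableSet_refused,
    expectedCard_eq_tsum μ h.measurableSet_processed]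
  simp only [fun i => (h.measure_lost i).2, h.measure_refused, h.measure_processed]
  rw [ENNReal.tsum_add, ENNReal.tsum_mul_left, ENNReal.toReal_div, ENNReal.toReal_add tr ta,
    ENNReal.toReal_add tr (ENNReal.mul_ne_top ENNReal.ofReal_ne_top ta), ENNReal.toReal_mul,
    ENNReal.toReal_ofReal hp, ENNReal.tsum_toReal_eq fa, ENNReal.tsum_toReal_eq fr]
  rfl

/-- A bound for the expected remaining number of messages of the busy period after message `L`,
where `θ` is chosen such that `exp (-θ λ W)` has a strictly positive drift. -/
lemma sum_busyProb_le (h : IsLossSystem μ lam B p law τ χ ζ mark) (hB : B (Set.Iio 0) = 0)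
    (hlam : 0 < lam) (hint : Integrable (fun x => x ^ 3) B) {N : ℕ}
    (hN : ∀ᵐ ω ∂μ, ∀ i, ζ i ω ≤ N) {θ a δ k : ℝ} (hθ : 0 ≤ θ) (hθ1 : θ < 1) (ha : 0 < a)
    (hδ : 0 < δ) (hδ' : δ ≤ laplace lam B θ - 1 + θ) (hk : 0 < k)
    (hk' : k ≤ Real.exp (-(θ * (a + 1))) * laplace lam B θ ^ N)
    (hκ : 2 * (Real.exp 1 * (loadMoment lam B 3 / a ^ 2)) ≤ k) {L n : ℕ} (hLn : L ≤ n) :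
    ∑ i ∈ Finset.Ico L n, busyProb μ τ χ ζ i ≤
      2 / k * (busyProb μ τ χ ζ L / δ + Real.exp 1 * (lam * workMean μ τ χ ζ L)) := by
  have := h.isProbabilityMeasure_service
  have hs : 0 ≤ θ * lam := by positivity
  have hM : 0 ≤ a / lam := by positivity
  have h3 := loadMoment_nonneg hlam hB 3
  have hl1 := laplace_le_one hlam hB hθ
  have hA := accR_nonneg (μ := μ) (τ := τ) (χ := χ) (ζ := ζ)
  have hR := refR_nonneg (μ := μ) (τ := τ) (χ := χ) (ζ := ζ)
  have hle := h.accR_add_refR_le hB hs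
  have hv := busyProb_nonneg (μ := μ) (τ := τ) (χ := χ) (ζ := ζ)
  have key := sum_Ico_le_of_drift (v := busyProb μ τ χ ζ)
    (e := fun i => accR μ τ χ ζ (θ * lam) i + refR μ τ χ ζ (θ * lam) i)
    (b := headProb μ τ χ ζ ((a + 1) / lam))
    (f := fun i => Real.exp 1 * (lam * excessMean μ τ χ ζ (a / lam) i))
    (g := fun i => busyProb μ τ χ ζ i - (1 - θ) *
      (accR μ τ χ ζ (θ * lam) i + refR μ τ χ ζ (θ * lam) i))
    hδ hk hκ hv
    (fun i => by
      have : 0 ≤ excessMean μ τ χ ζ (a / lam) i := ENNReal.toReal_nonneg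
      positivity)
    (fun i => by
      have := hle i
      have := hA (θ * lam) i
      have := hR (θ * lam) i
      nlinarith)
    (fun i => by
      have := hA (θ * lam) i
      have := hR (θ * lam) i
      nlinarith)
    (fun i => by
      rw [← h.accR_add_refR_succ hB hlam hθ hθ1 i]
      have := hA (θ * lam) i
      have := hR (θ * lam) i
      nlinarith)
    (fun i => by
      refine (h.headProb_le hB hlam hint ha i).trans ?_
      have h4 : accR μ τ χ ζ 0 i ≤ busyProb μ τ χ ζ i := by
        rw [h.busyProb_eq hB]; linarith [hR 0 i]
      have h5 : 0 ≤ Real.exp 1 * (loadMoment lam B 3 / a ^ 2) := by positivity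
      have := mul_le_mul_of_nonneg_left h4 h5
      linarith)
    (fun i => (mul_le_mul_of_nonneg_right hk' (hv i)).trans
      (h.busyProb_le hB hlam hN hθ (by positivity) i)) hLn
  refine key.trans ?_
  have := h.excessMean_le_workMean hB hlam hint hM L
  gcongr

/-- The mean workload found by message `m ^ 4` during the busy period is `O (1 / m)`. -/
lemma workMean_pow_le (h : IsLossSystem μ lam B p law τ χ ζ mark) (hB : B (Set.Iio 0) = 0)
    (hlam : 0 < lam) (hint : Integrable (fun x => x ^ 3) B) {N : ℕ}
    (hN : ∀ᵐ ω ∂μ, ∀ i, ζ i ω ≤ N) (hs : Summable (busyProb μ τ χ ζ)) {m : ℕ} (hm : 0 < m) :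
    lam * workMean μ τ χ ζ (m ^ 4) ≤
      ((N + 1) * ∑' i, busyProb μ τ χ ζ i + loadMoment lam B 3) / m := by
  have h3 := loadMoment_nonneg hlam hB 3
  have hm' : (1 : ℝ) ≤ m := by exact_mod_cast hm
  have h1 := h.workMean_le hB hlam hint hN (a := (m : ℝ) ^ 3) (by positivity) (m ^ 4)
  have h2 := antitone_mul_le_tsum busyProb_nonneg antitone_busyProb hs (m ^ 4)
  push_cast at h1 h2
  refine h1.trans ?_
  rw [le_div_iff₀ (by linarith)]
  have e1 : ((m : ℝ) ^ 3 * (N + 1) * busyProb μ τ χ ζ (m ^ 4) +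
      (m : ℝ) ^ 4 * (loadMoment lam B 3 / ((m : ℝ) ^ 3) ^ 2)) * m =
      (N + 1) * ((m : ℝ) ^ 4 * busyProb μ τ χ ζ (m ^ 4)) + loadMoment lam B 3 / m := by
    field_simp
  rw [e1]
  have h4 : loadMoment lam B 3 / m ≤ loadMoment lam B 3 := div_le_self h3 hm'
  have h5 := mul_le_mul_of_nonneg_left h2 (a := (N : ℝ) + 1) (by positivity)
  linarith

/-- The expected number of refused messages: by Wald's identity for the workload. -/
lemma tsum_refR_eq (h : IsLossSystem μ lam B p law τ χ ζ mark) (hB : B (Set.Iio 0) = 0)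
    (hlam : 0 < lam) (hint : Integrable (fun x => x ^ 3) B) {N : ℕ}
    (hN : ∀ᵐ ω ∂μ, ∀ i, ζ i ω ≤ N) (hs : Summable (busyProb μ τ χ ζ)) :
    ∑' i, refR μ τ χ ζ 0 i = 1 + (loadMoment lam B 1 - 1) * ∑' i, accR μ τ χ ζ 0 i := by
  have sa := h.summable_accR hB hs le_rfl
  have sr := h.summable_refR hB hs le_rfl
  have hs1 : Summable fun i => busyProb μ τ χ ζ (i + 1) := (summable_nat_add_iff 1).2 hs
  have key := hasSum_of_telescope
    (u := fun i => busyProb μ τ χ ζ (i + 1) - loadMoment lam B 1 * accR μ τ χ ζ 0 i)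
    (g := fun i => lam * workMean μ τ χ ζ i)
    (fun i => by have := h.workMean_succ hB hlam hint i; linarith)
    (hs1.sub (sa.mul_left _)) (n := fun m => m ^ 4)
    (tendsto_pow_atTop (by norm_num)) (by
      refine squeeze_zero' (g := fun m : ℕ =>
        ((N + 1) * ∑' i, busyProb μ τ χ ζ i + loadMoment lam B 3) / (m : ℝ)) ?_ ?_ ?_
      · exact Eventually.of_forall fun m => mul_nonneg hlam.le ENNReal.toReal_nonneg
      · filter_upwards [eventually_gt_atTop 0] with m hm
        exact h.workMean_pow_le hB hlam hint hN hs hm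
      · exact tendsto_const_div_atTop_nhds_zero_nat _)
  have h1 := key.tsum_eq
  rw [hs1.tsum_sub (sa.mul_left _), tsum_mul_left, workMean_zero, mul_zero] at h1
  have h2 := hs.tsum_eq_zero_add
  have h3 : ∑' i, busyProb μ τ χ ζ i = ∑' i, accR μ τ χ ζ 0 i + ∑' i, refR μ τ χ ζ 0 i := by
    rw [← sa.tsum_add sr]
    exact tsum_congr fun i => h.busyProb_eq hB i
  rw [busyProb_zero] at h2
  linarith

lemma accR_zero_add_refR_zero (h : IsLossSystem μ lam B p law τ χ ζ mark)
    (hB : B (Set.Iio 0) = 0) {s : ℝ} (hs : 0 ≤ s) :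
    accR μ τ χ ζ s 0 + refR μ τ χ ζ s 0 = 1 := by
  rw [accR, refR, ← ENNReal.toReal_add (h.accMean_ne_top hB hs 0) (h.refMean_ne_top hB hs 0),
    ← h.busyMean_exp]
  simp [busyMean, inBusy_zero, state]

/-- The total balance of `exp (-θ λ W)` over the busy period. -/
lemma tsum_exp_balance (h : IsLossSystem μ lam B p law τ χ ζ mark) (hB : B (Set.Iio 0) = 0)
    (hlam : 0 < lam) (hs : Summable (busyProb μ τ χ ζ)) {θ : ℝ} (hθ : 0 ≤ θ) (hθ1 : θ < 1) :
    (laplace lam B θ - 1 + θ) * ∑' i, accR μ τ χ ζ (θ * lam) i +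
      θ * ∑' i, refR μ τ χ ζ (θ * lam) i = θ := by
  have h0 : 0 ≤ θ * lam := by positivity
  have sa := h.summable_accR hB hs h0
  have sr := h.summable_refR hB hs h0
  have key := hasSum_of_telescope
    (u := fun i => (laplace lam B θ - 1 + θ) * accR μ τ χ ζ (θ * lam) i +
      θ * refR μ τ χ ζ (θ * lam) i)
    (g := fun i => busyProb μ τ χ ζ i - (1 - θ) *
      (accR μ τ χ ζ (θ * lam) i + refR μ τ χ ζ (θ * lam) i))
    (fun i => h.accR_add_refR_succ hB hlam hθ hθ1 i)
    ((sa.mul_left _).add (sr.mul_left _)) (n := id) tendsto_id (by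
      have h1 := hs.tendsto_atTop_zero
      have h2 := (sa.tendsto_atTop_zero.add sr.tendsto_atTop_zero).const_mul (1 - θ)
      have h3 := h1.sub h2
      simpa using h3)
  have h1 := key.tsum_eq
  rw [(sa.mul_left _).tsum_add (sr.mul_left _), tsum_mul_left, tsum_mul_left,
    h.accR_zero_add_refR_zero hB h0, busyProb_zero] at h1
  linarith

/-- Few messages find a long residual service time at the head of the queue. -/
lemma summable_headProb (h : IsLossSystem μ lam B p law τ χ ζ mark) (hB : B (Set.Iio 0) = 0)
    (hlam : 0 < lam) (hint : Integrable (fun x => x ^ 3) B)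
    (hs : Summable (busyProb μ τ χ ζ)) {a : ℝ} (ha : 0 < a) :
    Summable (headProb μ τ χ ζ ((a + 1) / lam)) ∧
      ∑' i, headProb μ τ χ ζ ((a + 1) / lam) i ≤
        Real.exp 1 * (loadMoment lam B 3 / a ^ 2) * ∑' i, accR μ τ χ ζ 0 i := by
  have h3 := loadMoment_nonneg hlam hB 3
  have sa := h.summable_accR hB hs le_rfl
  have hb : ∀ i, 0 ≤ headProb μ τ χ ζ ((a + 1) / lam) i := fun i => ENNReal.toReal_nonneg
  have hn : ∀ n, ∑ i ∈ Finset.range n, headProb μ τ χ ζ ((a + 1) / lam) i ≤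
      Real.exp 1 * (loadMoment lam B 3 / a ^ 2) * ∑' i, accR μ τ χ ζ 0 i := by
    intro n
    refine (Finset.sum_le_sum fun i _ => h.headProb_le hB hlam hint ha i).trans ?_
    rw [Finset.sum_add_distrib, Finset.sum_range_sub', ← Finset.mul_sum, excessMean_zero]
    have h4 : 0 ≤ excessMean μ τ χ ζ (a / lam) n := ENNReal.toReal_nonneg
    have h5 := sa.sum_le_tsum (Finset.range n) fun i _ => accR_nonneg 0 i
    have h6 := mul_le_mul_of_nonneg_left h5
      (a := Real.exp 1 * (loadMoment lam B 3 / a ^ 2)) (by positivity)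
    have h7 : 0 ≤ Real.exp 1 * (lam * excessMean μ τ χ ζ (a / lam) n) := by positivity
    simp only [mul_zero, zero_sub]
    linarith
  exact ⟨summable_of_sum_range_le hb hn, Real.tsum_le_of_sum_range_le hb hn⟩

lemma badProb_le_busyProb (lo hi i : ℕ) : badProb μ τ χ ζ lo hi i ≤ busyProb μ τ χ ζ i := by
  refine ENNReal.toReal_mono (measure_ne_top _ _) ?_
  rw [← one_mul (μ _), ← busyMean_const]
  refine lintegral_mono fun ω => ?_
  dsimp only
  split_ifs <;> simp

/-- The expected number of messages of the busy period that arrive after a threshold outside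
`[lo, hi]`: before message `L` such thresholds are improbable, and few messages come after. -/
lemma tsum_badProb_le (h : IsLossSystem μ lam B p law τ χ ζ mark) {lo hi : ℕ} {β X : ℝ}
    (hβ : 0 ≤ β) (hbad : ∀ j, μ {ω | ¬ (lo ≤ ζ j ω ∧ ζ j ω ≤ hi)} ≤ ENNReal.ofReal β)
    (hs : Summable (busyProb μ τ χ ζ)) {L : ℕ}
    (hX : ∀ n, L ≤ n → ∑ i ∈ Finset.Ico L n, busyProb μ τ χ ζ i ≤ X) :
    Summable (badProb μ τ χ ζ lo hi) ∧ ∑' i, badProb μ τ χ ζ lo hi i ≤ L ^ 2 * β + X := by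
  have hb : ∀ i, 0 ≤ badProb μ τ χ ζ lo hi i := fun i => ENNReal.toReal_nonneg
  have hsb : Summable (badProb μ τ χ ζ lo hi) :=
    hs.of_nonneg_of_le hb fun i => badProb_le_busyProb lo hi i
  refine ⟨hsb, ?_⟩
  have h1 : ∀ n, L ≤ n → ∑ i ∈ Finset.range n, badProb μ τ χ ζ lo hi i ≤ L ^ 2 * β + X := by
    intro n hn
    rw [← Finset.sum_range_add_sum_Ico _ hn]
    refine add_le_add ?_ ((Finset.sum_le_sum fun i _ => badProb_le_busyProb lo hi i).trans
      (hX n hn))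
    calc ∑ i ∈ Finset.range L, badProb μ τ χ ζ lo hi i
        ≤ ∑ i ∈ Finset.range L, (L * β) := by
          refine Finset.sum_le_sum fun i hi' => (h.badProb_le_mul hβ hbad i).trans ?_
          have : (i : ℝ) + 1 ≤ L := by exact_mod_cast Finset.mem_range.1 hi'
          gcongr
      _ = L ^ 2 * β := by simp; ring
  exact le_of_tendsto hsb.hasSum.tendsto_sum_nat
    (eventually_atTop.2 ⟨L, fun n hn => h1 n hn⟩)

end IsLossSystem

/-! ### Concentration of the buffer size -/

lemma le_bufferSize_iff {ν : ℕ → ℕ} (hν : ∀ i, 1 ≤ ν i) {N n : ℕ} :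
    n ≤ bufferSize ν N ↔ ∑ i ∈ Finset.range n, ν i ≤ N := by
  have hb : ∀ m, ∑ i ∈ Finset.range m, ν i ≤ N → m ≤ N := fun m hm => by
    refine le_trans ?_ hm
    simpa using Finset.sum_le_sum fun i (_ : i ∈ Finset.range m) => hν i
  have hbdd : BddAbove {m : ℕ | ∑ i ∈ Finset.range m, ν i ≤ N} := ⟨N, fun m hm => hb m hm⟩
  constructor
  · intro h
    have hmem : bufferSize ν N ∈ {m : ℕ | ∑ i ∈ Finset.range m, ν i ≤ N} :=
      Nat.sSup_mem ⟨0, by simp⟩ hbdd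
    exact (Finset.sum_le_sum_of_subset (Finset.range_subset_range.2 h)).trans hmem
  · intro h
    exact le_csSup hbdd h

lemma bufferSize_le {ν : ℕ → ℕ} (hν : ∀ i, 1 ≤ ν i) (N : ℕ) : bufferSize ν N ≤ N := by
  have h := (le_bufferSize_iff hν (N := N)).1 le_rfl
  refine le_trans ?_ h
  simpa using Finset.sum_le_sum fun i (_ : i ∈ Finset.range (bufferSize ν N)) => hν i

lemma tendsto_pow_mul_exp_neg_sqrt (k : ℕ) {d : ℝ} (hd : 0 < d) :
    Tendsto (fun N : ℕ => (N : ℝ) ^ k * Real.exp (-(d * √N))) atTop (𝓝 0) := by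
  have h1 : Tendsto (fun N : ℕ => d * √(N : ℝ)) atTop atTop :=
    (Real.tendsto_sqrt_atTop.comp tendsto_natCast_atTop_atTop).const_mul_atTop hd
  have h2 := ((Real.tendsto_pow_mul_exp_neg_atTop_nhds_zero (2 * k)).comp h1).const_mul
    ((d ^ (2 * k))⁻¹)
  rw [mul_zero] at h2
  refine h2.congr fun N => ?_
  simp only [Function.comp]
  rw [mul_pow, pow_mul √(N : ℝ), Real.sq_sqrt (Nat.cast_nonneg N)]
  field_simp

namespace IsPacketSequence

variable {Ω : Type*} [MeasurableSpace Ω] {P : Measure Ω}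
  {ν : ℕ → Ω → ℕ} {lo up : ℕ}

lemma ae_one_le (hν : IsPacketSequence P ν lo up) : ∀ᵐ ω ∂P, ∀ i, 1 ≤ ν i ω := by
  rw [ae_all_iff]
  intro i
  filter_upwards [hν.bounds i] with ω hω
  exact hν.one_le.trans hω.1

lemma aemeasurable_bufferSize (hν : IsPacketSequence P ν lo up) (N : ℕ) :
    AEMeasurable (fun ω => bufferSize (ν · ω) N) P := by
  classical
  have hm : ∀ n, MeasurableSet {ω | ∑ i ∈ Finset.range n, ν i ω ≤ N} := fun n =>
    measurableSet_le (Finset.measurable_fun_sum _ fun i _ => hν.measurable i) measurable_const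
  refine ⟨fun ω => ∑ n ∈ Finset.range N,
    {ω | ∑ i ∈ Finset.range (n + 1), ν i ω ≤ N}.indicator 1 ω, ?_, ?_⟩
  · exact Finset.measurable_fun_sum _ fun n _ => measurable_one.indicator (hm _)
  · filter_upwards [hν.ae_one_le] with ω hω
    have h1 : ∀ n, {ω | ∑ i ∈ Finset.range (n + 1), ν i ω ≤ N}.indicator (1 : Ω → ℕ) ω =
        if n < bufferSize (ν · ω) N then 1 else 0 := by
      intro n
      simp only [Set.indicator, Set.mem_ofPred_eq, Pi.one_apply, ← Nat.succ_le_iff,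
        le_bufferSize_iff hω, Nat.succ_eq_add_one]
    simp only [h1]
    rw [Finset.sum_ite, Finset.sum_const_zero, add_zero, Finset.sum_const, smul_eq_mul, mul_one]
    have h2 : (Finset.range N).filter (fun n => n < bufferSize (ν · ω) N) =
        Finset.range (bufferSize (ν · ω) N) := by
      ext n
      have := bufferSize_le hω N
      simp only [Finset.mem_filter, Finset.mem_range]
      omega
    rw [h2, Finset.card_range]

variable [IsProbabilityMeasure P]

lemma one_le_integral (hν : IsPacketSequence P ν lo up) : 1 ≤ ∫ ω, (ν 0 ω : ℝ) ∂P := by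
  have hi : Integrable (fun ω => (ν 0 ω : ℝ)) P := by
    refine Integrable.of_mem_Icc 0 (up : ℝ) (by have := hν.measurable 0; fun_prop) ?_
    filter_upwards [hν.bounds 0] with ω hω
    exact ⟨by positivity, by exact_mod_cast hω.2⟩
  have : ∫ _, (1 : ℝ) ∂P = 1 := by simp
  rw [← this]
  refine integral_mono_ae (integrable_const _) hi ?_
  filter_upwards [hν.bounds 0] with ω hω
  exact_mod_cast hν.one_le.trans hω.1

/-- Hoeffding's inequality for the total number of packets, on both sides. -/
lemma measure_sum_le (hν : IsPacketSequence P ν lo up) (n : ℕ) {t : ℝ} (ht : 0 ≤ t) :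
    P.real {ω | t ≤ ∑ i ∈ Finset.range n, (ν i ω : ℝ) - n * ∫ ω, (ν 0 ω : ℝ) ∂P} ≤
        Real.exp (-t ^ 2 / (2 * n * (up / 2 : ℝ) ^ 2)) ∧
    P.real {ω | t ≤ n * (∫ ω, (ν 0 ω : ℝ) ∂P) - ∑ i ∈ Finset.range n, (ν i ω : ℝ)} ≤
        Real.exp (-t ^ 2 / (2 * n * (up / 2 : ℝ) ^ 2)) := by
  set m := ∫ ω, (ν 0 ω : ℝ) ∂P with hm
  have hsub : ∀ i, HasSubgaussianMGF (fun ω => (ν i ω : ℝ) - m) ((‖(up : ℝ) - 0‖₊ / 2) ^ 2) P := by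
    intro i
    have h1 : ∫ ω, (ν i ω : ℝ) ∂P = m :=
      ((hν.identDistrib i).comp (u := fun n : ℕ => (n : ℝ)) measurable_from_nat).integral_eq
    rw [← h1]
    refine hasSubgaussianMGF_of_mem_Icc (a := 0) (b := (up : ℝ))
      (by have := hν.measurable i; fun_prop) ?_
    filter_upwards [hν.bounds i] with ω hω
    exact ⟨by positivity, by exact_mod_cast hω.2⟩
  have hind : iIndepFun (fun i ω => (ν i ω : ℝ) - m) P :=
    hν.indep.comp (fun _ n => (n : ℝ) - m) fun _ => measurable_from_nat
  have hind' : iIndepFun (fun i => -(fun ω => (ν i ω : ℝ) - m)) P :=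
    hν.indep.comp (fun _ n => -((n : ℝ) - m)) fun _ => measurable_from_nat
  have k1 := HasSubgaussianMGF.measure_sum_range_ge_le_of_iIndepFun hind (n := n)
    (fun i _ => hsub i) ht
  have k2 := HasSubgaussianMGF.measure_sum_range_ge_le_of_iIndepFun hind' (n := n)
    (fun i _ => (hsub i).neg) ht
  have hc : (((‖(up : ℝ) - 0‖₊ / 2) ^ 2 : NNReal) : ℝ) = (up / 2 : ℝ) ^ 2 := by
    push_cast
    rw [sub_zero, Real.norm_of_nonneg (by positivity)]
  rw [hc] at k1 k2
  constructor
  · convert k1 using 3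
    ext ω
    simp
  · convert k2 using 3
    ext ω
    simp

/-- The buffer size is confined to a deterministic interval around `N / E ν`, of relative width
tending to zero, up to an event whose probability is smaller than any power of `N`. -/
lemma exists_thresholds (hν : IsPacketSequence P ν lo up) :
    ∃ (m : ℝ) (a b : ℕ → ℕ) (β : ℕ → ℝ), 0 < m ∧
      Tendsto (fun N => (a N : ℝ) / N) atTop (𝓝 (1 / m)) ∧
      Tendsto (fun N => (b N : ℝ) / N) atTop (𝓝 (1 / m)) ∧
      (∀ N, 0 ≤ β N) ∧ (∀ k : ℕ, Tendsto (fun N : ℕ => (N : ℝ) ^ k * β N) atTop (𝓝 0)) ∧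
      ∀ᶠ N in atTop, P {ω | ¬ (a N ≤ bufferSize (ν · ω) N ∧ bufferSize (ν · ω) N ≤ b N)} ≤
        ENNReal.ofReal (β N) := by
  set m := ∫ ω, (ν 0 ω : ℝ) ∂P with hm
  have hm1 : 1 ≤ m := hν.one_le_integral
  have hm0 : 0 < m := by linarith
  have hup : 0 < (up : ℝ) := by
    obtain ⟨ω, hω⟩ := (hν.bounds 0).exists
    have h1 := hν.one_le
    have : 0 < up := by omega
    exact_mod_cast this
  -- the half-width of the interval is `N ^ (3/4)`
  let r : ℕ → ℝ := fun N => √N * √√N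
  have hr0 : ∀ N, 0 ≤ r N := fun N => by positivity
  have hr2 : ∀ N, r N ^ 2 = N * √N := fun N => by
    simp only [r]
    rw [mul_pow, Real.sq_sqrt (by positivity), Real.sq_sqrt (by positivity)]
  have hrN : Tendsto (fun N : ℕ => r N / N) atTop (𝓝 0) := by
    have h1 : Tendsto (fun N : ℕ => (√√(N : ℝ))⁻¹) atTop (𝓝 0) :=
      (Real.tendsto_sqrt_atTop.comp
        (Real.tendsto_sqrt_atTop.comp tendsto_natCast_atTop_atTop)).inv_tendsto_atTop
    refine h1.congr' ?_
    filter_upwards [eventually_gt_atTop 0] with N hN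
    have hN' : (0 : ℝ) < N := by exact_mod_cast hN
    have e1 : √(N : ℝ) * √N = N := Real.mul_self_sqrt hN'.le
    have e2 : √√(N : ℝ) * √√N = √N := Real.mul_self_sqrt (by positivity)
    have h3 : 0 < √√(N : ℝ) := by positivity
    have h4 : 0 < √(N : ℝ) := by positivity
    simp only [r]
    rw [eq_div_iff hN'.ne', inv_mul_eq_iff_eq_mul₀ h3.ne']
    nlinarith
  have h1N : Tendsto (fun N : ℕ => (1 : ℝ) / N) atTop (𝓝 0) := tendsto_one_div_atTop_nhds_zero_nat
  have hrle : ∀ᶠ N : ℕ in atTop, r N ≤ N := by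
    filter_upwards [hrN.eventually (ge_mem_nhds (show (0 : ℝ) < 1 by norm_num)),
      eventually_gt_atTop 0] with N hN hN0
    rwa [div_le_one (by exact_mod_cast hN0)] at hN
  let c : ℝ := 2 * 3 * (up / 2) ^ 2
  have hc : 0 < c := by positivity
  refine ⟨m, fun N => ⌊N / m - r N⌋₊, fun N => ⌈N / m + r N⌉₊,
    fun N => 2 * Real.exp (-(1 / c * √N)), hm0, ?_, ?_, fun N => by positivity, fun k => ?_, ?_⟩
  · have lim : ∀ u : ℝ, Tendsto (fun N : ℕ => 1 / m - r N / N + u * (1 / N)) atTop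
        (𝓝 (1 / m)) := fun u => by
      simpa using (tendsto_const_nhds.sub hrN).add (h1N.const_mul u)
    have hpos : ∀ᶠ N : ℕ in atTop, 0 ≤ N / m - r N := by
      have : Tendsto (fun N : ℕ => 1 / m - r N / N) atTop (𝓝 (1 / m)) := by
        simpa using lim 0
      filter_upwards [this.eventually (le_mem_nhds (show (0 : ℝ) < 1 / m by positivity)),
        eventually_gt_atTop 0] with N hN hN0
      have hN0' : (0 : ℝ) < N := by exact_mod_cast hN0
      have := mul_nonneg hN hN0'.le
      have e : (1 / m - r N / N) * N = N / m - r N := by field_simp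
      linarith
    refine tendsto_of_tendsto_of_tendsto_of_le_of_le' (lim (-1)) (lim 0) ?_ ?_
    · filter_upwards [eventually_gt_atTop 0] with N hN0
      have hN0' : (0 : ℝ) < N := by exact_mod_cast hN0
      rw [le_div_iff₀ hN0']
      have e : (1 / m - r N / N + -1 * (1 / N)) * N = N / m - r N - 1 := by field_simp; ring
      rw [e]
      exact (Nat.sub_one_lt_floor _).le
    · filter_upwards [eventually_gt_atTop 0, hpos] with N hN0 hp
      have hN0' : (0 : ℝ) < N := by exact_mod_cast hN0
      rw [div_le_iff₀ hN0']
      have e : (1 / m - r N / N + 0 * (1 / N)) * N = N / m - r N := by field_simp; ring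
      rw [e]
      exact Nat.floor_le hp
  · have lim : ∀ u : ℝ, Tendsto (fun N : ℕ => 1 / m + r N / N + u * (1 / N)) atTop
        (𝓝 (1 / m)) := fun u => by
      simpa using (tendsto_const_nhds.add hrN).add (h1N.const_mul u)
    refine tendsto_of_tendsto_of_tendsto_of_le_of_le' (lim 0) (lim 1) ?_ ?_
    · filter_upwards [eventually_gt_atTop 0] with N hN0
      have hN0' : (0 : ℝ) < N := by exact_mod_cast hN0
      rw [le_div_iff₀ hN0']
      have e : (1 / m + r N / N + 0 * (1 / N)) * N = N / m + r N := by field_simp; ring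
      rw [e]
      exact Nat.le_ceil _
    · filter_upwards [eventually_gt_atTop 0] with N hN0
      have hN0' : (0 : ℝ) < N := by exact_mod_cast hN0
      rw [div_le_iff₀ hN0']
      have e : (1 / m + r N / N + 1 * (1 / N)) * N = N / m + r N + 1 := by field_simp
      rw [e]
      exact (Nat.ceil_lt_add_one (by have := hr0 N; positivity)).le
  · have := (tendsto_pow_mul_exp_neg_sqrt k (d := 1 / c) (by positivity)).const_mul 2
    rw [mul_zero] at this
    exact this.congr fun N => by ring
  · filter_upwards [eventually_gt_atTop 0, hrle] with N hN0 hrl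
    have hN0' : (1 : ℝ) ≤ N := by exact_mod_cast hN0
    set a := ⌊N / m - r N⌋₊
    set b := ⌈N / m + r N⌉₊
    have hrm : r N ≤ r N * m := le_mul_of_one_le_right (hr0 N) hm1
    have expo : ∀ n : ℕ, 0 < n → (n : ℝ) ≤ 3 * N →
        Real.exp (-r N ^ 2 / (2 * n * (up / 2 : ℝ) ^ 2)) ≤ Real.exp (-(1 / c * √N)) := by
      intro n hn hn3
      have hn' : (0 : ℝ) < n := by exact_mod_cast hn
      refine Real.exp_le_exp.2 ?_
      rw [neg_div, neg_le_neg_iff, le_div_iff₀ (by positivity), hr2]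
      have e : 1 / c * √N * (2 * n * (up / 2 : ℝ) ^ 2) = n / 3 * √N := by
        simp only [c]; field_simp
      rw [e]
      have : (n : ℝ) / 3 ≤ N := by linarith
      gcongr
    have hsub : {ω | ¬ (a ≤ bufferSize (ν · ω) N ∧ bufferSize (ν · ω) N ≤ b)} ≤ᵐ[P]
        (({ω | ¬ (a ≤ bufferSize (ν · ω) N)} ∪
          {ω | r N ≤ b * m - ∑ i ∈ Finset.range b, (ν i ω : ℝ)} : Set Ω)) := by
      filter_upwards [hν.ae_one_le] with ω hω
      intro h
      rcases not_and_or.1 h with h1 | h1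
      · exact Or.inl h1
      · refine Or.inr ?_
        have h2 := (le_bufferSize_iff hω).1 (not_le.1 h1).le
        have h3 : ∑ i ∈ Finset.range b, (ν i ω : ℝ) ≤ N := by exact_mod_cast h2
        have h4 : N / m + r N ≤ b := Nat.le_ceil _
        have h5 := mul_le_mul_of_nonneg_right h4 hm0.le
        have e : (N / m + r N) * m = N + r N * m := by field_simp
        change r N ≤ b * m - ∑ i ∈ Finset.range b, (ν i ω : ℝ)
        linarith
    have hA : P {ω | ¬ (a ≤ bufferSize (ν · ω) N)} ≤
        ENNReal.ofReal (Real.exp (-(1 / c * √N))) := by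
      rcases Nat.eq_zero_or_pos a with h0 | h0
      · simp [h0]
      · have ha : (a : ℝ) ≤ N / m - r N := Nat.floor_le (by
          by_contra h1
          have := Nat.floor_of_nonpos (not_le.1 h1).le
          omega)
        have hsub2 : {ω | ¬ (a ≤ bufferSize (ν · ω) N)} ≤ᵐ[P]
            ({ω | r N ≤ ∑ i ∈ Finset.range a, (ν i ω : ℝ) - a * m} : Set Ω) := by
          filter_upwards [hν.ae_one_le] with ω hω
          intro h
          have h1 : ¬ a ≤ bufferSize (ν · ω) N := h
          rw [le_bufferSize_iff hω, not_le] at h1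
          have h3 : (N : ℝ) ≤ ∑ i ∈ Finset.range a, (ν i ω : ℝ) := by exact_mod_cast h1.le
          have h5 := mul_le_mul_of_nonneg_right ha hm0.le
          have e : (N / m - r N) * m = N - r N * m := by field_simp
          change r N ≤ ∑ i ∈ Finset.range a, (ν i ω : ℝ) - a * m
          linarith
        refine (measure_mono_ae hsub2).trans ?_
        rw [← ofReal_measureReal]
        refine ENNReal.ofReal_le_ofReal ((hν.measure_sum_le a (hr0 N)).1.trans
          (expo a h0 ?_))
        have : (N : ℝ) / m ≤ N := div_le_self (by positivity) hm1
        have := hr0 N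
        linarith
    have hBb : P {ω | r N ≤ b * m - ∑ i ∈ Finset.range b, (ν i ω : ℝ)} ≤
        ENNReal.ofReal (Real.exp (-(1 / c * √N))) := by
      rw [← ofReal_measureReal]
      refine ENNReal.ofReal_le_ofReal ((hν.measure_sum_le b (hr0 N)).2.trans (expo b ?_ ?_))
      · refine Nat.ceil_pos.2 ?_
        have := hr0 N
        positivity
      · have h1 : (b : ℝ) ≤ N / m + r N + 1 :=
          (Nat.ceil_lt_add_one (by have := hr0 N; positivity)).le
        have : (N : ℝ) / m ≤ N := div_le_self (by positivity) hm1
        linarith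
    refine (measure_mono_ae hsub).trans ((measure_union_le _ _).trans ?_)
    refine (add_le_add hA hBb).trans_eq ?_
    rw [← ENNReal.ofReal_add (by positivity) (by positivity)]
    congr 1; ring

/-- If `ε ζ(N)` converges to `C` almost surely, then `ε N` converges to `C E ν`. -/
lemma tendsto_mul_nat {m : ℝ} {a b : ℕ → ℕ} {β : ℕ → ℝ}
    (hm : 0 < m) (ha : Tendsto (fun N => (a N : ℝ) / N) atTop (𝓝 (1 / m)))
    (hb : Tendsto (fun N => (b N : ℝ) / N) atTop (𝓝 (1 / m))) (hβ0 : ∀ N, 0 ≤ β N)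
    (hβ : ∀ k : ℕ, Tendsto (fun N : ℕ => (N : ℝ) ^ k * β N) atTop (𝓝 0))
    (hbad : ∀ᶠ N in atTop,
      P {ω | ¬ (a N ≤ bufferSize (ν · ω) N ∧ bufferSize (ν · ω) N ≤ b N)} ≤ ENNReal.ofReal (β N))
    {ε : ℕ → ℝ} {C : ℝ} (hζ : ∀ᵐ ω ∂P,
      Tendsto (fun N => ε N * (bufferSize (ν · ω) N : ℝ)) atTop (𝓝 C)) :
    Tendsto (fun N : ℕ => ε N * N) atTop (𝓝 (C * m)) := by
  obtain ⟨N₀, hN₀⟩ := eventually_atTop.1 hbad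
  have hsum : Summable β := by
    refine summable_of_isBigO_nat (g := fun N : ℕ => 1 / (N : ℝ) ^ 2)
      (Real.summable_one_div_nat_pow.2 (by norm_num)) ?_
    refine IsBigO.of_bound 1 ?_
    filter_upwards [(hβ 2).eventually (ge_mem_nhds (show (0 : ℝ) < 1 by norm_num)),
      eventually_gt_atTop 0] with N hN hN0
    have hN0' : (0 : ℝ) < N := by exact_mod_cast hN0
    rw [Real.norm_of_nonneg (hβ0 N), Real.norm_of_nonneg (by positivity), one_mul,
      le_div_iff₀ (by positivity)]
    linarith
  have hbc := ae_eventually_notMem (μ := P)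
    (s := fun N => {ω | ¬ (a (N + N₀) ≤ bufferSize (ν · ω) (N + N₀) ∧
      bufferSize (ν · ω) (N + N₀) ≤ b (N + N₀))})
    (ne_top_of_le_ne_top ((summable_nat_add_iff N₀).2 hsum).tsum_ofReal_ne_top
      (ENNReal.tsum_le_tsum fun N => hN₀ _ (by omega)))
  obtain ⟨ω, h1, h2⟩ := (hbc.and hζ).exists
  have h3 : ∀ᶠ N in atTop, a N ≤ bufferSize (ν · ω) N ∧ bufferSize (ν · ω) N ≤ b N := by
    obtain ⟨N₁, hN₁⟩ := eventually_atTop.1 h1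
    refine eventually_atTop.2 ⟨N₁ + N₀, fun N hN => ?_⟩
    have := hN₁ (N - N₀) (by omega)
    rw [Nat.sub_add_cancel (by omega)] at this
    exact not_not.1 this
  have h4 : Tendsto (fun N : ℕ => (bufferSize (ν · ω) N : ℝ) / N) atTop (𝓝 (1 / m)) := by
    refine tendsto_of_tendsto_of_tendsto_of_le_of_le' ha hb ?_ ?_
    · filter_upwards [h3] with N hN
      have := hN.1
      gcongr
    · filter_upwards [h3] with N hN
      have := hN.2
      gcongr
  have h5 := h2.div h4 (by positivity)
  have e : C / (1 / m) = C * m := by field_simp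
  rw [e] at h5
  refine h5.congr' ?_
  filter_upwards [h4.eventually (lt_mem_nhds (show 0 < 1 / m by positivity)),
    eventually_gt_atTop 0] with N hN hN0
  have hN0' : (0 : ℝ) < N := by exact_mod_cast hN0
  have h6 : (bufferSize (ν · ω) N : ℝ) ≠ 0 := by
    intro h7
    simp [h7] at hN
  simp only [Pi.div_apply]
  field_simp

end IsPacketSequence

/-! ### The heavy traffic limit -/

lemma IsLossSystem.measure_ζ_preimage {Ω Ω₀ : Type*} [MeasurableSpace Ω] [MeasurableSpace Ω₀]
    {μ : Measure Ω} {P : Measure Ω₀} {b : Ω₀ → ℕ} (hb : AEMeasurable b P)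
    {lam : ℝ} {B : Measure ℝ} {p : ℝ} {τ χ : ℕ → Ω → ℝ} {ζ : ℕ → Ω → ℕ} {mark : ℕ → Ω → Bool}
    (h : IsLossSystem μ lam B p (fun j => P {ω | b ω = j}) τ χ ζ mark) (i : ℕ) (s : Set ℕ) :
    μ (ζ i ⁻¹' s) = P (b ⁻¹' s) := by
  have hs : MeasurableSet s := MeasurableSet.of_discrete
  have e : μ.map (ζ i) = P.map b := by
    rw [Measure.ext_iff_singleton]
    intro j
    rw [Measure.map_apply (h.measurable_ζ i) (measurableSet_singleton j),
      Measure.map_apply_of_aemeasurable hb (measurableSet_singleton j)]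
    exact h.law_ζ i j
  rw [← Measure.map_apply (h.measurable_ζ i) hs, e, Measure.map_apply_of_aemeasurable hb hs]

/-- If `x ε⁻¹ → c` and `n ε → C` then `(1 - x) ^ n → exp (-c C)`. -/
lemma tendsto_one_sub_pow {x ε : ℕ → ℝ} {n : ℕ → ℕ} {c C : ℝ} (hε : ∀ N, 0 < ε N)
    (hε0 : Tendsto ε atTop (𝓝 0))
    (hx : Tendsto (fun N => x N / ε N) atTop (𝓝 c))
    (hn : Tendsto (fun N => ε N * n N) atTop (𝓝 C)) :
    Tendsto (fun N => (1 - x N) ^ n N) atTop (𝓝 (Real.exp (-(c * C)))) := by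
  have hx' : Tendsto x atTop (𝓝 0) := by
    have := hx.mul hε0
    rw [mul_zero] at this
    exact this.congr fun N => by have := (hε N).ne'; field_simp
  have hnx : Tendsto (fun N => n N * x N) atTop (𝓝 (c * C)) :=
    (hx.mul hn).congr fun N => by have := (hε N).ne'; field_simp
  have h1 : Tendsto (fun N => Real.exp (-(n N * x N))) atTop (𝓝 (Real.exp (-(c * C)))) :=
    (Real.continuous_exp.tendsto _).comp hnx.neg
  have h2 : Tendsto (fun N => Real.exp (-(n N * x N / (1 - x N)))) atTop
      (𝓝 (Real.exp (-(c * C)))) := by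
    have h3 := hnx.div (hx'.const_sub 1) (by norm_num)
    rw [sub_zero, div_one] at h3
    exact (Real.continuous_exp.tendsto _).comp h3.neg
  refine tendsto_of_tendsto_of_tendsto_of_le_of_le' h2 h1 ?_ ?_
  · filter_upwards [hx'.eventually (gt_mem_nhds (show (0 : ℝ) < 1 by norm_num))] with N hN
    have hpos : 0 < 1 - x N := by linarith
    have h4 : Real.exp (-(x N / (1 - x N))) ≤ 1 - x N := by
      rw [Real.exp_neg, inv_le_comm₀ (Real.exp_pos _) hpos]
      have := Real.add_one_le_exp (x N / (1 - x N))
      refine le_trans (le_of_eq ?_) this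
      field_simp
      ring
    calc Real.exp (-(n N * x N / (1 - x N))) = Real.exp (-(x N / (1 - x N))) ^ n N := by
          rw [← Real.exp_nat_mul]; congr 1; ring
      _ ≤ (1 - x N) ^ n N := pow_le_pow_left₀ (Real.exp_nonneg _) h4 _
  · filter_upwards [hx'.eventually (gt_mem_nhds (show (0 : ℝ) < 1 by norm_num))] with N hN
    have hpos : 0 < 1 - x N := by linarith
    have h4 : 1 - x N ≤ Real.exp (-(x N)) := by
      have := Real.add_one_le_exp (-(x N)); linarith
    calc (1 - x N) ^ n N ≤ Real.exp (-(x N)) ^ n N := pow_le_pow_left₀ hpos.le h4 _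
      _ = Real.exp (-(n N * x N)) := by rw [← Real.exp_nat_mul]; congr 1; ring

/-- The limit of `R` read off from approximate linear relations. -/
lemma tendsto_of_balance {R S η q q' bad h : ℕ → ℝ} {Q : ℝ} (hQ : 0 < Q)
    (hq : Tendsto q atTop (𝓝 Q)) (hq' : Tendsto q' atTop (𝓝 Q)) (hη : Tendsto η atTop (𝓝 0))
    (hbad : Tendsto bad atTop (𝓝 0)) (hh : Tendsto h atTop (𝓝 0))
    (h1 : ∀ᶠ N in atTop, |1 - S N| ≤ η N * R N) (h2 : ∀ᶠ N in atTop, S N ≤ q N * R N + bad N)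
    (h3 : ∀ᶠ N in atTop, q' N * R N ≤ S N + h N * R N + bad N) :
    Tendsto R atTop (𝓝 (1 / Q)) := by
  have l1 : Tendsto (fun N => (1 - bad N) / (q N + η N)) atTop (𝓝 (1 / Q)) := by
    have : Tendsto (fun N => (1 - bad N) / (q N + η N)) atTop (𝓝 ((1 - 0) / (Q + 0))) :=
      (hbad.const_sub 1).div (hq.add hη) (by simpa using hQ.ne')
    rwa [sub_zero, add_zero] at this
  have l2' : Tendsto (fun N => q' N - η N - h N) atTop (𝓝 Q) := by
    simpa using (hq'.sub hη).sub hh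
  have l2 : Tendsto (fun N => (1 + bad N) / (q' N - η N - h N)) atTop (𝓝 (1 / Q)) := by
    have : Tendsto (fun N => (1 + bad N) / (q' N - η N - h N)) atTop (𝓝 ((1 + 0) / Q)) :=
      (hbad.const_add 1).div l2' hQ.ne'
    rwa [add_zero] at this
  have l3 : Tendsto (fun N => q N + η N) atTop (𝓝 Q) := by simpa using hq.add hη
  refine tendsto_of_tendsto_of_tendsto_of_le_of_le' l1 l2 ?_ ?_
  · filter_upwards [h1, h2, l3.eventually (lt_mem_nhds hQ)] with N e1 e2 e3
    rw [div_le_iff₀ e3]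
    have := (abs_le.1 e1).2
    linarith
  · filter_upwards [h1, h3, l2'.eventually (lt_mem_nhds hQ)] with N e1 e2 e3
    rw [le_div_iff₀ e3]
    have := (abs_le.1 e1).1
    linarith

section regime

variable {lam : ℕ → ℝ} {B : ℕ → Measure ℝ} {ε : ℕ → ℝ} {M : ℝ}

/-- With `θ = 4 ε` the drift of `exp (-θ λ W)` is at least `ε ^ 2`: to second order it is
`-4 ε ^ 2 + 8 ε ^ 2 ϱ₂`, and `ϱ₂ ≥ 1`. -/
lemma sq_le_laplace_sub [∀ N, IsProbabilityMeasure (B N)]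
    (hlam : ∀ N, 0 < lam N) (hB : ∀ N, B N (Set.Iio 0) = 0)
    (hint : ∀ N, Integrable (fun x => x ^ 3) (B N)) (hε : ∀ N, 0 < ε N)
    (hε0 : Tendsto ε atTop (𝓝 0)) (hload : ∀ N, loadMoment (lam N) (B N) 1 = 1 + ε N)
    (hM : ∀ N, loadMoment (lam N) (B N) 3 ≤ M) :
    ∀ᶠ N in atTop, ε N ^ 2 ≤ laplace (lam N) (B N) (4 * ε N) - 1 + 4 * ε N := by
  have h1 : Tendsto (fun N => 11 * M * ε N) atTop (𝓝 0) := by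
    simpa using hε0.const_mul (11 * M)
  filter_upwards [h1.eventually (gt_mem_nhds (show (0 : ℝ) < 3 by norm_num))] with N hN
  have e := hε N
  have h2 := le_laplace (hlam N) (hB N) (hint N) (θ := 4 * ε N) (by positivity)
  have h3 := two_mul_loadMoment_one_sub_one_le (lam := lam N) (hB N) (hint N)
  have h4 := loadMoment_nonneg (hlam N) (hB N) 3
  rw [hload] at h2 h3
  have h5 : (4 * ε N) ^ 3 / 6 * loadMoment (lam N) (B N) 3 ≤ 11 * ε N ^ 3 * M := by
    have : (4 * ε N) ^ 3 / 6 * loadMoment (lam N) (B N) 3 ≤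
        11 * ε N ^ 3 * loadMoment (lam N) (B N) 3 := by
      refine mul_le_mul_of_nonneg_right ?_ h4
      have : 0 < ε N ^ 3 := by positivity
      nlinarith
    refine this.trans (mul_le_mul_of_nonneg_left (hM N) (by positivity))
  have h6 : (4 * ε N) ^ 2 / 2 * 1 ≤ (4 * ε N) ^ 2 / 2 * loadMoment (lam N) (B N) 2 :=
    mul_le_mul_of_nonneg_left (by linarith) (by positivity)
  have h7 : 11 * ε N ^ 3 * M ≤ 3 * ε N ^ 2 := by
    have : 11 * M * ε N * ε N ^ 2 ≤ 3 * ε N ^ 2 := by gcongr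
    linarith
  nlinarith

/-- With `θ = 2 ε / ρ₂` the drift of `exp (-θ λ W)` is `o (ε ^ 2)`: the second order terms cancel in
the limit, and the third moments are bounded. -/
lemma tendsto_laplace_sub [∀ N, IsProbabilityMeasure (B N)]
    (hlam : ∀ N, 0 < lam N) (hB : ∀ N, B N (Set.Iio 0) = 0)
    (hint : ∀ N, Integrable (fun x => x ^ 3) (B N)) (hε : ∀ N, 0 < ε N)
    (hε0 : Tendsto ε atTop (𝓝 0)) (hload : ∀ N, loadMoment (lam N) (B N) 1 = 1 + ε N)
    (hM : ∀ N, loadMoment (lam N) (B N) 3 ≤ M) {ρ₂ : ℝ} (hρ : 0 < ρ₂)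
    (hρ₂ : Tendsto (fun N => loadMoment (lam N) (B N) 2) atTop (𝓝 ρ₂)) :
    Tendsto (fun N => (laplace (lam N) (B N) (2 * ε N / ρ₂) - 1 + 2 * ε N / ρ₂) / ε N ^ 2) atTop
      (𝓝 0) := by
  have l1 : Tendsto (fun N => -(2 / ρ₂) + 2 / ρ₂ ^ 2 * loadMoment (lam N) (B N) 2) atTop
      (𝓝 0) := by
    have := (hρ₂.const_mul (2 / ρ₂ ^ 2)).const_add (-(2 / ρ₂))
    have e : -(2 / ρ₂) + 2 / ρ₂ ^ 2 * ρ₂ = 0 := by field_simp; ring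
    rwa [e] at this
  have l2 : Tendsto (fun N => -(2 / ρ₂) + 2 / ρ₂ ^ 2 * loadMoment (lam N) (B N) 2 -
      (2 / ρ₂) ^ 3 / 6 * M * ε N) atTop (𝓝 0) := by
    have := l1.sub (hε0.const_mul ((2 / ρ₂) ^ 3 / 6 * M))
    simpa using this
  refine tendsto_of_tendsto_of_tendsto_of_le_of_le l2 l1 (fun N => ?_) (fun N => ?_)
  · have e := hε N
    have h2 := le_laplace (hlam N) (hB N) (hint N) (θ := 2 * ε N / ρ₂) (by positivity)
    have h5 : (2 * ε N / ρ₂) ^ 3 / 6 * loadMoment (lam N) (B N) 3 ≤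
        (2 * ε N / ρ₂) ^ 3 / 6 * M := mul_le_mul_of_nonneg_left (hM N) (by positivity)
    simp only
    rw [le_div_iff₀ (by positivity)]
    rw [hload] at h2
    refine le_trans (le_of_eq ?_) (sub_le_sub_right (h2.trans' (sub_le_sub_left h5 _)) 1 |>
      fun h => add_le_add_left h (2 * ε N / ρ₂))
    field_simp
    ring
  · have e := hε N
    have h2 := laplace_le (hlam N) (hB N) (hint N) (θ := 2 * ε N / ρ₂) (by positivity)
    simp only
    rw [div_le_iff₀ (by positivity)]
    rw [hload] at h2
    refine (add_le_add_left (sub_le_sub_right h2 1) (2 * ε N / ρ₂)).trans (le_of_eq ?_)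
    field_simp
    ring

variable {Ω : ℕ → Type*} [∀ N, MeasurableSpace (Ω N)] {μ : ∀ N, Measure (Ω N)}
  [∀ N, IsProbabilityMeasure (μ N)] {τ χ : ∀ N, ℕ → Ω N → ℝ} {ζ : ∀ N, ℕ → Ω N → ℕ}
  {mark : ∀ N, ℕ → Ω N → Bool} {p : ℕ → ℝ} {law : ℕ → ℕ → ℝ≥0∞}

/-- The expected remaining length of the busy period, uniformly in `N`. -/
lemma exists_sum_busyProb_le [∀ N, IsProbabilityMeasure (B N)]
    (hsys : ∀ N, IsLossSystem (μ N) (lam N) (B N) (p N) (law N) (τ N) (χ N) (ζ N) (mark N))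
    (hlam : ∀ N, 0 < lam N) (hB : ∀ N, B N (Set.Iio 0) = 0)
    (hint : ∀ N, Integrable (fun x => x ^ 3) (B N)) (hε : ∀ N, 0 < ε N)
    (hε0 : Tendsto ε atTop (𝓝 0)) (hload : ∀ N, loadMoment (lam N) (B N) 1 = 1 + ε N)
    (hM : ∀ N, loadMoment (lam N) (B N) 3 ≤ M) {c : ℝ}
    (hεN : Tendsto (fun N : ℕ => ε N * N) atTop (𝓝 c))
    (hζN : ∀ N, ∀ᵐ ω ∂(μ N), ∀ i, ζ N i ω ≤ N) :
    ∃ K : ℝ, 0 < K ∧ ∀ᶠ N in atTop, ∀ L n, L ≤ n →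
      ∑ i ∈ Finset.Ico L n, busyProb (μ N) (τ N) (χ N) (ζ N) i ≤
        K * (busyProb (μ N) (τ N) (χ N) (ζ N) L / ε N ^ 2 +
          Real.exp 1 * (lam N * workMean (μ N) (τ N) (χ N) (ζ N) L)) := by
  have hM0 : 0 ≤ M := (loadMoment_nonneg (hlam 0) (hB 0) 3).trans (hM 0)
  set k := Real.exp (-(8 * (c + 1)) - 1) with hk
  have hk0 : 0 < k := Real.exp_pos _
  set a := 2 * Real.exp 1 * M / k + 1 with ha
  have ha1 : 1 ≤ a := by
    have : 0 ≤ 2 * Real.exp 1 * M / k := by positivity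
    linarith
  refine ⟨2 / k, by positivity, ?_⟩
  have l1 : Tendsto (fun N => 4 * ε N * (a + 1)) atTop (𝓝 0) := by
    simpa using (hε0.const_mul 4).mul_const (a + 1)
  filter_upwards [sq_le_laplace_sub hlam hB hint hε hε0 hload hM,
    l1.eventually (gt_mem_nhds (show (0 : ℝ) < 1 by norm_num)),
    hεN.eventually (gt_mem_nhds (show c < c + 1 by linarith)),
    hε0.eventually (gt_mem_nhds (show (0 : ℝ) < 1 / 8 by norm_num))] with N h1 h2 h3 h4 L n hLn
  have e := hε N
  refine (hsys N).sum_busyProb_le (hB N) (hlam N) (hint N) (hζN N) (θ := 4 * ε N) (a := a)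
    (by positivity) (by linarith) (by linarith) (by positivity) h1 hk0 ?_ ?_ hLn
  · have h5 : Real.exp (-(8 * ε N)) ≤ laplace (lam N) (B N) (4 * ε N) := by
      -- `exp (-2 x) ≤ 1 - x` for `x ≤ 1 / 2`
      have h6 : 1 - 4 * ε N ≤ laplace (lam N) (B N) (4 * ε N) := by
        have : 0 < ε N ^ 2 := by positivity
        linarith
      refine le_trans ?_ h6
      have := exp_neg_le_quadratic (y := 8 * ε N) (by positivity)
      nlinarith
    calc k ≤ Real.exp (-(4 * ε N * (a + 1)) + -(8 * ε N) * N) := by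
          refine Real.exp_le_exp.2 ?_
          nlinarith
      _ = Real.exp (-(4 * ε N * (a + 1))) * Real.exp (-(8 * ε N)) ^ N := by
          rw [← Real.exp_nat_mul, ← Real.exp_add]; congr 1; ring
      _ ≤ _ := by gcongr
  · have h5 : M / a ^ 2 ≤ M / a :=
      div_le_div_of_nonneg_left hM0 (by linarith) (by nlinarith)
    have h6 : loadMoment (lam N) (B N) 3 / a ^ 2 ≤ M / a ^ 2 := by
      have := hM N
      gcongr
    have h7 : 2 * (Real.exp 1 * (M / a)) ≤ k := by
      have e1 : 2 * (Real.exp 1 * (M / a)) = 2 * Real.exp 1 * M / a := by ring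
      rw [e1, div_le_iff₀ (by linarith)]
      have : k * a = 2 * Real.exp 1 * M + k := by rw [ha]; field_simp
      linarith
    have h8 : Real.exp 1 * (loadMoment (lam N) (B N) 3 / a ^ 2) ≤ Real.exp 1 * (M / a) :=
      mul_le_mul_of_nonneg_left (h6.trans h5) (Real.exp_nonneg _)
    linarith

/-- The case `L = 0`: the busy period starts with an empty system, so `workMean` vanishes. -/
lemma summable_of_sum_busyProb_le {Ω : Type*} [MeasurableSpace Ω] {μ : Measure Ω}
    [IsProbabilityMeasure μ] {τ χ : ℕ → Ω → ℝ} {ζ : ℕ → Ω → ℕ} {lam K e : ℝ}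
    (hK : ∀ L n, L ≤ n → ∑ i ∈ Finset.Ico L n, busyProb μ τ χ ζ i ≤
        K * (busyProb μ τ χ ζ L / e ^ 2 + Real.exp 1 * (lam * workMean μ τ χ ζ L))) :
    Summable (busyProb μ τ χ ζ) ∧ ∑' i, busyProb μ τ χ ζ i ≤ K / e ^ 2 := by
  have h1 : ∀ n, ∑ i ∈ Finset.range n, busyProb μ τ χ ζ i ≤ K / e ^ 2 := by
    intro n
    have := hK 0 n (Nat.zero_le n)
    rw [← Finset.range_eq_Ico, IsLossSystem.busyProb_zero, IsLossSystem.workMean_zero] at this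
    refine this.trans (le_of_eq ?_)
    ring
  exact ⟨summable_of_sum_range_le IsLossSystem.busyProb_nonneg h1,
    Real.tsum_le_of_sum_range_le IsLossSystem.busyProb_nonneg h1⟩

/-- Messages that arrive after an exceptional admission threshold are negligible. -/
lemma tendsto_badProb
    (hsys : ∀ N, IsLossSystem (μ N) (lam N) (B N) (p N) (law N) (τ N) (χ N) (ζ N) (mark N))
    (hlam : ∀ N, 0 < lam N) (hB : ∀ N, B N (Set.Iio 0) = 0)
    (hint : ∀ N, Integrable (fun x => x ^ 3) (B N)) (hε : ∀ N, 0 < ε N)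
    (hM : ∀ N, loadMoment (lam N) (B N) 3 ≤ M) {c : ℝ} (hc : 0 < c)
    (hεN : Tendsto (fun N : ℕ => ε N * N) atTop (𝓝 c))
    (hζN : ∀ N, ∀ᵐ ω ∂(μ N), ∀ i, ζ N i ω ≤ N) {K : ℝ} (hK0 : 0 < K)
    (hK : ∀ᶠ N in atTop, ∀ L n, L ≤ n →
      ∑ i ∈ Finset.Ico L n, busyProb (μ N) (τ N) (χ N) (ζ N) i ≤
        K * (busyProb (μ N) (τ N) (χ N) (ζ N) L / ε N ^ 2 +
          Real.exp 1 * (lam N * workMean (μ N) (τ N) (χ N) (ζ N) L)))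
    {a b : ℕ → ℕ} {β : ℕ → ℝ} (hβ0 : ∀ N, 0 ≤ β N)
    (hβ : ∀ k : ℕ, Tendsto (fun N : ℕ => (N : ℝ) ^ k * β N) atTop (𝓝 0))
    (hbad : ∀ᶠ N in atTop, ∀ j, μ N {ω | ¬ (a N ≤ ζ N j ω ∧ ζ N j ω ≤ b N)} ≤
      ENNReal.ofReal (β N)) :
    Tendsto (fun N => ∑' i, badProb (μ N) (τ N) (χ N) (ζ N) (a N) (b N) i) atTop (𝓝 0) := by
  have hM0 : 0 ≤ M := (loadMoment_nonneg (hlam 0) (hB 0) 3).trans (hM 0)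
  set K₁ := 4 / c ^ 2 with hK₁
  have hK₁0 : 0 < K₁ := by positivity
  set K₂ := K * (K * K₁ ^ 2 + Real.exp 1 * (2 * (K * K₁) + M)) with hK₂
  have hlim : Tendsto (fun N : ℕ => (N : ℝ) ^ 32 * β N + K₂ / N) atTop (𝓝 0) := by
    simpa using (hβ 32).add (tendsto_const_div_atTop_nhds_zero_nat K₂)
  refine squeeze_zero' (Eventually.of_forall fun N => tsum_nonneg fun i => ENNReal.toReal_nonneg)
    ?_ hlim
  filter_upwards [hK, hbad, hεN.eventually (lt_mem_nhds (show c / 2 < c by linarith)),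
    eventually_gt_atTop 0] with N h1 h2 h3 hN0
  have hN1 : (1 : ℝ) ≤ N := by exact_mod_cast hN0
  have hN0' : (0 : ℝ) < N := by linarith
  have e := hε N
  obtain ⟨hs, hV⟩ := summable_of_sum_busyProb_le h1
  set v := busyProb (μ N) (τ N) (χ N) (ζ N)
  have hεi : 1 / ε N ^ 2 ≤ K₁ * N ^ 2 := by
    rw [hK₁, div_le_iff₀ (by positivity)]
    have h4 : (c / 2) ^ 2 ≤ (ε N * N) ^ 2 := pow_le_pow_left₀ (by positivity) h3.le 2
    have e1 : 4 / c ^ 2 * (N : ℝ) ^ 2 * ε N ^ 2 = 4 / c ^ 2 * (ε N * N) ^ 2 := by ring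
    rw [e1]
    have := mul_le_mul_of_nonneg_left h4 (a := 4 / c ^ 2) (by positivity)
    refine le_trans (le_of_eq ?_) this
    field_simp
    norm_num
  have hV2 : ∑' i, v i ≤ K * K₁ * N ^ 2 := by
    refine hV.trans ?_
    have := mul_le_mul_of_nonneg_left hεi hK0.le
    refine le_trans (le_of_eq ?_) (this.trans_eq ?_) <;> ring
  have hv0 : 0 ≤ ∑' i, v i := tsum_nonneg IsLossSystem.busyProb_nonneg
  -- The tail after message `L = N ^ 16`. The expected length `V` of the busy period is `O (N ^ 2)`,
  -- so that `busyProb L ≤ V / L`, divided by `ε ^ 2`, is small; and by `workMean_pow_le` with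
  -- `m = N ^ 4` the mean workload is `O (N V / N ^ 4)`.
  have hX : ∀ n, (N ^ 4) ^ 4 ≤ n → ∑ i ∈ Finset.Ico ((N ^ 4) ^ 4) n, v i ≤ K₂ / N := by
    intro n hn
    refine (h1 _ n hn).trans ?_
    have t1 := antitone_mul_le_tsum IsLossSystem.busyProb_nonneg IsLossSystem.antitone_busyProb hs
      ((N ^ 4) ^ 4)
    have t2 := (hsys N).workMean_pow_le (hB N) (hlam N) (hint N) (hζN N) hs (m := N ^ 4)
      (by positivity)
    push_cast at t1 t2
    have s1 : v ((N ^ 4) ^ 4) / ε N ^ 2 ≤ K * K₁ ^ 2 / N := by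
      have u1 : v ((N ^ 4) ^ 4) ≤ K * K₁ / N ^ 14 := by
        rw [le_div_iff₀ (by positivity)]
        have u2 : ((N : ℝ) ^ 4) ^ 4 * v ((N ^ 4) ^ 4) ≤ K * K₁ * N ^ 2 := t1.trans hV2
        have u3 : ((N : ℝ) ^ 4) ^ 4 * v ((N ^ 4) ^ 4) =
            (v ((N ^ 4) ^ 4) * (N : ℝ) ^ 14) * N ^ 2 := by ring
        rw [u3] at u2
        exact le_of_mul_le_mul_right u2 (by positivity)
      calc v ((N ^ 4) ^ 4) / ε N ^ 2 = v ((N ^ 4) ^ 4) * (1 / ε N ^ 2) := by ring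
        _ ≤ K * K₁ / N ^ 14 * (K₁ * N ^ 2) := by gcongr
        _ = K * K₁ ^ 2 / N ^ 12 := by field_simp
        _ ≤ K * K₁ ^ 2 / N := by
            refine div_le_div_of_nonneg_left (by positivity) hN0' ?_
            exact le_self_pow₀ hN1 (by norm_num)
    have s2 : lam N * workMean (μ N) (τ N) (χ N) (ζ N) ((N ^ 4) ^ 4) ≤
        (2 * (K * K₁) + M) / N := by
      refine t2.trans ?_
      rw [div_le_div_iff₀ (by positivity) hN0']
      have w1 : (N + 1) * ∑' i, v i ≤ (2 * N) * (K * K₁ * N ^ 2) := by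
        have : (N : ℝ) + 1 ≤ 2 * N := by linarith
        gcongr
      have w2 := hM N
      have w3 : M ≤ M * N ^ 3 := le_mul_of_one_le_right hM0 (one_le_pow₀ hN1)
      have w4 : (N + 1) * ∑' i, v i + loadMoment (lam N) (B N) 3 ≤
          (2 * (K * K₁) + M) * N ^ 3 := by nlinarith
      calc ((N + 1) * ∑' i, v i + loadMoment (lam N) (B N) 3) * N
          ≤ (2 * (K * K₁) + M) * N ^ 3 * N := by gcongr
        _ = (2 * (K * K₁) + M) * N ^ 4 := by ring
    calc K * (v ((N ^ 4) ^ 4) / ε N ^ 2 +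
          Real.exp 1 * (lam N * workMean (μ N) (τ N) (χ N) (ζ N) ((N ^ 4) ^ 4)))
        ≤ K * (K * K₁ ^ 2 / N + Real.exp 1 * ((2 * (K * K₁) + M) / N)) := by gcongr
      _ = K₂ / N := by rw [hK₂]; ring
  have := ((hsys N).tsum_badProb_le (hβ0 N) h2 hs hX).2
  refine this.trans (le_of_eq ?_)
  push_cast; ring

end regime

/-! ### The expected numbers of refused and processed messages -/

/-- The linear relations between the expected number of refused messages, the expected number of
processed messages and the sum of `exp (-θ λ W)` over the refused messages. -/
lemma IsLossSystem.balance {Ω : Type*} [MeasurableSpace Ω] {μ : Measure Ω} [IsProbabilityMeasure μ]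
    {lam : ℝ} {B : Measure ℝ} {p : ℝ} {law : ℕ → ℝ≥0∞} {τ χ : ℕ → Ω → ℝ} {ζ : ℕ → Ω → ℕ}
    {mark : ℕ → Ω → Bool} (h : IsLossSystem μ lam B p law τ χ ζ mark) (hB : B (Set.Iio 0) = 0)
    (hlam : 0 < lam) (hint : Integrable (fun x => x ^ 3) B) (hs : Summable (busyProb μ τ χ ζ))
    {θ a : ℝ} (hθ : 0 < θ) (hθ1 : θ < 1) (ha : 0 < a) (lo hi : ℕ) :
    |1 - ∑' i, refR μ τ χ ζ (θ * lam) i| ≤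
        |laplace lam B θ - 1 + θ| / θ * ∑' i, accR μ τ χ ζ 0 i ∧
      ∑' i, refR μ τ χ ζ (θ * lam) i ≤
        laplace lam B θ ^ lo * ∑' i, refR μ τ χ ζ 0 i + ∑' i, badProb μ τ χ ζ lo hi i ∧
      Real.exp (-(θ * (a + 1))) * laplace lam B θ ^ hi * ∑' i, refR μ τ χ ζ 0 i ≤
        ∑' i, refR μ τ χ ζ (θ * lam) i +
          Real.exp 1 * (loadMoment lam B 3 / a ^ 2) * ∑' i, accR μ τ χ ζ 0 i +
          ∑' i, badProb μ τ χ ζ lo hi i := by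
  have hθl : 0 ≤ θ * lam := by positivity
  have sa := h.summable_accR hB hs le_rfl
  have sr := h.summable_refR hB hs le_rfl
  have sa' := h.summable_accR hB hs hθl
  have sr' := h.summable_refR hB hs hθl
  have sb : Summable (badProb μ τ χ ζ lo hi) :=
    hs.of_nonneg_of_le (fun i => ENNReal.toReal_nonneg) fun i => badProb_le_busyProb lo hi i
  obtain ⟨sh, hh⟩ := h.summable_headProb hB hlam hint hs ha
  refine ⟨?_, ?_, ?_⟩
  · have key := h.tsum_exp_balance hB hlam hs hθ.le hθ1
    have h1 : ∑' i, accR μ τ χ ζ (θ * lam) i ≤ ∑' i, accR μ τ χ ζ 0 i :=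
      sa'.tsum_le_tsum (fun i => h.accR_le hB hθl i) sa
    have h0 : 0 ≤ ∑' i, accR μ τ χ ζ (θ * lam) i := tsum_nonneg (accR_nonneg _)
    have e : 1 - ∑' i, refR μ τ χ ζ (θ * lam) i =
        (laplace lam B θ - 1 + θ) / θ * ∑' i, accR μ τ χ ζ (θ * lam) i := by
      field_simp
      linarith
    rw [e, abs_mul, abs_div, abs_of_pos hθ, abs_of_nonneg h0]
    gcongr
  · rw [← tsum_mul_left, ← (sr.mul_left _).tsum_add sb]
    exact sr'.tsum_le_tsum (fun i => h.refR_le_add_badProb hB hlam hθ.le lo hi i)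
      ((sr.mul_left _).add sb)
  · have h1 := (sr.mul_left (Real.exp (-(θ * (a + 1))) * laplace lam B θ ^ hi)).tsum_le_tsum
      (fun i => h.le_refR_add_badProb hB hlam hθ.le (by positivity : 0 ≤ a + 1) lo hi i)
      ((sr'.add sh).add sb)
    rw [tsum_mul_left, (sr'.add sh).tsum_add sb, sr'.tsum_add sh] at h1
    linarith

section regime

variable {lam : ℕ → ℝ} {B : ℕ → Measure ℝ} {ε : ℕ → ℝ} {M : ℝ}
  {Ω : ℕ → Type*} [∀ N, MeasurableSpace (Ω N)] {μ : ∀ N, Measure (Ω N)}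
  [∀ N, IsProbabilityMeasure (μ N)] {τ χ : ∀ N, ℕ → Ω N → ℝ} {ζ : ∀ N, ℕ → Ω N → ℕ}
  {mark : ∀ N, ℕ → Ω N → Bool} {p : ℕ → ℝ} {law : ℕ → ℕ → ℝ≥0∞}

/-- The expected number of refused messages converges to `exp (2 C / ρ₂)`. -/
lemma tendsto_tsum_refR [∀ N, IsProbabilityMeasure (B N)]
    (hsys : ∀ N, IsLossSystem (μ N) (lam N) (B N) (p N) (law N) (τ N) (χ N) (ζ N) (mark N))
    (hlam : ∀ N, 0 < lam N) (hB : ∀ N, B N (Set.Iio 0) = 0)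
    (hint : ∀ N, Integrable (fun x => x ^ 3) (B N)) (hε : ∀ N, 0 < ε N)
    (hε0 : Tendsto ε atTop (𝓝 0)) (hload : ∀ N, loadMoment (lam N) (B N) 1 = 1 + ε N)
    (hM : ∀ N, loadMoment (lam N) (B N) 3 ≤ M) {ρ₂ C : ℝ} (hρ : 0 < ρ₂)
    (hρ₂ : Tendsto (fun N => loadMoment (lam N) (B N) 2) atTop (𝓝 ρ₂))
    (hs : ∀ᶠ N in atTop, Summable (busyProb (μ N) (τ N) (χ N) (ζ N)))
    (hR : ∀ᶠ N in atTop, ∑' i, refR (μ N) (τ N) (χ N) (ζ N) 0 i =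
      1 + ε N * ∑' i, accR (μ N) (τ N) (χ N) (ζ N) 0 i)
    {a b : ℕ → ℕ} (ha : Tendsto (fun N => ε N * a N) atTop (𝓝 C))
    (hb : Tendsto (fun N => ε N * b N) atTop (𝓝 C))
    (hbad : Tendsto (fun N => ∑' i, badProb (μ N) (τ N) (χ N) (ζ N) (a N) (b N) i) atTop (𝓝 0)) :
    Tendsto (fun N => ∑' i, refR (μ N) (τ N) (χ N) (ζ N) 0 i) atTop
      (𝓝 (Real.exp (2 * C / ρ₂))) := by
  have hM0 : 0 ≤ M := (loadMoment_nonneg (hlam 0) (hB 0) 3).trans (hM 0)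
  set δ : ℕ → ℝ := fun N => laplace (lam N) (B N) (2 * ε N / ρ₂) - 1 + 2 * ε N / ρ₂ with hδ
  have hδ0 : Tendsto (fun N => δ N / ε N ^ 2) atTop (𝓝 0) :=
    tendsto_laplace_sub hlam hB hint hε hε0 hload hM hρ hρ₂
  -- the residual service time at the head of the queue is compared with `(r + 1) / λ`, where
  -- `r ε → 0` and `1 / r ^ 2 = o (ε)`
  set r : ℕ → ℝ := fun N => (√(ε N) * √√(ε N))⁻¹ with hr
  have hsq : Tendsto (fun N => √(ε N)) atTop (𝓝 0) := by
    simpa using hε0.sqrt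
  have hsq2 : Tendsto (fun N => √√(ε N)) atTop (𝓝 0) := by
    simpa using hsq.sqrt
  have hrε : ∀ N, r N * ε N = √√(ε N) := fun N => by
    have h1 : 0 < √(ε N) := Real.sqrt_pos.2 (hε N)
    have h2 : 0 < √√(ε N) := Real.sqrt_pos.2 h1
    have e1 := Real.mul_self_sqrt (hε N).le
    have e2 := Real.mul_self_sqrt h1.le
    simp only [hr]
    rw [inv_mul_eq_iff_eq_mul₀ (by positivity)]
    rw [mul_assoc, e2, e1]
  have hr2 : ∀ N, 1 / r N ^ 2 = ε N * √(ε N) := fun N => by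
    simp only [hr]
    rw [inv_pow, one_div, inv_inv, mul_pow, Real.sq_sqrt (hε N).le,
      Real.sq_sqrt (Real.sqrt_nonneg _)]
  have hr0 : ∀ N, 0 < r N := fun N => by
    have h1 : 0 < √(ε N) := Real.sqrt_pos.2 (hε N)
    have h2 : 0 < √√(ε N) := Real.sqrt_pos.2 h1
    simp only [hr]
    positivity
  have hx : Tendsto (fun N => (1 - laplace (lam N) (B N) (2 * ε N / ρ₂)) / ε N) atTop
      (𝓝 (2 / ρ₂)) := by
    have h1 := (hδ0.mul hε0).const_sub (2 / ρ₂)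
    rw [zero_mul, sub_zero] at h1
    refine h1.congr fun N => ?_
    have := (hε N).ne'
    simp only [hδ]
    field_simp
    ring
  have eQ : 2 / ρ₂ * C = 2 * C / ρ₂ := by ring
  have hpow : ∀ n : ℕ → ℕ, Tendsto (fun N => ε N * n N) atTop (𝓝 C) →
      Tendsto (fun N => laplace (lam N) (B N) (2 * ε N / ρ₂) ^ n N) atTop
        (𝓝 (Real.exp (-(2 * C / ρ₂)))) := fun n hn => by
    have := tendsto_one_sub_pow hε hε0 hx hn
    rw [eQ] at this
    simpa using this
  have hexp : Tendsto (fun N => Real.exp (-(2 * ε N / ρ₂ * (r N + 1)))) atTop (𝓝 1) := by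
    have h1 : Tendsto (fun N => -(2 / ρ₂ * (√√(ε N) + ε N))) atTop (𝓝 0) := by
      simpa using ((hsq2.add hε0).const_mul (2 / ρ₂)).neg
    have h2 := (Real.continuous_exp.tendsto 0).comp h1
    rw [Real.exp_zero] at h2
    refine h2.congr fun N => ?_
    simp only [Function.comp]
    rw [← hrε N]
    congr 1
    ring
  have hq' := hexp.mul (hpow b hb)
  rw [one_mul] at hq'
  have hη : Tendsto (fun N => ρ₂ / 2 * |δ N / ε N ^ 2|) atTop (𝓝 0) := by
    simpa using hδ0.abs.const_mul (ρ₂ / 2)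
  have hh : Tendsto (fun N => Real.exp 1 * M * √(ε N)) atTop (𝓝 0) := by
    simpa using hsq.const_mul (Real.exp 1 * M)
  have hθ1 : ∀ᶠ N in atTop, 2 * ε N / ρ₂ < 1 := by
    have h1 : Tendsto (fun N => 2 * ε N / ρ₂) atTop (𝓝 0) := by
      simpa using (hε0.const_mul 2).div_const ρ₂
    exact h1.eventually (gt_mem_nhds one_pos)
  have hbal := (hs.and hθ1).mono fun N hN =>
    (hsys N).balance (hB N) (hlam N) (hint N) hN.1 (θ := 2 * ε N / ρ₂)
      (by have := hε N; positivity) hN.2 (hr0 N) (a N) (b N)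
  have hεX : ∀ᶠ N in atTop, ε N * ∑' i, accR (μ N) (τ N) (χ N) (ζ N) 0 i ≤
      ∑' i, refR (μ N) (τ N) (χ N) (ζ N) 0 i := by
    filter_upwards [hR] with N h1
    linarith
  have key := tendsto_of_balance (Real.exp_pos _) (hpow a ha) hq' hη hbad hh
    (S := fun N => ∑' i, refR (μ N) (τ N) (χ N) (ζ N) (2 * ε N / ρ₂ * lam N) i)
    (R := fun N => ∑' i, refR (μ N) (τ N) (χ N) (ζ N) 0 i) ?_ ?_ ?_
  · rwa [Real.exp_neg, one_div, inv_inv] at key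
  · filter_upwards [hbal, hεX] with N h1 h2
    refine h1.1.trans ?_
    have := hε N
    calc _ = ρ₂ / 2 * |δ N / ε N ^ 2| * (ε N * ∑' i, accR (μ N) (τ N) (χ N) (ζ N) 0 i) := by
          rw [abs_div, abs_of_pos (by positivity : 0 < ε N ^ 2)]
          simp only [hδ]
          field_simp
      _ ≤ _ := by gcongr
  · filter_upwards [hbal] with N h1
    exact h1.2.1
  · filter_upwards [hbal, hεX] with N h1 h2
    refine h1.2.2.trans ?_
    refine add_le_add_left (add_le_add_right ?_ _) _
    have hX : 0 ≤ ∑' i, accR (μ N) (τ N) (χ N) (ζ N) 0 i := tsum_nonneg (IsLossSystem.accR_nonneg _)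
    have e : loadMoment (lam N) (B N) 3 / r N ^ 2 =
        loadMoment (lam N) (B N) 3 * (ε N * √(ε N)) := by rw [← hr2]; ring
    calc _ ≤ Real.exp 1 * (M * (ε N * √(ε N))) * ∑' i, accR (μ N) (τ N) (χ N) (ζ N) 0 i := by
          rw [e]
          have := hM N
          have := hε N
          gcongr
      _ = Real.exp 1 * M * √(ε N) * (ε N * ∑' i, accR (μ N) (τ N) (χ N) (ζ N) 0 i) := by ring
      _ ≤ _ := by gcongr

end regime

/-- The expansion of the loss probability, from the limit `E` of the expected number `R` of refused
messages and the relation `R = 1 + ε X` to the expected number `X` of processed messages. -/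
lemma loss_asymptotics {L p ε R X : ℕ → ℝ} {E : ℝ} (hE : 1 < E) (hε : ∀ N, 0 < ε N)
    (hε0 : Tendsto ε atTop (𝓝 0)) (hp : ∀ N, 0 ≤ p N ∧ p N ≤ 1)
    (hR : Tendsto R atTop (𝓝 E)) (hRX : ∀ᶠ N in atTop, R N = 1 + ε N * X N)
    (hL : ∀ᶠ N in atTop, L N = (R N + p N * X N) / (R N + X N)) :
    (∀ D : ℝ, Tendsto (fun N => p N / ε N) atTop (𝓝 D) →
      (fun N => L N - (D + E / (E - 1)) * ε N) =o[atTop] ε) ∧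
    (fun N => L N - p N) =O[atTop] ε := by
  have hE1 : E - 1 ≠ 0 := by linarith
  have hden : Tendsto (fun N => ε N * R N + (R N - 1)) atTop (𝓝 (E - 1)) := by
    simpa using (hε0.mul hR).add (hR.sub_const 1)
  have hpos := hden.eventually (lt_mem_nhds (show 0 < E - 1 by linarith))
  constructor
  · intro D hD
    have l1 : Tendsto (fun N => (R N + p N / ε N * (R N - 1)) / (ε N * R N + (R N - 1))) atTop
        (𝓝 ((E + D * (E - 1)) / (E - 1))) :=
      (hR.add (hD.mul (hR.sub_const 1))).div hden hE1
    have e : (E + D * (E - 1)) / (E - 1) = D + E / (E - 1) := by field_simp; ring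
    rw [e] at l1
    refine (isLittleO_iff_tendsto fun N hN => absurd hN (hε N).ne').2 ?_
    have l2 := l1.sub_const (D + E / (E - 1))
    rw [sub_self] at l2
    refine l2.congr' ?_
    filter_upwards [hRX, hL, hpos] with N h1 h2 h3
    have := hε N
    have e1 : R N - 1 = ε N * X N := by linarith
    rw [e1] at h3 ⊢
    have h4 : ε N * R N + ε N * X N = ε N * (R N + X N) := by ring
    rw [h4] at h3 ⊢
    have h5 : 0 < R N + X N := pos_of_mul_pos_right h3 this.le
    rw [h2]
    field_simp
  · have l1 : Tendsto (fun N => R N / (ε N * R N + (R N - 1))) atTop (𝓝 (E / (E - 1))) :=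
      hR.div hden hE1
    refine IsBigO.of_bound (E / (E - 1) + 1) ?_
    filter_upwards [hRX, hL, hpos, hR.eventually (lt_mem_nhds (show 0 < E by linarith)),
      l1.eventually (gt_mem_nhds (show E / (E - 1) < E / (E - 1) + 1 by linarith))]
      with N h1 h2 h3 hR0 h6
    have := hε N
    have e1 : R N - 1 = ε N * X N := by linarith
    rw [e1] at h3 h6
    have h4 : ε N * R N + ε N * X N = ε N * (R N + X N) := by ring
    rw [h4] at h3 h6
    have h5 : 0 < R N + X N := pos_of_mul_pos_right h3 this.le
    have h7 : L N - p N = (1 - p N) * (R N / (ε N * (R N + X N)) * ε N) := by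
      rw [h2]
      field_simp
      ring
    have h8 : 0 ≤ R N / (ε N * (R N + X N)) * ε N := by positivity
    rw [h7, Real.norm_of_nonneg (mul_nonneg (by linarith [(hp N).2]) h8),
      Real.norm_of_nonneg this.le]
    calc (1 - p N) * (R N / (ε N * (R N + X N)) * ε N)
        ≤ 1 * (R N / (ε N * (R N + X N)) * ε N) := by
          gcongr
          linarith [(hp N).1]
      _ ≤ _ := by rw [one_mul]; gcongr

end LossQueue

theorem theorem5p3
    -- numbers of packets in a message, on one probability space
    {Ω₀ : Type*} [MeasurableSpace Ω₀] (P₀ : Measure Ω₀) [IsProbabilityMeasure P₀]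
    (ν : ℕ → Ω₀ → ℕ) (νlower νupper : ℕ)
    (hν : LossQueue.IsPacketSequence P₀ ν νlower νupper)
    -- for every buffer size `N`, the parameters of the system and the system itself
    (lam : ℕ → ℝ) (hlam : ∀ N, 0 < lam N)
    (B : ℕ → Measure ℝ) [∀ N, IsProbabilityMeasure (B N)] (hB : ∀ N, B N (Set.Iio 0) = 0)
    (p : ℕ → ℝ) (hp : ∀ N, 0 ≤ p N ∧ p N ≤ 1)
    {Ω : ℕ → Type*} [∀ N, MeasurableSpace (Ω N)]
    (μ : ∀ N, Measure (Ω N)) [∀ N, IsProbabilityMeasure (μ N)]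
    (τ χ : ∀ N, ℕ → Ω N → ℝ) (ζ : ∀ N, ℕ → Ω N → ℕ) (mark : ∀ N, ℕ → Ω N → Bool)
    (hsys : ∀ N, LossQueue.IsLossSystem (μ N) (lam N) (B N) (p N)
      (fun j => P₀ {ω | LossQueue.bufferSize (ν · ω) N = j}) (τ N) (χ N) (ζ N) (mark N))
    -- the asymptotic regime
    (ε : ℕ → ℝ) (hε : ∀ N, 0 < ε N) (hε0 : Tendsto ε atTop (𝓝 0))
    (hload : ∀ N, LossQueue.loadMoment (lam N) (B N) 1 = 1 + ε N)
    (C : ℝ) (hC : 0 < C)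
    (hζ : ∀ᵐ ω ∂P₀,
      Tendsto (fun N => ε N * (LossQueue.bufferSize (ν · ω) N : ℝ)) atTop (𝓝 C))
    (hp0 : Tendsto p atTop (𝓝 0))
    (hint : ∀ N, Integrable (fun x => x ^ 3) (B N))
    (hbdd : ∃ M : ℝ, ∀ N, LossQueue.loadMoment (lam N) (B N) 3 ≤ M)
    (ρ₂ : ℝ) (hρ₂ : Tendsto (fun N => LossQueue.loadMoment (lam N) (B N) 2) atTop (𝓝 ρ₂)) :
    (∀ D : ℝ, 0 ≤ D → Tendsto (fun N => p N / ε N) atTop (𝓝 D) →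
      (fun N => LossQueue.lossProbability (μ N) (τ N) (χ N) (ζ N) (mark N) -
          (D + Real.exp (2 * C / ρ₂) / (Real.exp (2 * C / ρ₂) - 1)) * ε N) =o[atTop] ε) ∧
    (Tendsto (fun N => p N / ε N) atTop atTop →
      (fun N => LossQueue.lossProbability (μ N) (τ N) (χ N) (ζ N) (mark N) - p N)
        =O[atTop] ε) := by

  open LossQueue in
  obtain ⟨M, hM⟩ := hbdd
  obtain ⟨m, a, b, β, hm, ha, hb, hβ0, hβ, hbad⟩ := hν.exists_thresholds
  have hεN := IsPacketSequence.tendsto_mul_nat hm ha hb hβ0 hβ hbad hζ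
  have hmeas := hν.aemeasurable_bufferSize
  have hζN : ∀ N, ∀ᵐ ω ∂(μ N), ∀ i, ζ N i ω ≤ N := fun N => by
    rw [ae_all_iff]
    intro i
    rw [ae_iff]
    refine ((hsys N).measure_ζ_preimage (hmeas N) i {n | ¬ n ≤ N}).trans ?_
    rw [← compl_mem_ae_iff]
    filter_upwards [hν.ae_one_le] with ω hω
    exact not_not.2 (bufferSize_le hω N)
  have hbad' : ∀ᶠ N in atTop, ∀ j, μ N {ω | ¬ (a N ≤ ζ N j ω ∧ ζ N j ω ≤ b N)} ≤
      ENNReal.ofReal (β N) := by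
    filter_upwards [hbad] with N hN j
    exact ((hsys N).measure_ζ_preimage (hmeas N) j {n | ¬ (a N ≤ n ∧ n ≤ b N)}).trans_le hN
  obtain ⟨K, hK0, hK⟩ := exists_sum_busyProb_le hsys hlam hB hint hε hε0 hload hM hεN hζN
  have hbad0 := tendsto_badProb hsys hlam hB hint hε hM (by positivity : 0 < C * m) hεN hζN hK0 hK
    hβ0 hβ hbad'
  have hs : ∀ᶠ N in atTop, Summable (busyProb (μ N) (τ N) (χ N) (ζ N)) := by
    filter_upwards [hK] with N hN
    exact (summable_of_sum_busyProb_le hN).1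
  have hR : ∀ᶠ N in atTop, ∑' i, refR (μ N) (τ N) (χ N) (ζ N) 0 i =
      1 + ε N * ∑' i, accR (μ N) (τ N) (χ N) (ζ N) 0 i := by
    filter_upwards [hs] with N hN
    rw [(hsys N).tsum_refR_eq (hB N) (hlam N) (hint N) (hζN N) hN, hload]
    ring
  have hρ : 1 ≤ ρ₂ := by
    refine ge_of_tendsto' hρ₂ fun N => ?_
    have h1 := two_mul_loadMoment_one_sub_one_le (lam := lam N) (hB N) (hint N)
    rw [hload] at h1
    linarith [hε N]
  have hρ0 : 0 < ρ₂ := by linarith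
  have hmul : ∀ n : ℕ → ℕ, Tendsto (fun N => (n N : ℝ) / N) atTop (𝓝 (1 / m)) →
      Tendsto (fun N => ε N * n N) atTop (𝓝 C) := fun n hn => by
    have h1 := hεN.mul hn
    have e : C * m * (1 / m) = C := by field_simp
    rw [e] at h1
    refine h1.congr' ?_
    filter_upwards [eventually_gt_atTop 0] with N hN
    have : (0 : ℝ) < N := by exact_mod_cast hN
    field_simp
  have hlim := tendsto_tsum_refR hsys hlam hB hint hε hε0 hload hM hρ0 hρ₂ hs hR (hmul a ha)
    (hmul b hb) hbad0
  have hL := hs.mono fun N hN => (hsys N).lossProbability_eq (hB N) (hp N).1 hN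
  have key := loss_asymptotics (Real.one_lt_exp_iff.2 (by positivity)) hε hε0 hp hlim hR hL
  exact ⟨fun D _ hD => key.1 D hD, fun _ => key.2⟩
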